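/- Let $G$ be a second countable, locally compact Hausdorff groupoid with unit space $G^0$, range and source maps $r,s$, and a left Haar system $\{\lambda^u\}_{u\in G^0}$; put $G^u=r^{-1}(\{u\})$. For $f,g\in C_c(G)$ let $$(f*g)(x)=\int f(t)\,g(t^{-1}x)\,d\lambda^{r(x)}(t)\qquad(x\in G).$$ A section $u\mapsto\xi^u\in L^2(G^u,\lambda^u)$ over $G^0$ is called continuous if for every $u\in G^0$ and $\varepsilon>0$ there are $f\in C_c(G)$ and a neighbourhood $V$ of $u$ in $G^0$ such that $\|\xi^v-f|_{G^v}\|_2<\varepsilon$ for all $v\in V$. Let $E^2$ be the Banach space of all continuous sections $\xi$ such that $u\mapsto\|\xi^u\|_2$ vanishes at infinity on $G^0$, with the norm $\|\xi\|=\sup_{u\in G^0}\|\xi^u\|_2$; it contains $C_c(G)$ as a dense subspace (identify $f$ with the section $u\mapsto f|_{G^u}$). For $F\in C_c(G)$ let $L_F$ and $R_F$ be the bounded linear operators on $E^2$ that extend the maps $f\mapsto F*f$ and $f\mapsto f*F$ of $C_c(G)$ into itself. Let $\mathfrak{B}(E^2)$ be the algebra of bounded linear operators on $E^2$ and $$VN(G)=\{T\in\mathfrak{B}(E^2):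 TR_F=R_FT\ \text{for all }F\in C_c(G)\}.$$ Then $\mathfrak{L}=\{L_F: F\in C_c(G)\}$ is a subalgebra of $\mathfrak{B}(E^2)$, and $VN(G)$ is the closure of $\mathfrak{L}$ in $\mathfrak{B}(E^2)$ for the strong operator topology. -/

import Mathlib

noncomputable section

open MeasureTheory Topology Filter Set
open scoped CompactlySupported ENNReal

set_option linter.unusedSectionVars false

/-- A topological groupoid, given by its space `G` of arrows. The unit space is the subset
`{u | r u = u}` of `G`. The product `x * y` is meaningful only if `s x = r y`: no law says anything
about its value for other pairs. -/
class TopologicalGroupoid (G : Type*) [TopologicalSpace G] extends Mul G, Inv G where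
  /-- the range map -/
  r : G → G
  /-- the source map -/
  s : G → G
  s_r : ∀ x, s (r x) = r x
  r_s : ∀ x, r (s x) = s x
  r_mul : ∀ x y, s x = r y → r (x * y) = r x
  s_mul : ∀ x y, s x = r y → s (x * y) = s y
  mul_assoc : ∀ x y z, s x = r y → s y = r z → x * y * z = x * (y * z)
  r_mul_self : ∀ x, r x * x = x
  mul_s_self : ∀ x, x * s x = x
  r_inv : ∀ x, r x⁻¹ = s x
  s_inv : ∀ x, s x⁻¹ = r x
  mul_inv : ∀ x, x * x⁻¹ = r x
  inv_mul : ∀ x, x⁻¹ * x = s x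
  continuousOn_mul : ContinuousOn (fun p : G × G => p.1 * p.2) {p | s p.1 = r p.2}
  continuous_inv : Continuous fun x : G => x⁻¹

namespace TopologicalGroupoid

variable {G : Type*} [TopologicalSpace G] [TopologicalGroupoid G]

theorem r_r (x : G) : r (r x) = r x := by
  have h := r_s (r x)
  rwa [s_r] at h

theorem continuous_r : Continuous (r : G → G) := by
  have h : Continuous fun x : G => x * x⁻¹ :=
    continuousOn_mul.comp_continuous (continuous_id.prodMk continuous_inv)
      (fun x => (r_inv x).symm)
  simpa only [mul_inv] using h

theorem continuous_s : Continuous (s : G → G) := by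
  have h : Continuous fun x : G => x⁻¹ * x :=
    continuousOn_mul.comp_continuous (continuous_inv.prodMk continuous_id) (fun x => s_inv x)
  simpa only [inv_mul] using h

theorem inv_mul_cancel_left (t x : G) (h : r t = r x) : t * (t⁻¹ * x) = x := by
  rw [← mul_assoc t t⁻¹ x (r_inv t).symm (by rw [s_inv, h]), mul_inv, h, r_mul_self]

theorem eq_inv_of_mul_eq (x y : G) (h : s x = r y) (hxy : x * y = r x) : y = x⁻¹ := by
  have h1 : x⁻¹ * (x * y) = y := by
    rw [← mul_assoc _ _ _ (s_inv x) h, inv_mul, h, r_mul_self]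
  rw [← h1, hxy, ← s_inv, mul_s_self]

theorem inv_inv (x : G) : x⁻¹⁻¹ = x :=
  (eq_inv_of_mul_eq x⁻¹ x (s_inv x) (by rw [inv_mul, r_inv])).symm

theorem inv_mul_inv (t x : G) (h : r t = r x) : (t⁻¹ * x)⁻¹ = x⁻¹ * t := by
  have h1 : s t⁻¹ = r x := by rw [s_inv, h]
  have h2 : s x⁻¹ = r t := by rw [s_inv, h]
  refine (eq_inv_of_mul_eq _ _ (by rw [s_mul _ _ h1, r_mul _ _ h2, r_inv]) ?_).symm
  rw [mul_assoc _ _ _ h1 (by rw [r_mul _ _ h2, r_inv]), inv_mul_cancel_left x t h.symm, inv_mul,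
    r_mul _ _ h1, r_inv]

variable (G) in
/-- The unit space `G⁰` as a subset of `G`. -/
def unitSpace : Set G := {u | r u = u}

/-- The range of an arrow, as a point of the unit space. -/
def rangeUnit (x : G) : unitSpace G := ⟨r x, r_r x⟩

/-- The source of an arrow, as a point of the unit space. -/
def sourceUnit (x : G) : unitSpace G := ⟨s x, r_s x⟩

/-- The fibre `G^u = r⁻¹(u)`. -/
def fiber (u : unitSpace G) : Set G := {x | r x = u}

theorem continuous_rangeUnit : Continuous (rangeUnit : G → unitSpace G) :=
  continuous_r.subtype_mk _

theorem rangeUnit_eq_iff (x : G) (u : unitSpace G) : rangeUnit x = u ↔ r x = u := by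
  simp [rangeUnit, Subtype.ext_iff]

theorem rangeUnit_coe (u : unitSpace G) : rangeUnit (u : G) = u := Subtype.ext u.2

theorem isClosed_unitSpace [T2Space G] : IsClosed (unitSpace G) :=
  isClosed_eq continuous_r continuous_id

theorem isClosed_fiber [T2Space G] (u : unitSpace G) : IsClosed (fiber u) :=
  isClosed_eq continuous_r continuous_const

instance [T2Space G] [LocallyCompactSpace G] : LocallyCompactSpace (unitSpace G) :=
  isClosed_unitSpace.isClosedEmbedding_subtypeVal.locallyCompactSpace

end TopologicalGroupoid

open TopologicalGroupoid

/-- A left Haar system: regular Borel measures `λ^u` on `G` with support `G^u`, which depend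
continuously on the unit `u` and are invariant under left translations. -/
structure HaarSystem (G : Type*) [TopologicalSpace G] [TopologicalGroupoid G]
    [MeasurableSpace G] [BorelSpace G] where
  measure : unitSpace G → Measure G
  regular : ∀ u, (measure u).Regular
  support_eq : ∀ u, (measure u).support = fiber u
  continuous_integral : ∀ f : C_c(G, ℂ), Continuous fun u => ∫ t, f t ∂measure u
  left_invariant : ∀ (f : C_c(G, ℂ)) (x : G),
    ∫ y, f (x * y) ∂measure (sourceUnit x) = ∫ y, f y ∂measure (rangeUnit x)

namespace HaarSystem

variable {G : Type*} [TopologicalSpace G] [T2Space G] [LocallyCompactSpace G]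
  [SecondCountableTopology G] [MeasurableSpace G] [BorelSpace G] [TopologicalGroupoid G]
  (lam : HaarSystem G)

instance (u : unitSpace G) : (lam.measure u).Regular := lam.regular u

theorem ae_r_eq (u : unitSpace G) : ∀ᵐ t ∂lam.measure u, r t = (u : G) := by
  have h : (lam.measure u).support ∈ ae (lam.measure u) := Measure.support_mem_ae
  rw [lam.support_eq] at h
  exact h

theorem memLp (f : C_c(G, ℂ)) (u : unitSpace G) : MemLp f 2 (lam.measure u) :=
  f.continuous.memLp_of_hasCompactSupport f.hasCompactSupport

/-- The restriction of `f ∈ C_c(G)` to `G^u`, as an element of `L²(G^u, λ^u)`. -/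
def restrict (f : C_c(G, ℂ)) (u : unitSpace G) : Lp ℂ 2 (lam.measure u) :=
  (lam.memLp f u).toLp f

theorem restrict_add (f g : C_c(G, ℂ)) (u : unitSpace G) :
    lam.restrict (f + g) u = lam.restrict f u + lam.restrict g u := rfl

theorem restrict_smul (c : ℂ) (f : C_c(G, ℂ)) (u : unitSpace G) :
    lam.restrict (c • f) u = c • lam.restrict f u := rfl

theorem restrict_zero (u : unitSpace G) : lam.restrict 0 u = 0 := rfl

/-- A section `u ↦ ξ u ∈ L²(G^u)` is continuous if it is locally a uniform limit of sections that
come from `C_c(G)`. -/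
def IsContinuousSection (ξ : ∀ u : unitSpace G, Lp ℂ 2 (lam.measure u)) : Prop :=
  ∀ u, ∀ ε > 0, ∃ f : C_c(G, ℂ), ∀ᶠ v in 𝓝 u, ‖ξ v - lam.restrict f v‖ < ε

/-- A section vanishes at infinity if its norm function does. -/
def VanishesAtInfinity (ξ : ∀ u : unitSpace G, Lp ℂ 2 (lam.measure u)) : Prop :=
  Tendsto (fun u => ‖ξ u‖) (cocompact (unitSpace G)) (𝓝 0)

/-- The space `E²` of continuous sections of `L²(G)` that vanish at infinity, with the norm
`‖ξ‖ = sup_u ‖ξ u‖` (it is a subspace of the space of all bounded sections). -/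
def E2 : Submodule ℂ (lp (fun u : unitSpace G => Lp ℂ 2 (lam.measure u)) ∞) where
  carrier := {ξ | lam.IsContinuousSection ξ ∧ lam.VanishesAtInfinity ξ}
  add_mem' := by
    rintro ξ η ⟨h1, h2⟩ ⟨h3, h4⟩
    refine ⟨fun u ε hε => ?_, ?_⟩
    · obtain ⟨f, hf⟩ := h1 u (ε / 2) (half_pos hε)
      obtain ⟨g, hg⟩ := h3 u (ε / 2) (half_pos hε)
      refine ⟨f + g, ?_⟩
      filter_upwards [hf, hg] with v hfv hgv
      rw [restrict_add, lp.coeFn_add, Pi.add_apply, add_sub_add_comm]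
      exact (norm_add_le _ _).trans_lt (by linarith)
    · have h : Tendsto (fun u => ‖ξ u‖ + ‖η u‖) (cocompact (unitSpace G)) (𝓝 0) := by
        simpa using Tendsto.add h2 h4
      exact squeeze_zero (fun u => norm_nonneg _) (fun u => norm_add_le _ _) h
  zero_mem' := by
    refine ⟨fun u ε hε => ⟨0, ?_⟩, ?_⟩
    · filter_upwards with v
      simpa [restrict_zero] using hε
    · simpa [VanishesAtInfinity] using tendsto_const_nhds
  smul_mem' := by
    rintro c ξ ⟨h1, h2⟩
    refine ⟨fun u ε hε => ?_, ?_⟩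
    · have hc : 0 < ‖c‖ + 1 := by positivity
      obtain ⟨f, hf⟩ := h1 u (ε / (‖c‖ + 1)) (by positivity)
      refine ⟨c • f, ?_⟩
      filter_upwards [hf] with v hfv
      rw [restrict_smul, lp.coeFn_smul, Pi.smul_apply, ← smul_sub, norm_smul]
      rw [lt_div_iff₀ hc] at hfv
      nlinarith [norm_nonneg (ξ v - lam.restrict f v), norm_nonneg c]
    · have h : Tendsto (fun u => ‖c‖ * ‖ξ u‖) (cocompact (unitSpace G)) (𝓝 0) := by
        simpa using Tendsto.const_mul ‖c‖ h2
      refine h.congr (fun u => ?_)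
      rw [lp.coeFn_smul, Pi.smul_apply, norm_smul]

theorem norm_apply_le (ξ : lam.E2) (u : unitSpace G) : ‖ξ.1 u‖ ≤ ‖ξ‖ :=
  lp.norm_apply_le_norm ENNReal.top_ne_zero ξ.1 u

theorem isClosed_E2 : IsClosed (lam.E2 : Set (lp (fun u => Lp ℂ 2 (lam.measure u)) ∞)) := by
  refine isClosed_of_closure_subset fun ξ hξ => ?_
  have key : ∀ ε > 0, ∃ η ∈ lam.E2, ∀ u, ‖ξ u - η u‖ < ε := by
    intro ε hε
    obtain ⟨η, hη, hd⟩ := Metric.mem_closure_iff.1 hξ ε hε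
    refine ⟨η, hη, fun u => ?_⟩
    rw [dist_eq_norm] at hd
    exact (lp.norm_apply_le_norm ENNReal.top_ne_zero (ξ - η) u).trans_lt hd
  refine ⟨fun u ε hε => ?_, ?_⟩
  · obtain ⟨η, hη, h⟩ := key (ε / 2) (half_pos hε)
    obtain ⟨f, hf⟩ := hη.1 u (ε / 2) (half_pos hε)
    refine ⟨f, ?_⟩
    filter_upwards [hf] with v hv
    have := norm_sub_le_norm_sub_add_norm_sub (ξ v) (η v) (lam.restrict f v)
    linarith [h v]
  · refine Metric.tendsto_nhds.2 fun ε hε => ?_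
    obtain ⟨η, hη, h⟩ := key (ε / 2) (half_pos hε)
    filter_upwards [Metric.tendsto_nhds.1 hη.2 (ε / 2) (half_pos hε)] with u hu
    simp only [dist_zero_right, norm_norm] at hu ⊢
    have := norm_le_norm_add_norm_sub' (ξ u) (η u)
    linarith [h u]

instance : CompleteSpace lam.E2 := lam.isClosed_E2.completeSpace_coe


/-! ### Continuity of fibre integrals -/

/-- A compactly supported real function as an element of `C_c(G, ℂ)`. -/
def ofRealCc (g : C(G, ℝ)) (hg : HasCompactSupport g) : C_c(G, ℂ) where
  toFun x := (g x : ℂ)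
  continuous_toFun := Complex.continuous_ofReal.comp g.continuous
  hasCompactSupport' := hg.comp_left (g := fun a : ℝ => (a : ℂ)) Complex.ofReal_zero

theorem continuous_integral_real (g : C(G, ℝ)) (hg : HasCompactSupport g) :
    Continuous fun u => ∫ t, g t ∂lam.measure u := by
  have h := Complex.continuous_re.comp (lam.continuous_integral (ofRealCc g hg))
  refine h.congr fun u => ?_
  have h1 : ∫ t, ofRealCc g hg t ∂lam.measure u = ((∫ t, g t ∂lam.measure u : ℝ) : ℂ) :=
    integral_ofReal
  simp only [Function.comp_apply, h1, Complex.ofReal_re]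

/-- Fibre integrals of a function that is continuous on `{(t, x) : r t = r x}` and vanishes unless
`t` is in a fixed compact set depend continuously on `x`. -/
theorem continuous_integral_rangeUnit (φ : G × G → ℂ) {K : Set G} (hK : IsCompact K)
    (hφ : ContinuousOn φ {p | r p.1 = r p.2})
    (h0 : ∀ p : G × G, r p.1 = r p.2 → p.1 ∉ K → φ p = 0) :
    Continuous fun x => ∫ t, φ (t, x) ∂lam.measure (rangeUnit x) := by
  have hZ : IsClosed {p : G × G | r p.1 = r p.2} :=
    isClosed_eq (continuous_r.comp continuous_fst) (continuous_r.comp continuous_snd)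
  obtain ⟨Φ, hΦ⟩ := ContinuousMap.exists_restrict_eq hZ
    (⟨_, hφ.domRestrict⟩ : C({p : G × G | r p.1 = r p.2}, ℂ))
  have hΦ' : ∀ p : G × G, r p.1 = r p.2 → Φ p = φ p := fun p hp =>
    DFunLike.congr_fun hΦ ⟨p, hp⟩
  obtain ⟨c, hc1, hc2, -, -⟩ := exists_continuousMap_one_of_isCompact_subset_isOpen hK isOpen_univ
    (subset_univ K)
  obtain ⟨d, hd1, hd2, -, hd3⟩ := exists_continuousMap_one_of_isCompact_subset_isOpen hc2
    isOpen_univ (subset_univ _)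
  obtain ⟨M, hM⟩ := hc2.exists_bound_of_continuousOn (f := c) c.continuous.continuousOn
  -- the extended integrand
  let F : G → C_c(G, ℂ) := fun x =>
    { toFun := fun t => (c t : ℂ) * Φ (t, x)
      continuous_toFun := by fun_prop
      hasCompactSupport' := HasCompactSupport.mul_right
        (HasCompactSupport.comp_left (g := fun a : ℝ => (a : ℂ)) hc2 Complex.ofReal_zero) }
  have hF : ∀ x, ∫ t, φ (t, x) ∂lam.measure (rangeUnit x) =
      ∫ t, F x t ∂lam.measure (rangeUnit x) := by
    intro x
    refine integral_congr_ae ?_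
    filter_upwards [lam.ae_r_eq (rangeUnit x)] with t ht
    have ht' : r t = r x := ht
    change φ (t, x) = (c t : ℂ) * Φ (t, x)
    by_cases htK : t ∈ K
    · rw [hΦ' _ ht', hc1 htK]
      simp
    · rw [hΦ' _ ht', h0 _ ht' htK, mul_zero]
  simp_rw [hF]
  refine continuous_iff_continuousAt.2 fun x₀ => ?_
  have hA : Tendsto (fun x => ∫ t, F x₀ t ∂lam.measure (rangeUnit x)) (𝓝 x₀)
      (𝓝 (∫ t, F x₀ t ∂lam.measure (rangeUnit x₀))) :=
    ((lam.continuous_integral (F x₀)).comp continuous_rangeUnit).tendsto x₀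
  have hB : Tendsto (fun x => ∫ t, F x t ∂lam.measure (rangeUnit x)
      - ∫ t, F x₀ t ∂lam.measure (rangeUnit x)) (𝓝 x₀) (𝓝 0) := by
    have hd := (((lam.continuous_integral_real d hd2).comp continuous_rangeUnit).tendsto x₀)
    set m := ∫ t, d t ∂lam.measure (rangeUnit x₀) with hm
    have hm0 : 0 ≤ m := integral_nonneg fun t => (hd3 t).1
    have hM0 : 0 ≤ |M| := abs_nonneg M
    refine Metric.tendsto_nhds.2 fun ε hε => ?_
    let δ := ε / ((|M| + 1) * (m + 1))
    have hδ : 0 < δ := by positivity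
    let Ψ : C(G × G, ℂ) := Φ.comp ⟨Prod.swap, continuous_swap⟩
    have hΨ := (ContinuousMap.tendsto_iff_forall_isCompact_tendstoUniformlyOn.1
      (Ψ.curry.continuous.tendsto x₀)) _ hc2
    have hΨ' := Metric.tendstoUniformlyOn_iff.1 hΨ δ hδ
    filter_upwards [hΨ', hd.eventually (gt_mem_nhds (lt_add_one m))] with x hx hdx
    simp only [Function.comp_apply] at hdx
    have hint : ∀ y, Integrable (fun t => F y t) (lam.measure (rangeUnit x)) := fun y =>
      (F y).continuous.integrable_of_hasCompactSupport (F y).hasCompactSupport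
    rw [dist_zero_right, ← integral_sub (hint x) (hint x₀)]
    have hbound : ∀ t, ‖F x t - F x₀ t‖ ≤ (|M| * δ) * d t := by
      intro t
      change ‖(c t : ℂ) * Φ (t, x) - (c t : ℂ) * Φ (t, x₀)‖ ≤ _
      by_cases ht : t ∈ tsupport c
      · rw [hd1 ht, ← mul_sub, norm_mul, Complex.norm_real]
        have h1 := hx t ht
        change dist (Φ (t, x₀)) (Φ (t, x)) < δ at h1
        rw [dist_comm, dist_eq_norm] at h1
        simp only [Pi.one_apply, mul_one]
        exact mul_le_mul ((hM t ht).trans (le_abs_self M)) h1.le (norm_nonneg _) hM0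
      · rw [image_eq_zero_of_notMem_tsupport ht]
        simp only [Complex.ofReal_zero, zero_mul, sub_zero, norm_zero]
        exact mul_nonneg (by positivity) (hd3 t).1
    have h2 := norm_integral_le_of_norm_le (μ := lam.measure (rangeUnit x))
      ((d.continuous.integrable_of_hasCompactSupport hd2).const_mul (|M| * δ))
      (Eventually.of_forall hbound)
    rw [integral_const_mul] at h2
    refine h2.trans_lt ?_
    have h3 : |M| * δ * ∫ t, d t ∂lam.measure (rangeUnit x) ≤ |M| * δ * (m + 1) :=
      mul_le_mul_of_nonneg_left hdx.le (by positivity)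
    refine h3.trans_lt ?_
    have h4 : (|M| + 1) * δ * (m + 1) = ε := by
      simp only [δ]
      field_simp
    nlinarith [mul_pos hδ (by linarith : (0 : ℝ) < m + 1)]
  have hAB := hB.add hA
  simpa [ContinuousAt] using hAB

/-! ### Convolution -/

/-- The convolution `f * g (x) = ∫ f(t) g(t⁻¹x) dλ^{r(x)}(t)`. -/
def conv (f g : G → ℂ) (x : G) : ℂ :=
  ∫ t, f t * g (t⁻¹ * x) ∂lam.measure (rangeUnit x)

theorem continuousOn_inv_mul : ContinuousOn (fun p : G × G => p.1⁻¹ * p.2)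
    {p | r p.1 = r p.2} :=
  continuousOn_mul.comp (f := fun p : G × G => (p.1⁻¹, p.2))
    ((TopologicalGroupoid.continuous_inv.comp continuous_fst).prodMk continuous_snd).continuousOn
    (fun p hp => by
      change s p.1⁻¹ = r p.2
      rw [s_inv]
      exact hp)

theorem continuous_conv (f g : C_c(G, ℂ)) : Continuous (lam.conv f g) := by
  refine lam.continuous_integral_rangeUnit (fun p => f p.1 * g (p.1⁻¹ * p.2))
    (K := tsupport f) f.hasCompactSupport ?_ ?_
  · exact (f.continuous.comp continuous_fst).continuousOn.mul
      (g.continuous.comp_continuousOn continuousOn_inv_mul)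
  · intro p _ hp
    simp only [image_eq_zero_of_notMem_tsupport hp, zero_mul]

theorem hasCompactSupport_conv (f g : C_c(G, ℂ)) : HasCompactSupport (lam.conv f g) := by
  have hK : IsCompact ((tsupport f ×ˢ tsupport g) ∩ {p : G × G | s p.1 = r p.2}) :=
    (f.hasCompactSupport.isCompact.prod g.hasCompactSupport.isCompact).inter_right
      (isClosed_eq (continuous_s.comp continuous_fst) (continuous_r.comp continuous_snd))
  refine HasCompactSupport.intro
    (hK.image_of_continuousOn (continuousOn_mul.mono inter_subset_right)) fun x hx => ?_
  refine integral_eq_zero_of_ae ?_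
  filter_upwards [lam.ae_r_eq (rangeUnit x)] with t ht
  have ht' : r t = r x := ht
  by_contra hne
  have h1 : f t ≠ 0 := left_ne_zero_of_mul hne
  have h2 : g (t⁻¹ * x) ≠ 0 := right_ne_zero_of_mul hne
  exact hx ⟨(t, t⁻¹ * x), ⟨⟨subset_tsupport _ h1, subset_tsupport _ h2⟩, by
    change s t = r (t⁻¹ * x)
    rw [r_mul _ _ (by rw [s_inv, ht']), r_inv]⟩, inv_mul_cancel_left t x ht'⟩

/-- Convolution as an operation on `C_c(G)`. -/
def convCc (f g : C_c(G, ℂ)) : C_c(G, ℂ) where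
  toFun := lam.conv f g
  continuous_toFun := lam.continuous_conv f g
  hasCompactSupport' := lam.hasCompactSupport_conv f g

theorem integrable_conv (f g : C_c(G, ℂ)) (x : G) :
    Integrable (fun t => f t * g (t⁻¹ * x)) (lam.measure (rangeUnit x)) := by
  have hZ : IsClosed (fiber (rangeUnit x)) := isClosed_fiber _
  obtain ⟨B, hB⟩ := g.hasCompactSupport.exists_bound_of_continuous g.continuous
  have hf : Integrable f (lam.measure (rangeUnit x)) :=
    f.continuous.integrable_of_hasCompactSupport f.hasCompactSupport
  refine hf.mul_bdd (c := B) ?_ (Eventually.of_forall fun t => hB _)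
  have h1 : ContinuousOn (fun t : G => g (t⁻¹ * x)) (fiber (rangeUnit x)) :=
    g.continuous.comp_continuousOn (continuousOn_inv_mul.comp (f := fun t : G => (t, x))
      (by fun_prop) (fun t ht => ht))
  have h2 := h1.aestronglyMeasurable (μ := lam.measure (rangeUnit x)) hZ.measurableSet
  rwa [Measure.restrict_eq_self_of_ae_mem (s := fiber (rangeUnit x))
    (lam.ae_r_eq (rangeUnit x))] at h2

/-- Left convolution `g ↦ f * g` on `C_c(G)`. -/
def leftConvCc (f : C_c(G, ℂ)) : C_c(G, ℂ) →ₗ[ℂ] C_c(G, ℂ) where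
  toFun g := lam.convCc f g
  map_add' g h := by
    ext x
    change ∫ t, f t * (g (t⁻¹ * x) + h (t⁻¹ * x)) ∂_ = _
    simp_rw [mul_add]
    exact integral_add (lam.integrable_conv f g x) (lam.integrable_conv f h x)
  map_smul' a g := by
    ext x
    change ∫ t, f t * (a * g (t⁻¹ * x)) ∂_ = a * ∫ t, f t * g (t⁻¹ * x) ∂_
    simp_rw [mul_left_comm _ a]
    exact integral_const_mul _ _

/-- Right convolution `g ↦ g * f` on `C_c(G)`. -/
def rightConvCc (f : C_c(G, ℂ)) : C_c(G, ℂ) →ₗ[ℂ] C_c(G, ℂ) where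
  toFun g := lam.convCc g f
  map_add' g h := by
    ext x
    change ∫ t, (g t + h t) * f (t⁻¹ * x) ∂_ = _
    simp_rw [add_mul]
    exact integral_add (lam.integrable_conv g f x) (lam.integrable_conv h f x)
  map_smul' a g := by
    ext x
    change ∫ t, (a * g t) * f (t⁻¹ * x) ∂_ = a * ∫ t, g t * f (t⁻¹ * x) ∂_
    simp_rw [_root_.mul_assoc]
    exact integral_const_mul _ _

/-! ### `C_c(G)` inside `E²` -/

theorem hasCompactSupport_integral_real (g : C(G, ℝ)) (hg : HasCompactSupport g) :
    HasCompactSupport fun u => ∫ t, g t ∂lam.measure u := by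
  refine HasCompactSupport.intro (hg.isCompact.image continuous_rangeUnit) fun u hu => ?_
  refine integral_eq_zero_of_ae ?_
  filter_upwards [lam.ae_r_eq u] with t ht
  by_contra hne
  exact hu ⟨t, subset_tsupport _ hne, (rangeUnit_eq_iff t u).2 ht⟩

theorem exists_lintegral_le (g : C(G, ℝ)) (hg : HasCompactSupport g) (h0 : ∀ x, 0 ≤ g x) :
    ∃ A : ℝ, 0 ≤ A ∧ ∀ u, ∫⁻ t, ENNReal.ofReal (g t) ∂lam.measure u ≤ ENNReal.ofReal A := by
  obtain ⟨A, hA⟩ := (lam.hasCompactSupport_integral_real g hg).exists_bound_of_continuous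
    (lam.continuous_integral_real g hg)
  refine ⟨|A|, abs_nonneg A, fun u => ?_⟩
  rw [← ofReal_integral_eq_lintegral_ofReal (g.continuous.integrable_of_hasCompactSupport hg)
    (Eventually.of_forall h0)]
  exact ENNReal.ofReal_le_ofReal ((le_abs_self _).trans ((hA u).trans (le_abs_self A)))

/-- The function `|f|^n` (`n ≠ 0`). -/
def absPow (f : C_c(G, ℂ)) (n : ℕ) : C(G, ℝ) :=
  ⟨fun x => ‖f x‖ ^ n, f.continuous.norm.pow n⟩

theorem hasCompactSupport_absPow (f : C_c(G, ℂ)) {n : ℕ} (hn : n ≠ 0) :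
    HasCompactSupport (absPow f n) :=
  f.hasCompactSupport.comp_left (g := fun z : ℂ => ‖z‖ ^ n) (by simp [hn])

theorem ofReal_absPow (f : C_c(G, ℂ)) (n : ℕ) (x : G) :
    ENNReal.ofReal (absPow f n x) = ‖f x‖ₑ ^ n := by
  change ENNReal.ofReal (‖f x‖ ^ n) = _
  rw [ENNReal.ofReal_pow (norm_nonneg _), ofReal_norm]

theorem absPow_nonneg (f : C_c(G, ℂ)) (n : ℕ) (x : G) : 0 ≤ absPow f n x :=
  pow_nonneg (norm_nonneg _) n

theorem enorm_restrict_sq (f : C_c(G, ℂ)) (u : unitSpace G) :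
    ‖lam.restrict f u‖ₑ ^ 2 = ∫⁻ t, ‖f t‖ₑ ^ 2 ∂lam.measure u := by
  rw [restrict, Lp.enorm_toLp, eLpNorm_eq_lintegral_rpow_enorm_toReal two_ne_zero
    ENNReal.ofNat_ne_top]
  simp only [ENNReal.toReal_ofNat, one_div]
  rw [← ENNReal.rpow_natCast, ← ENNReal.rpow_mul]
  norm_num

theorem norm_restrict_eq (f : C_c(G, ℂ)) (u : unitSpace G) :
    ‖lam.restrict f u‖ = √(∫ t, absPow f 2 t ∂lam.measure u) := by
  rw [← Real.sqrt_sq (norm_nonneg (lam.restrict f u))]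
  congr 1
  rw [integral_eq_lintegral_of_nonneg_ae (Eventually.of_forall (absPow_nonneg f 2))
    (absPow f 2).continuous.aestronglyMeasurable]
  simp_rw [ofReal_absPow]
  rw [← enorm_restrict_sq, ENNReal.toReal_pow, toReal_enorm]

theorem continuous_norm_restrict (f : C_c(G, ℂ)) : Continuous fun u => ‖lam.restrict f u‖ := by
  simp_rw [norm_restrict_eq]
  exact (lam.continuous_integral_real _ (hasCompactSupport_absPow f two_ne_zero)).sqrt

theorem hasCompactSupport_norm_restrict (f : C_c(G, ℂ)) :
    HasCompactSupport fun u => ‖lam.restrict f u‖ := by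
  simp_rw [norm_restrict_eq]
  exact (lam.hasCompactSupport_integral_real _ (hasCompactSupport_absPow f two_ne_zero)).comp_left
    (g := Real.sqrt) Real.sqrt_zero

theorem memℓp_restrict (f : C_c(G, ℂ)) : Memℓp (fun u => lam.restrict f u) ∞ := by
  obtain ⟨A, hA⟩ := (lam.hasCompactSupport_norm_restrict f).exists_bound_of_continuous
    (lam.continuous_norm_restrict f)
  refine memℓp_infty ⟨A, ?_⟩
  rintro _ ⟨u, rfl⟩
  simpa using hA u

/-- The inclusion of `C_c(G)` in `E²`: a function `f` is viewed as the section
`u ↦ f|_{G^u} ∈ L²(G^u)`. -/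
def toE2 : C_c(G, ℂ) →ₗ[ℂ] lam.E2 where
  toFun f := ⟨⟨fun u => lam.restrict f u, lam.memℓp_restrict f⟩,
    fun u ε hε => ⟨f, Eventually.of_forall fun v => by simpa using hε⟩,
    (lam.hasCompactSupport_norm_restrict f).is_zero_at_infty⟩
  map_add' _ _ := rfl
  map_smul' _ _ := rfl

theorem toE2_apply (f : C_c(G, ℂ)) (u : unitSpace G) : (lam.toE2 f).1 u = lam.restrict f u := rfl

/-- Multiplication of `f ∈ C_c(G)` by a continuous function of the range. -/
def mulRange (b : C(unitSpace G, ℝ)) (f : C_c(G, ℂ)) : C_c(G, ℂ) where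
  toFun x := (b (rangeUnit x) : ℂ) * f x
  continuous_toFun := (Complex.continuous_ofReal.comp
    (b.continuous.comp continuous_rangeUnit)).mul f.continuous
  hasCompactSupport' := f.hasCompactSupport.mul_left

theorem restrict_mulRange (b : C(unitSpace G, ℝ)) (f : C_c(G, ℂ)) (u : unitSpace G) :
    lam.restrict (mulRange b f) u = (b u : ℂ) • lam.restrict f u := by
  have h : lam.restrict ((b u : ℂ) • f) u = (b u : ℂ) • lam.restrict f u := rfl
  rw [← h]
  refine MemLp.toLp_congr _ _ ?_
  filter_upwards [lam.ae_r_eq u] with t ht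
  change (b (rangeUnit t) : ℂ) * f t = (b u : ℂ) * f t
  rw [(rangeUnit_eq_iff t u).2 ht]

theorem restrict_sum {ι : Type*} (S : Finset ι) (f : ι → C_c(G, ℂ)) (u : unitSpace G) :
    lam.restrict (∑ i ∈ S, f i) u = ∑ i ∈ S, lam.restrict (f i) u := by
  classical
  induction S using Finset.induction_on with
  | empty => simp [restrict_zero]
  | insert a S ha ih => rw [Finset.sum_insert ha, Finset.sum_insert ha, restrict_add, ih]

/-- `C_c(G)` is dense in `E²`. -/
theorem denseRange_toE2 : DenseRange lam.toE2 := by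
  refine fun ξ => Metric.mem_closure_iff.2 fun ε hε => ?_
  obtain ⟨hc, hv⟩ := ξ.2
  have hε2 : 0 < ε / 2 := half_pos hε
  obtain ⟨K, hK, hKξ⟩ := mem_cocompact.1 (Metric.tendsto_nhds.1 hv _ hε2)
  choose f hf using fun u => hc u (ε / 2) hε2
  choose V hVf hVo hVu using fun u => eventually_nhds_iff.1 (hf u)
  obtain ⟨T, hT⟩ := hK.elim_nhds_subcover V fun u _ => (hVo u).mem_nhds (hVu u)
  obtain ⟨ρ, hρ, -⟩ := PartitionOfUnity.exists_isSubordinate_of_locallyFinite_t2space hK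
    (fun i : T => V i) (fun i => hVo i) (locallyFinite_of_finite _)
    (fun x hx => by
      obtain ⟨i, hi, hxi⟩ := mem_iUnion₂.1 (hT.2 hx)
      exact mem_iUnion.2 ⟨⟨i, hi⟩, hxi⟩)
  let g : C_c(G, ℂ) := ∑ i : T, mulRange (ρ i) (f i)
  refine ⟨lam.toE2 g, ⟨g, rfl⟩, ?_⟩
  have hbd : ∀ u, ‖ξ.1 u - lam.restrict g u‖ ≤ ε / 2 := by
    intro u
    have hsum1 : ∑ i : T, ρ i u ≤ 1 := by
      rw [← finsum_eq_sum_of_fintype]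
      exact ρ.sum_le_one u
    have hg : lam.restrict g u = ∑ i : T, (ρ i u : ℂ) • lam.restrict (f i) u := by
      simp only [g, restrict_sum, restrict_mulRange]
    have hdec : ξ.1 u - lam.restrict g u = ((1 - ∑ i : T, ρ i u : ℝ) : ℂ) • ξ.1 u +
        ∑ i : T, (ρ i u : ℂ) • (ξ.1 u - lam.restrict (f i) u) := by
      simp only [smul_sub, Finset.sum_sub_distrib, ← Finset.sum_smul, hg]
      push_cast
      rw [sub_smul, one_smul]
      abel
    have h1 : ‖((1 - ∑ i : T, ρ i u : ℝ) : ℂ) • ξ.1 u‖ ≤ (1 - ∑ i : T, ρ i u) * (ε / 2) := by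
      rw [norm_smul, Complex.norm_real, Real.norm_of_nonneg (by linarith)]
      by_cases hu : u ∈ K
      · have h2 : ∑ i : T, ρ i u = 1 := by
          rw [← finsum_eq_sum_of_fintype]
          exact ρ.sum_eq_one hu
        rw [h2]
        simp
      · have h2 := hKξ hu
        simp only [mem_ofPred_eq, dist_zero_right, norm_norm] at h2
        exact mul_le_mul_of_nonneg_left h2.le (by linarith)
    have h3 : ‖∑ i : T, (ρ i u : ℂ) • (ξ.1 u - lam.restrict (f i) u)‖ ≤
        (∑ i : T, ρ i u) * (ε / 2) := by
      rw [Finset.sum_mul]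
      refine norm_sum_le_of_le _ fun i _ => ?_
      rw [norm_smul, Complex.norm_real, Real.norm_of_nonneg (ρ.nonneg i u)]
      by_cases hu : u ∈ V i
      · exact mul_le_mul_of_nonneg_left (hVf i u hu).le (ρ.nonneg i u)
      · have h4 : ρ i u = 0 := by
          by_contra hne
          exact hu (hρ i (subset_tsupport _ hne))
        simp [h4]
    rw [hdec]
    refine (norm_add_le _ _).trans ?_
    nlinarith
  rw [dist_eq_norm]
  refine lt_of_le_of_lt ?_ (half_lt_self hε)
  exact lp.norm_le_of_forall_le hε2.le hbd

/-! ### Boundedness of the convolution operators -/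

theorem lintegral_mul_sq_le {X : Type*} [MeasurableSpace X] (μ : Measure X) {w b : X → ℝ≥0∞}
    (hw : AEMeasurable w μ) (hb : AEMeasurable b μ) :
    (∫⁻ t, w t * b t ∂μ) ^ 2 ≤ (∫⁻ t, w t ∂μ) * ∫⁻ t, w t * b t ^ 2 ∂μ := by
  have hw2 : ∀ t, w t ^ (1 / 2 : ℝ) * w t ^ (1 / 2 : ℝ) = w t := fun t => by
    rw [← ENNReal.rpow_add_of_nonneg _ _ (by norm_num) (by norm_num)]
    norm_num
  have h := ENNReal.lintegral_mul_le_Lp_mul_Lq μ Real.HolderConjugate.two_two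
    (hw.pow_const (1 / 2 : ℝ)) ((hw.pow_const (1 / 2 : ℝ)).mul hb)
  have e0 : ∀ x : ℝ≥0∞, x ^ (2 : ℝ) = x * x := fun x => by
    rw [ENNReal.rpow_ofNat, sq]
  have e1 : ∀ t, (w t ^ (1 / 2 : ℝ) * b t) ^ (2 : ℝ) = w t * b t ^ 2 := fun t => by
    rw [e0, mul_mul_mul_comm, hw2, sq]
  simp only [Pi.mul_apply, ← _root_.mul_assoc, hw2, e1] at h
  simp only [e0, hw2] at h
  calc (∫⁻ t, w t * b t ∂μ) ^ 2
      ≤ ((∫⁻ t, w t ∂μ) ^ (1 / 2 : ℝ) * (∫⁻ t, w t * b t ^ 2 ∂μ) ^ (1 / 2 : ℝ)) ^ 2 := by gcongr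
    _ = _ := by
      rw [mul_pow, ← ENNReal.rpow_natCast, ← ENNReal.rpow_natCast, ← ENNReal.rpow_mul,
        ← ENNReal.rpow_mul]
      norm_num

theorem aemeasurable_comp_inv_mul (f : C_c(G, ℂ)) (u : unitSpace G) :
    AEMeasurable (fun p : G × G => ‖f (p.1⁻¹ * p.2)‖ₑ) ((lam.measure u).prod (lam.measure u)) := by
  have hS : IsClosed (fiber u ×ˢ fiber u) := (isClosed_fiber u).prod (isClosed_fiber u)
  have h1 : ContinuousOn (fun p : G × G => f (p.1⁻¹ * p.2)) (fiber u ×ˢ fiber u) :=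
    f.continuous.comp_continuousOn (continuousOn_inv_mul.mono fun p hp => hp.1.trans hp.2.symm)
  have h2 := h1.enorm.aemeasurable (μ := (lam.measure u).prod (lam.measure u)) hS.measurableSet
  rwa [← Measure.prod_restrict, Measure.restrict_eq_self_of_ae_mem (s := fiber u)
    (lam.ae_r_eq u)] at h2

theorem aemeasurable_comp_inv_mul_left (f : C_c(G, ℂ)) (u : unitSpace G) (x : G) (hx : r x = (u : G)) :
    AEMeasurable (fun t => ‖f (t⁻¹ * x)‖ₑ) (lam.measure u) := by
  have h1 : ContinuousOn (fun t : G => f (t⁻¹ * x)) (fiber u) :=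
    f.continuous.comp_continuousOn (continuousOn_inv_mul.comp (f := fun t : G => (t, x))
      (by fun_prop) (fun t ht => Eq.trans ht hx.symm))
  have h2 := h1.enorm.aemeasurable (μ := lam.measure u) (isClosed_fiber u).measurableSet
  rwa [Measure.restrict_eq_self_of_ae_mem (s := fiber u) (lam.ae_r_eq u)] at h2

/-- Left invariance for integrals of nonnegative functions. -/
theorem lintegral_inv_mul (g : C(G, ℝ)) (hg : HasCompactSupport g) (h0 : ∀ x, 0 ≤ g x) (t : G) :
    ∫⁻ x, ENNReal.ofReal (g (t⁻¹ * x)) ∂lam.measure (rangeUnit t) =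
      ∫⁻ x, ENNReal.ofReal (g x) ∂lam.measure (sourceUnit t) := by
  have e1 : sourceUnit t⁻¹ = rangeUnit t := Subtype.ext (s_inv t)
  have e2 : rangeUnit t⁻¹ = sourceUnit t := Subtype.ext (r_inv t)
  have hinv : ∫ x, g (t⁻¹ * x) ∂lam.measure (rangeUnit t) =
      ∫ x, g x ∂lam.measure (sourceUnit t) := by
    have h := lam.left_invariant (ofRealCc g hg) t⁻¹
    rw [e1, e2] at h
    have h1 : ((∫ x, g (t⁻¹ * x) ∂lam.measure (rangeUnit t) : ℝ) : ℂ) =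
        ((∫ x, g x ∂lam.measure (sourceUnit t) : ℝ) : ℂ) :=
      integral_ofReal.symm.trans (h.trans integral_ofReal)
    exact_mod_cast h1
  have hcont : ContinuousOn (fun x : G => g (t⁻¹ * x)) (fiber (rangeUnit t)) :=
    g.continuous.comp_continuousOn (continuousOn_inv_mul.comp (f := fun x : G => (t, x))
      (by fun_prop) (fun x hx => Eq.symm hx))
  have hmeas : AEStronglyMeasurable (fun x : G => g (t⁻¹ * x)) (lam.measure (rangeUnit t)) := by
    have h2 := hcont.aestronglyMeasurable (μ := lam.measure (rangeUnit t))
      (isClosed_fiber (rangeUnit t)).measurableSet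
    rwa [Measure.restrict_eq_self_of_ae_mem (s := fiber (rangeUnit t))
      (lam.ae_r_eq (rangeUnit t))] at h2
  -- the integrand vanishes outside a compact set
  have hCcomp : IsCompact (tsupport g ∩ {y | s t = r y}) :=
    hg.isCompact.inter_right (isClosed_eq continuous_const continuous_r)
  have hC : IsCompact ((fun y => t * y) '' (tsupport g ∩ {y | s t = r y})) :=
    hCcomp.image_of_continuousOn (continuousOn_mul.comp (f := fun y : G => (t, y))
      (by fun_prop) (fun y hy => hy.2))
  obtain ⟨B, hB⟩ := hg.exists_bound_of_continuous g.continuous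
  have hint : Integrable (fun x : G => g (t⁻¹ * x)) (lam.measure (rangeUnit t)) := by
    have h3 : IntegrableOn (fun x : G => g (t⁻¹ * x))
        ((fun y => t * y) '' (tsupport g ∩ {y | s t = r y})) (lam.measure (rangeUnit t)) :=
      Measure.integrableOn_of_bounded (M := B) hC.measure_lt_top.ne hmeas
        (Eventually.of_forall fun x => hB _)
    refine h3.integrable_of_ae_notMem_eq_zero ?_
    filter_upwards [lam.ae_r_eq (rangeUnit t)] with x hx hxC
    have hx' : r t = r x := Eq.symm hx
    by_contra hne
    exact hxC ⟨t⁻¹ * x, ⟨subset_tsupport _ hne, by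
      change s t = r (t⁻¹ * x)
      rw [r_mul _ _ (by rw [s_inv, hx']), r_inv]⟩, inv_mul_cancel_left t x hx'⟩
  rw [← ofReal_integral_eq_lintegral_ofReal hint (Eventually.of_forall fun x => h0 _), hinv,
    ofReal_integral_eq_lintegral_ofReal (g.continuous.integrable_of_hasCompactSupport hg)
      (Eventually.of_forall h0)]

theorem lintegral_enorm_inv_mul (f : C_c(G, ℂ)) {n : ℕ} (hn : n ≠ 0) (u : unitSpace G) (t : G)
    (ht : r t = (u : G)) :
    ∫⁻ x, ‖f (t⁻¹ * x)‖ₑ ^ n ∂lam.measure u = ∫⁻ x, ‖f x‖ₑ ^ n ∂lam.measure (sourceUnit t) := by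
  obtain rfl := (rangeUnit_eq_iff t u).2 ht
  have h := lam.lintegral_inv_mul (absPow f n) (hasCompactSupport_absPow f hn)
    (absPow_nonneg f n) t
  simpa only [ofReal_absPow] using h

theorem exists_lintegral_enorm_le (f : C_c(G, ℂ)) :
    ∃ A : ℝ, 0 ≤ A ∧ ∀ u, ∫⁻ t, ‖f t‖ₑ ∂lam.measure u ≤ ENNReal.ofReal A := by
  obtain ⟨A, hA, h⟩ := lam.exists_lintegral_le (absPow f 1)
    (hasCompactSupport_absPow f one_ne_zero) (absPow_nonneg f 1)
  refine ⟨A, hA, fun u => ?_⟩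
  simpa only [ofReal_absPow, pow_one] using h u

theorem enorm_convCc_le (f g : C_c(G, ℂ)) (u : unitSpace G) (x : G) (hx : r x = (u : G)) :
    ‖lam.convCc f g x‖ₑ ≤ ∫⁻ t, ‖f t‖ₑ * ‖g (t⁻¹ * x)‖ₑ ∂lam.measure u := by
  obtain rfl := (rangeUnit_eq_iff x u).2 hx
  refine (enorm_integral_le_lintegral_enorm _).trans_eq ?_
  simp_rw [enorm_mul]

theorem norm_toE2_le {f g : C_c(G, ℂ)} {A : ℝ} (hA : 0 ≤ A)
    (h : ∀ u, ∫⁻ t, ‖f t‖ₑ ^ 2 ∂lam.measure u ≤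
      ENNReal.ofReal A * (ENNReal.ofReal A * ‖lam.toE2 g‖ₑ ^ 2)) :
    ‖lam.toE2 f‖ ≤ A * ‖lam.toE2 g‖ := by
  refine lp.norm_le_of_forall_le (by positivity) fun u => ?_
  have h1 := h u
  rw [← enorm_restrict_sq, ← _root_.mul_assoc, ← sq, ← mul_pow] at h1
  have h2 : ‖lam.restrict f u‖ₑ ≤ ENNReal.ofReal A * ‖lam.toE2 g‖ₑ :=
    (ENNReal.pow_le_pow_left_iff two_ne_zero).1 h1
  rw [← ofReal_norm, ← ofReal_norm, ← ENNReal.ofReal_mul hA] at h2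
  exact (ENNReal.ofReal_le_ofReal_iff (by positivity)).1 h2

theorem lintegral_enorm_sq_le (f : C_c(G, ℂ)) (u : unitSpace G) :
    ∫⁻ t, ‖f t‖ₑ ^ 2 ∂lam.measure u ≤ ‖lam.toE2 f‖ₑ ^ 2 := by
  rw [← enorm_restrict_sq]
  have h : ‖lam.restrict f u‖ₑ ≤ ‖lam.toE2 f‖ₑ := by
    rw [← ofReal_norm, ← ofReal_norm]
    exact ENNReal.ofReal_le_ofReal (lam.norm_apply_le (lam.toE2 f) u)
  gcongr

theorem exists_norm_leftConvCc_le (f : C_c(G, ℂ)) :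
    ∃ A : ℝ, ∀ g, ‖lam.toE2 (lam.leftConvCc f g)‖ ≤ A * ‖lam.toE2 g‖ := by
  obtain ⟨A, hA, hfA⟩ := lam.exists_lintegral_enorm_le f
  refine ⟨A, fun g => lam.norm_toE2_le hA fun u => ?_⟩
  have hfm : AEMeasurable (fun t => ‖f t‖ₑ) (lam.measure u) :=
    f.continuous.enorm.aemeasurable
  calc ∫⁻ x, ‖lam.convCc f g x‖ₑ ^ 2 ∂lam.measure u
      ≤ ∫⁻ x, ENNReal.ofReal A * ∫⁻ t, ‖f t‖ₑ * ‖g (t⁻¹ * x)‖ₑ ^ 2 ∂lam.measure u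
          ∂lam.measure u := by
        refine lintegral_mono_ae ?_
        filter_upwards [lam.ae_r_eq u] with x hx
        calc ‖lam.convCc f g x‖ₑ ^ 2
            ≤ (∫⁻ t, ‖f t‖ₑ * ‖g (t⁻¹ * x)‖ₑ ∂lam.measure u) ^ 2 := by
              gcongr
              exact lam.enorm_convCc_le f g u x hx
          _ ≤ _ := lintegral_mul_sq_le _ hfm (lam.aemeasurable_comp_inv_mul_left g u x hx)
          _ ≤ _ := mul_le_mul_left (hfA u) _
    _ = ENNReal.ofReal A * ∫⁻ x, ∫⁻ t, ‖f t‖ₑ * ‖g (t⁻¹ * x)‖ₑ ^ 2 ∂lam.measure u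
          ∂lam.measure u := lintegral_const_mul' _ _ ENNReal.ofReal_ne_top
    _ = ENNReal.ofReal A * ∫⁻ t, ∫⁻ x, ‖f t‖ₑ * ‖g (t⁻¹ * x)‖ₑ ^ 2 ∂lam.measure u
          ∂lam.measure u := by
        rw [lintegral_lintegral_swap]
        exact ((f.continuous.enorm.comp continuous_snd).aemeasurable).mul
          ((lam.aemeasurable_comp_inv_mul g u).prod_swap.pow_const 2)
    _ ≤ ENNReal.ofReal A * ∫⁻ t, ‖f t‖ₑ * ‖lam.toE2 g‖ₑ ^ 2 ∂lam.measure u := by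
        gcongr ENNReal.ofReal A * ?_
        refine lintegral_mono_ae ?_
        filter_upwards [lam.ae_r_eq u] with t ht
        rw [lintegral_const_mul' _ _ enorm_ne_top, lam.lintegral_enorm_inv_mul g two_ne_zero u t ht]
        gcongr
        exact lam.lintegral_enorm_sq_le g _
    _ ≤ ENNReal.ofReal A * (ENNReal.ofReal A * ‖lam.toE2 g‖ₑ ^ 2) := by
        rw [lintegral_mul_const' _ _ (ENNReal.pow_ne_top enorm_ne_top)]
        gcongr
        exact hfA u

/-- The function `f^∨(x) = f(x⁻¹)`. -/
def reflect (f : C_c(G, ℂ)) : C_c(G, ℂ) where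
  toFun x := f x⁻¹
  continuous_toFun := f.continuous.comp TopologicalGroupoid.continuous_inv
  hasCompactSupport' := by
    refine HasCompactSupport.intro
      (f.hasCompactSupport.isCompact.image TopologicalGroupoid.continuous_inv) fun x hx => ?_
    by_contra hne
    exact hx ⟨x⁻¹, subset_tsupport _ hne, TopologicalGroupoid.inv_inv x⟩

theorem exists_norm_rightConvCc_le (f : C_c(G, ℂ)) :
    ∃ A : ℝ, ∀ g, ‖lam.toE2 (lam.rightConvCc f g)‖ ≤ A * ‖lam.toE2 g‖ := by
  obtain ⟨A₁, hA₁, hf₁⟩ := lam.exists_lintegral_enorm_le f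
  obtain ⟨A₂, hA₂, hf₂⟩ := lam.exists_lintegral_enorm_le (reflect f)
  let A := max A₁ A₂
  have hA : 0 ≤ A := hA₁.trans (le_max_left _ _)
  have hfA : ∀ u, ∫⁻ t, ‖f t‖ₑ ∂lam.measure u ≤ ENNReal.ofReal A := fun u =>
    (hf₁ u).trans (ENNReal.ofReal_le_ofReal (le_max_left _ _))
  have hfA' : ∀ u, ∫⁻ t, ‖reflect f t‖ₑ ∂lam.measure u ≤ ENNReal.ofReal A := fun u =>
    (hf₂ u).trans (ENNReal.ofReal_le_ofReal (le_max_right _ _))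
  refine ⟨A, fun g => lam.norm_toE2_le hA fun u => ?_⟩
  have hgm : AEMeasurable (fun t => ‖g t‖ₑ) (lam.measure u) :=
    g.continuous.enorm.aemeasurable
  have hker : ∀ x : G, r x = (u : G) → ∫⁻ t, ‖f (t⁻¹ * x)‖ₑ ∂lam.measure u ≤ ENNReal.ofReal A := by
    intro x hx
    have h1 : ∫⁻ t, ‖f (t⁻¹ * x)‖ₑ ∂lam.measure u =
        ∫⁻ t, ‖reflect f (x⁻¹ * t)‖ₑ ^ 1 ∂lam.measure u := by
      refine lintegral_congr_ae ?_
      filter_upwards [lam.ae_r_eq u] with t ht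
      change _ = ‖f (x⁻¹ * t)⁻¹‖ₑ ^ 1
      rw [inv_mul_inv x t (hx.trans ht.symm), pow_one]
    rw [h1, lam.lintegral_enorm_inv_mul (reflect f) one_ne_zero u x hx]
    simpa only [pow_one] using hfA' (sourceUnit x)
  calc ∫⁻ x, ‖lam.convCc g f x‖ₑ ^ 2 ∂lam.measure u
      ≤ ∫⁻ x, ENNReal.ofReal A * ∫⁻ t, ‖f (t⁻¹ * x)‖ₑ * ‖g t‖ₑ ^ 2 ∂lam.measure u
          ∂lam.measure u := by
        refine lintegral_mono_ae ?_
        filter_upwards [lam.ae_r_eq u] with x hx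
        calc ‖lam.convCc g f x‖ₑ ^ 2
            ≤ (∫⁻ t, ‖f (t⁻¹ * x)‖ₑ * ‖g t‖ₑ ∂lam.measure u) ^ 2 := by
              gcongr
              refine (lam.enorm_convCc_le g f u x hx).trans_eq ?_
              simp_rw [mul_comm]
          _ ≤ _ := lintegral_mul_sq_le _ (lam.aemeasurable_comp_inv_mul_left f u x hx) hgm
          _ ≤ _ := mul_le_mul_left (hker x hx) _
    _ = ENNReal.ofReal A * ∫⁻ x, ∫⁻ t, ‖f (t⁻¹ * x)‖ₑ * ‖g t‖ₑ ^ 2 ∂lam.measure u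
          ∂lam.measure u := lintegral_const_mul' _ _ ENNReal.ofReal_ne_top
    _ = ENNReal.ofReal A * ∫⁻ t, ∫⁻ x, ‖f (t⁻¹ * x)‖ₑ * ‖g t‖ₑ ^ 2 ∂lam.measure u
          ∂lam.measure u := by
        rw [lintegral_lintegral_swap]
        exact (lam.aemeasurable_comp_inv_mul f u).prod_swap.mul
          ((g.continuous.enorm.comp continuous_snd).aemeasurable.pow_const 2)
    _ ≤ ENNReal.ofReal A * ∫⁻ t, ENNReal.ofReal A * ‖g t‖ₑ ^ 2 ∂lam.measure u := by
        gcongr ENNReal.ofReal A * ?_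
        refine lintegral_mono_ae ?_
        filter_upwards [lam.ae_r_eq u] with t ht
        rw [lintegral_mul_const' _ _ (ENNReal.pow_ne_top enorm_ne_top)]
        gcongr
        have h1 := lam.lintegral_enorm_inv_mul f one_ne_zero u t ht
        simp only [pow_one] at h1
        rw [h1]
        exact hfA _
    _ ≤ ENNReal.ofReal A * (ENNReal.ofReal A * ‖lam.toE2 g‖ₑ ^ 2) := by
        rw [lintegral_const_mul' _ _ ENNReal.ofReal_ne_top]
        gcongr
        exact lam.lintegral_enorm_sq_le g u

/-! ### The operators `L_F`, `R_F` and `VN(G)` -/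

/-- The operator `L_F ∈ 𝔅(E²)`: the continuous extension of `f ↦ F * f` from `C_c(G)` to `E²`. -/
def leftConv (F : C_c(G, ℂ)) : lam.E2 →L[ℂ] lam.E2 :=
  (lam.toE2 ∘ₗ lam.leftConvCc F).extendOfNorm lam.toE2

/-- The operator `R_F ∈ 𝔅(E²)`: the continuous extension of `f ↦ f * F` from `C_c(G)` to `E²`. -/
def rightConv (F : C_c(G, ℂ)) : lam.E2 →L[ℂ] lam.E2 :=
  (lam.toE2 ∘ₗ lam.rightConvCc F).extendOfNorm lam.toE2

theorem leftConv_toE2 (F f : C_c(G, ℂ)) :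
    lam.leftConv F (lam.toE2 f) = lam.toE2 (lam.convCc F f) :=
  LinearMap.extendOfNorm_eq lam.denseRange_toE2 (lam.exists_norm_leftConvCc_le F) f

theorem rightConv_toE2 (F f : C_c(G, ℂ)) :
    lam.rightConv F (lam.toE2 f) = lam.toE2 (lam.convCc f F) :=
  LinearMap.extendOfNorm_eq lam.denseRange_toE2 (lam.exists_norm_rightConvCc_le F) f

/-- `VN(G)`: the bounded operators on `E²` that commute with every `R_F`, `F ∈ C_c(G)`. -/
def VN : Set (lam.E2 →L[ℂ] lam.E2) :=
  {T | ∀ F : C_c(G, ℂ), T ∘L lam.rightConv F = lam.rightConv F ∘L T}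

/-- The closure of a set of bounded operators in the strong operator topology, which is the
topology of pointwise convergence on `E`. -/
def strongClosure {E : Type*} [NormedAddCommGroup E] [NormedSpace ℂ E] (S : Set (E →L[ℂ] E)) :
    Set (E →L[ℂ] E) :=
  closure (X := E →Lₚₜ[ℂ] E) S

end HaarSystem
end

noncomputable section

open MeasureTheory Topology Filter Set TopologicalGroupoid
open scoped CompactlySupported ENNReal InnerProductSpace

set_option linter.unusedSectionVars false

/-! ### Units and quotients `t⁻¹ * x` in a groupoid -/

namespace TopologicalGroupoid

variable {G : Type*} [TopologicalSpace G] [TopologicalGroupoid G]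

/-! Associativity of convolution makes 𝔏 an algebra commuting with every R_F, and a commutant is
closed under pointwise limits; hence the strong closure of 𝔏 lies in VN(G). The work is in the
reverse inclusion: for T in VN(G) and finitely many sections ξ i, a single F must bring every L_F (ξ
i) close to T (ξ i).

It suffices to do this at one unit u at a time. Norms of sections are upper semicontinuous in the
unit, and multiplying F by a function b of the range multiplies (L_F ξ)^u by b(u). A partition of
unity on G⁰ therefore glues the local choices of F, and vanishing at infinity handles the complement
of a compact set (`exists_norm_leftConv_sub_lt`).

On one fibre the argument follows the double commutant theorem, in the Hilbert sum of copies of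
L²(G^u). For y in G^u let y·ξ be the tuple of functions x ↦ ξ i (y⁻¹x). Bumps F near y show that y·ξ
is a limit of tuples (L_F ξ)^u, so it is enough that (Tξ)^u lies in the closed span of the y·ξ. By
an approximate identity, T may be replaced by B = T L_e; then B f = T (R_f e) = R_f η with η = T e,
for all f in C_c(G).

Let P be the projection onto the complement of the translates and let h be a tuple from C_c(G)
within δ of ξ. Formally (Bh)^u is the average of the y·h with weight η(y), and P(y·h) = P(y·(h - ξ))
is of order δ. But η^u is only square integrable, so this bound cannot be integrated. Instead
P(Bh)^u is paired with p * g in coordinate j, which gives the double integral of η(y) Q(y,x) conj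
p(x) with Q(y,x) = ⟨x·g, P(y·h)_j⟩. Since P commutes with the isotropy group of u, Q(y,x) = q(y⁻¹x)
for a Borel q, and all slices q(y⁻¹ ·) are O(δ) in L². With F in C_c(G) in place of q, the same
integral is ⟨p, (BF)^u⟩, bounded by ‖p‖ ‖B‖ ‖F‖. This bound extends to Borel kernels
(`norm_integral_kernel_le`), so the pairing is O(δ) (`norm_inner_coProj_single_le`), and δ → 0 gives
P(Bξ)^u = 0. -/

theorem s_coe (u : unitSpace G) : s (u : G) = u := by
  have h := s_r (u : G)
  rwa [show r (u : G) = u from u.2] at h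

theorem sourceUnit_coe (u : unitSpace G) : sourceUnit (u : G) = u :=
  Subtype.ext (s_coe u)

theorem inv_coe (u : unitSpace G) : (u : G)⁻¹ = u := by
  refine (eq_inv_of_mul_eq _ _ ((s_coe u).trans (Eq.symm u.2)) ?_).symm
  have h := r_mul_self (u : G)
  rw [show r (u : G) = u from u.2] at h ⊢
  exact h

theorem inv_coe_mul (u : unitSpace G) (x : G) (hx : r x = u) : (u : G)⁻¹ * x = x := by
  rw [inv_coe, ← hx, r_mul_self]

theorem r_inv_mul (t x : G) (h : r t = r x) : r (t⁻¹ * x) = s t := by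
  rw [r_mul _ _ (by rw [s_inv, h]), r_inv]

theorem s_inv_mul (t x : G) (h : r t = r x) : s (t⁻¹ * x) = s x :=
  s_mul _ _ (by rw [s_inv, h])

theorem mul_inv_mul (γ t x : G) (h : s γ = r t) (hx : r γ = r x) :
    (γ * t)⁻¹ * x = t⁻¹ * (γ⁻¹ * x) := by
  have h1 := inv_mul_inv γ⁻¹ t (by rw [r_inv, h])
  rw [TopologicalGroupoid.inv_inv] at h1
  rw [h1, mul_assoc _ _ _ (by rw [s_inv, r_inv, h]) (by rw [s_inv, hx])]

theorem inv_mul_inv_mul (t y x : G) (hy : r t = r y) (hx : r t = r x) :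
    (t⁻¹ * y)⁻¹ * (t⁻¹ * x) = y⁻¹ * x := by
  have h := mul_inv_mul t (t⁻¹ * y) x (r_inv_mul t y hy).symm hx
  rw [← h, inv_mul_cancel_left t y hy]

end TopologicalGroupoid

namespace HaarSystem

variable {G : Type*} [TopologicalSpace G] [T2Space G] [LocallyCompactSpace G]
  [SecondCountableTopology G] [MeasurableSpace G] [BorelSpace G] [TopologicalGroupoid G]
  (lam : HaarSystem G)

/-! ### Schur test -/

/-- Schur test: Cauchy–Schwarz with weight `W (x, ·)` uses the row bound, and after Tonelli the
column bound supplies the second factor `A`. -/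
theorem lintegral_mul_sq_le_of_schur {X : Type*} [MeasurableSpace X] {μ : Measure X} [SFinite μ]
    {W : X × X → ℝ≥0∞} (hW : AEMeasurable W (μ.prod μ)) {A : ℝ≥0∞}
    (h1 : ∀ᵐ x ∂μ, ∫⁻ y, W (x, y) ∂μ ≤ A) (h2 : ∀ᵐ y ∂μ, ∫⁻ x, W (x, y) ∂μ ≤ A)
    {k : X → ℝ≥0∞} (hk : AEMeasurable k μ) :
    ∫⁻ x, (∫⁻ y, W (x, y) * k y ∂μ) ^ 2 ∂μ ≤ A ^ 2 * ∫⁻ y, k y ^ 2 ∂μ := by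
  have hsec : ∀ᵐ x ∂μ, AEMeasurable (fun y => W (x, y)) μ := by
    filter_upwards [hW.aestronglyMeasurable.prodMk_left] with x hx using hx.aemeasurable
  have hk2 : AEMeasurable (fun p : X × X => k p.2 ^ 2) (μ.prod μ) :=
    (hk.comp_quasiMeasurePreserving Measure.quasiMeasurePreserving_snd).pow_const 2
  calc ∫⁻ x, (∫⁻ y, W (x, y) * k y ∂μ) ^ 2 ∂μ
      ≤ ∫⁻ x, A * ∫⁻ y, W (x, y) * k y ^ 2 ∂μ ∂μ := by
        refine lintegral_mono_ae ?_
        filter_upwards [hsec, h1] with x hx hxA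
        exact (lintegral_mul_sq_le μ hx hk).trans (mul_le_mul_left hxA _)
    _ = A * ∫⁻ x, ∫⁻ y, W (x, y) * k y ^ 2 ∂μ ∂μ :=
        lintegral_const_mul'' _ (hW.mul hk2).lintegral_prod_right'
    _ = A * ∫⁻ y, ∫⁻ x, W (x, y) * k y ^ 2 ∂μ ∂μ := by
        rw [lintegral_lintegral_swap]
        exact hW.mul hk2
    _ ≤ A * ∫⁻ y, A * k y ^ 2 ∂μ := by
        gcongr A * ?_
        have hsec' : ∀ᵐ y ∂μ, AEMeasurable (fun x => W (x, y)) μ := by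
          filter_upwards [hW.prod_swap.aestronglyMeasurable.prodMk_left] with x hx
            using hx.aemeasurable
        refine lintegral_mono_ae ?_
        filter_upwards [hsec', h2] with y hy hyA
        rw [lintegral_mul_const'' _ hy]
        gcongr
    _ = _ := by
        rw [lintegral_const_mul'' _ (hk.pow_const 2), ← _root_.mul_assoc, sq]

/-! ### Translation between fibres -/

/-- Products are constrained only on composable pairs, so translation is known to be continuous only
on the closed fibre that carries the measure. This is why translation identities are stated almost
everywhere. -/
theorem aemeasurable_inv_mul (t : G) (u : unitSpace G) (ht : rangeUnit t = u) :
    AEMeasurable (fun x => t⁻¹ * x) (lam.measure u) := by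
  subst ht
  have h1 : ContinuousOn (fun x : G => t⁻¹ * x) (fiber (rangeUnit t)) :=
    continuousOn_inv_mul.comp (f := fun x : G => (t, x)) (by fun_prop) (fun x hx => Eq.symm hx)
  have h2 := h1.aemeasurable (μ := lam.measure (rangeUnit t)) (isClosed_fiber _).measurableSet
  rwa [Measure.restrict_eq_self_of_ae_mem (s := fiber (rangeUnit t)) (lam.ae_r_eq _)] at h2

theorem aemeasurable_inv_mul_prod (u : unitSpace G) :
    AEMeasurable (fun p : G × G => p.1⁻¹ * p.2) ((lam.measure u).prod (lam.measure u)) := by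
  have hS : IsClosed (fiber u ×ˢ fiber u) := (isClosed_fiber u).prod (isClosed_fiber u)
  have h1 : ContinuousOn (fun p : G × G => p.1⁻¹ * p.2) (fiber u ×ˢ fiber u) :=
    continuousOn_inv_mul.mono fun p hp => hp.1.trans hp.2.symm
  have h2 := h1.aemeasurable (μ := (lam.measure u).prod (lam.measure u)) hS.measurableSet
  rwa [← Measure.prod_restrict, Measure.restrict_eq_self_of_ae_mem (s := fiber u)
    (lam.ae_r_eq u)] at h2

/-- Left invariance is given for integrals of functions in C_c(G). Measures finite on compact sets
are determined by such integrals, so it becomes an equality of measures, and then L² classes can be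
translated too. -/
theorem map_inv_mul (t : G) (u v : unitSpace G) (hr : rangeUnit t = u) (hs : sourceUnit t = v) :
    (lam.measure u).map (fun x => t⁻¹ * x) = lam.measure v := by
  have hm := lam.aemeasurable_inv_mul t u hr
  subst hr hs
  have key : ∀ g : C(G, ℝ), HasCompactSupport g → (∀ x, 0 ≤ g x) →
      ∫⁻ x, ENNReal.ofReal (g x) ∂((lam.measure (rangeUnit t)).map (fun x => t⁻¹ * x)) =
        ∫⁻ x, ENNReal.ofReal (g x) ∂lam.measure (sourceUnit t) := fun g hg h0 => by
    rw [lintegral_map' (by fun_prop) hm]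
    exact lam.lintegral_inv_mul g hg h0 t
  -- The mass of a compact set is at most the integral of a bump equal to 1 on it, which `key`
  -- transfers to the other fibre.
  have hfin : IsFiniteMeasureOnCompacts
      ((lam.measure (rangeUnit t)).map (fun x => t⁻¹ * x)) := by
    refine ⟨fun K hK => ?_⟩
    obtain ⟨c, hc1, hc2, -, hc3⟩ := exists_continuousMap_one_of_isCompact_subset_isOpen hK
      isOpen_univ (subset_univ K)
    refine lt_of_le_of_lt (b := ∫⁻ x, ENNReal.ofReal (c x)
      ∂((lam.measure (rangeUnit t)).map (fun x => t⁻¹ * x))) ?_ ?_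
    · rw [← lintegral_indicator_one hK.measurableSet]
      refine lintegral_mono fun x => ?_
      by_cases hx : x ∈ K
      · simp [hx, hc1 hx]
      · simp [hx]
    · rw [key c hc2 fun x => (hc3 x).1]
      exact (c.continuous.integrable_of_hasCompactSupport hc2).lintegral_lt_top
  refine Measure.ext_of_integral_eq_on_compactlySupported fun f => ?_
  have h := congrArg Complex.re (integral_map (μ := lam.measure (rangeUnit t)) hm
    (f := ofRealCc f.1 f.2) (by fun_prop))
  rw [integral_map hm (by fun_prop)]
  have h1 := lam.left_invariant (ofRealCc f.1 f.2) t⁻¹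
  have e1 : sourceUnit t⁻¹ = rangeUnit t := Subtype.ext (s_inv t)
  have e2 : rangeUnit t⁻¹ = sourceUnit t := Subtype.ext (r_inv t)
  rw [e1, e2] at h1
  have h2 : ((∫ x, f (t⁻¹ * x) ∂lam.measure (rangeUnit t) : ℝ) : ℂ) =
      ((∫ x, f x ∂lam.measure (sourceUnit t) : ℝ) : ℂ) :=
    integral_ofReal.symm.trans (h1.trans integral_ofReal)
  exact_mod_cast h2

theorem integral_translate (t : G) {u v : unitSpace G} (hr : rangeUnit t = u)
    (hs : sourceUnit t = v) {g : G → ℂ} (hg : AEStronglyMeasurable g (lam.measure v)) :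
    ∫ x, g (t⁻¹ * x) ∂lam.measure u = ∫ x, g x ∂lam.measure v := by
  have hm := lam.map_inv_mul t u v hr hs
  rw [← hm] at hg ⊢
  rw [integral_map (lam.aemeasurable_inv_mul t u hr) hg]

/-- Composition on `Lp` asks for an everywhere measurable map, so a representative of the
translation is used; `coeFn_transl` removes it again. -/
theorem measurePreserving_mk (t : G) {u v : unitSpace G} (hr : rangeUnit t = u)
    (hs : sourceUnit t = v) :
    MeasurePreserving (lam.aemeasurable_inv_mul t u hr).mk (lam.measure u) (lam.measure v) :=
  ⟨(lam.aemeasurable_inv_mul t u hr).measurable_mk, by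
    rw [← Measure.map_congr (lam.aemeasurable_inv_mul t u hr).ae_eq_mk,
      lam.map_inv_mul t u v hr hs]⟩

/-- The isometry `L²(G^v) → L²(G^u)`, `ξ ↦ ξ(t⁻¹ ·)`, for an arrow `t` from `v` to `u`. -/
def transl (t : G) {u v : unitSpace G} (hr : rangeUnit t = u) (hs : sourceUnit t = v) :
    Lp ℂ 2 (lam.measure v) →ₗᵢ[ℂ] Lp ℂ 2 (lam.measure u) :=
  Lp.compMeasurePreservingₗᵢ ℂ _ (lam.measurePreserving_mk t hr hs)

theorem coeFn_transl (t : G) {u v : unitSpace G} (hr : rangeUnit t = u) (hs : sourceUnit t = v)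
    (ξ : Lp ℂ 2 (lam.measure v)) :
    lam.transl t hr hs ξ =ᵐ[lam.measure u] fun x => ξ (t⁻¹ * x) := by
  refine (Lp.coeFn_compMeasurePreserving ξ (lam.measurePreserving_mk t hr hs)).trans ?_
  filter_upwards [(lam.aemeasurable_inv_mul t u hr).ae_eq_mk] with x hx
  rw [Function.comp_apply, ← hx]

theorem ae_translate (t : G) {u v : unitSpace G} (hr : rangeUnit t = u) (hs : sourceUnit t = v)
    {p : G → Prop} (hp : ∀ᵐ x ∂lam.measure v, p x) : ∀ᵐ x ∂lam.measure u, p (t⁻¹ * x) := by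
  filter_upwards [(lam.measurePreserving_mk t hr hs).quasiMeasurePreserving.ae hp,
    (lam.aemeasurable_inv_mul t u hr).ae_eq_mk] with x hx hx'
  rwa [hx']

theorem coeFn_restrict (f : C_c(G, ℂ)) (u : unitSpace G) :
    lam.restrict f u =ᵐ[lam.measure u] f := MemLp.coeFn_toLp _

theorem coeFn_transl_restrict (t : G) {u v : unitSpace G} (hr : rangeUnit t = u)
    (hs : sourceUnit t = v) (f : C_c(G, ℂ)) :
    lam.transl t hr hs (lam.restrict f v) =ᵐ[lam.measure u] fun x => f (t⁻¹ * x) := by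
  filter_upwards [lam.coeFn_transl t hr hs (lam.restrict f v),
    lam.ae_translate t hr hs (lam.coeFn_restrict f v)] with x hx hx'
  rw [hx, hx']

theorem transl_transl (γ t : G) {u v w : unitSpace G} (hγr : rangeUnit γ = u)
    (hγs : sourceUnit γ = v) (hr : rangeUnit t = v) (hs : sourceUnit t = w)
    (hr' : rangeUnit (γ * t) = u) (hs' : sourceUnit (γ * t) = w) (ξ : Lp ℂ 2 (lam.measure w)) :
    lam.transl γ hγr hγs (lam.transl t hr hs ξ) = lam.transl (γ * t) hr' hs' ξ := by
  refine Lp.ext ?_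
  filter_upwards [lam.coeFn_transl γ hγr hγs (lam.transl t hr hs ξ),
    lam.ae_translate γ hγr hγs (lam.coeFn_transl t hr hs ξ), lam.coeFn_transl (γ * t) hr' hs' ξ,
    lam.ae_r_eq u] with x h1 h2 h3 h4
  rw [h1, h2, h3]
  have e1 : r γ = (u : G) := (rangeUnit_eq_iff _ _).1 hγr
  have e2 : s γ = r t := by
    have a1 : s γ = (v : G) := congrArg Subtype.val hγs
    have a2 : r t = (v : G) := congrArg Subtype.val hr
    rw [a1, a2]
  congr 1
  refine (TopologicalGroupoid.mul_inv_mul γ t x e2 (e1.trans h4.symm)).symm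

theorem transl_unit (u : unitSpace G) (hr : rangeUnit (u : G) = u) (hs : sourceUnit (u : G) = u)
    (ξ : Lp ℂ 2 (lam.measure u)) : lam.transl (u : G) hr hs ξ = ξ := by
  refine Lp.ext ?_
  filter_upwards [lam.coeFn_transl (u : G) hr hs ξ, lam.ae_r_eq u] with x h1 h2
  rw [h1, inv_coe_mul u x h2]

/-! ### Convolution estimates on a fibre -/

/-- A bound for the fibre integrals of `|f|` and of `|f^∨|`. -/
theorem exists_schur_bound (f : C_c(G, ℂ)) :
    ∃ A : ℝ, 0 ≤ A ∧ ∀ u : unitSpace G, ∀ x : G, r x = u →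
      ∫⁻ y, ‖f (x⁻¹ * y)‖ₑ ∂lam.measure u ≤ ENNReal.ofReal A ∧
      ∫⁻ y, ‖f (y⁻¹ * x)‖ₑ ∂lam.measure u ≤ ENNReal.ofReal A := by
  obtain ⟨A₁, hA₁, h₁⟩ := lam.exists_lintegral_enorm_le f
  obtain ⟨A₂, hA₂, h₂⟩ := lam.exists_lintegral_enorm_le (reflect f)
  refine ⟨max A₁ A₂, hA₁.trans (le_max_left _ _), fun u x hx => ⟨?_, ?_⟩⟩
  · have h := lam.lintegral_enorm_inv_mul f one_ne_zero u x hx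
    simp only [pow_one] at h
    rw [h]
    exact (h₁ _).trans (ENNReal.ofReal_le_ofReal (le_max_left _ _))
  -- Left invariance controls integrals of f(x⁻¹y) over y. It reaches f(y⁻¹x) because this is
  -- f^∨(x⁻¹y).
  · have h := lam.lintegral_enorm_inv_mul (reflect f) one_ne_zero u x hx
    simp only [pow_one] at h
    have e : ∫⁻ y, ‖f (y⁻¹ * x)‖ₑ ∂lam.measure u =
        ∫⁻ y, ‖reflect f (x⁻¹ * y)‖ₑ ∂lam.measure u := by
      refine lintegral_congr_ae ?_
      filter_upwards [lam.ae_r_eq u] with y hy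
      change _ = ‖f (x⁻¹ * y)⁻¹‖ₑ
      rw [inv_mul_inv x y (hx.trans hy.symm)]
    rw [e, h]
    exact (h₂ _).trans (ENNReal.ofReal_le_ofReal (le_max_right _ _))

theorem lintegral_sq_lintegral_mul_right_le {f : C_c(G, ℂ)} {A : ℝ}
    (hA : ∀ u : unitSpace G, ∀ x : G, r x = u →
      ∫⁻ y, ‖f (x⁻¹ * y)‖ₑ ∂lam.measure u ≤ ENNReal.ofReal A ∧
      ∫⁻ y, ‖f (y⁻¹ * x)‖ₑ ∂lam.measure u ≤ ENNReal.ofReal A)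
    (u : unitSpace G) {k : G → ℝ≥0∞} (hk : AEMeasurable k (lam.measure u)) :
    ∫⁻ y, (∫⁻ x, ‖f (y⁻¹ * x)‖ₑ * k x ∂lam.measure u) ^ 2 ∂lam.measure u ≤
      ENNReal.ofReal A ^ 2 * ∫⁻ y, k y ^ 2 ∂lam.measure u := by
  refine lintegral_mul_sq_le_of_schur (W := fun p => ‖f (p.1⁻¹ * p.2)‖ₑ)
    (lam.aemeasurable_comp_inv_mul f u) ?_ ?_ hk
  · filter_upwards [lam.ae_r_eq u] with x hx using (hA u x hx).1
  · filter_upwards [lam.ae_r_eq u] with x hx using (hA u x hx).2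

theorem lintegral_mul_le_of_sq_le {X : Type*} [MeasurableSpace X] (μ : Measure X)
    {a b : X → ℝ≥0∞} (ha : AEMeasurable a μ) (hb : AEMeasurable b μ) {A B : ℝ≥0∞}
    (hA : ∫⁻ x, a x ^ 2 ∂μ ≤ A ^ 2) (hB : ∫⁻ x, b x ^ 2 ∂μ ≤ B ^ 2) :
    ∫⁻ x, a x * b x ∂μ ≤ A * B := by
  have h := ENNReal.lintegral_mul_le_Lp_mul_Lq μ Real.HolderConjugate.two_two ha hb
  refine h.trans ?_
  simp only [ENNReal.rpow_ofNat]
  have e : ∀ c : ℝ≥0∞, (c ^ 2) ^ (1 / 2 : ℝ) = c := fun c => by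
    rw [← ENNReal.rpow_natCast, ← ENNReal.rpow_mul]
    norm_num
  calc _ ≤ (A ^ 2) ^ (1 / 2 : ℝ) * (B ^ 2) ^ (1 / 2 : ℝ) := by gcongr
    _ = A * B := by rw [e, e]

theorem lintegral_enorm_sq_Lp {X : Type*} [MeasurableSpace X] (μ : Measure X) (a : Lp ℂ 2 μ) :
    ∫⁻ x, ‖a x‖ₑ ^ 2 ∂μ = ‖a‖ₑ ^ 2 := by
  rw [Lp.enorm_def, eLpNorm_eq_lintegral_rpow_enorm_toReal two_ne_zero ENNReal.ofNat_ne_top]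
  simp only [ENNReal.toReal_ofNat, one_div]
  rw [← ENNReal.rpow_natCast (_ ^ _), ← ENNReal.rpow_mul]
  norm_num

theorem aemeasurable_enorm_Lp {X : Type*} [MeasurableSpace X] {μ : Measure X} (a : Lp ℂ 2 μ) :
    AEMeasurable (fun x => ‖a x‖ₑ) μ := (Lp.aestronglyMeasurable a).enorm

/-- The Schur test bounds the inner integral in L², and Cauchy–Schwarz pairs it with `a`. Such
double integrals thus converge absolutely for `a` and `k` that are merely square integrable. -/
theorem lintegral_lintegral_mul_le {f : C_c(G, ℂ)} {A : ℝ}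
    (hA : ∀ u : unitSpace G, ∀ x : G, r x = u →
      ∫⁻ y, ‖f (x⁻¹ * y)‖ₑ ∂lam.measure u ≤ ENNReal.ofReal A ∧
      ∫⁻ y, ‖f (y⁻¹ * x)‖ₑ ∂lam.measure u ≤ ENNReal.ofReal A)
    (u : unitSpace G) (a k : Lp ℂ 2 (lam.measure u)) :
    ∫⁻ p, ‖a p.1 * f (p.1⁻¹ * p.2) * k p.2‖ₑ ∂(lam.measure u).prod (lam.measure u) ≤
      ENNReal.ofReal A * ‖a‖ₑ * ‖k‖ₑ := by
  have hf := lam.aemeasurable_comp_inv_mul f u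
  have ha : AEMeasurable (fun p : G × G => ‖a p.1‖ₑ) ((lam.measure u).prod (lam.measure u)) :=
    (aemeasurable_enorm_Lp a).comp_quasiMeasurePreserving Measure.quasiMeasurePreserving_fst
  have hk : AEMeasurable (fun p : G × G => ‖k p.2‖ₑ) ((lam.measure u).prod (lam.measure u)) :=
    (aemeasurable_enorm_Lp k).comp_quasiMeasurePreserving Measure.quasiMeasurePreserving_snd
  simp_rw [enorm_mul]
  rw [lintegral_prod (fun p : G × G => ‖a p.1‖ₑ * ‖f (p.1⁻¹ * p.2)‖ₑ * ‖k p.2‖ₑ)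
    ((ha.mul hf).mul hk)]
  simp only [_root_.mul_assoc]
  have hin : AEMeasurable (fun y => ∫⁻ x, ‖f (y⁻¹ * x)‖ₑ * ‖k x‖ₑ ∂lam.measure u)
      (lam.measure u) := (hf.mul hk).lintegral_prod_right'
  simp_rw [lintegral_const_mul' _ _ enorm_ne_top]
  have h2 := lam.lintegral_sq_lintegral_mul_right_le hA u (aemeasurable_enorm_Lp k)
  rw [lintegral_enorm_sq_Lp, ← mul_pow] at h2
  refine (lintegral_mul_le_of_sq_le _ (aemeasurable_enorm_Lp a) hin
    (lintegral_enorm_sq_Lp _ a).le h2).trans_eq ?_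
  ring

theorem aestronglyMeasurable_mul_inv_mul (f : G → ℂ) (hf : Measurable f) (u : unitSpace G)
    (a k : Lp ℂ 2 (lam.measure u)) :
    AEStronglyMeasurable (fun p : G × G => a p.1 * f (p.1⁻¹ * p.2) * k p.2)
      ((lam.measure u).prod (lam.measure u)) :=
  ((Lp.aestronglyMeasurable a).comp_fst.mul
    (hf.comp_aemeasurable (lam.aemeasurable_inv_mul_prod u)).aestronglyMeasurable).mul
    (Lp.aestronglyMeasurable k).comp_snd

theorem integrable_mul_inv_mul (f : C_c(G, ℂ)) (u : unitSpace G) (a k : Lp ℂ 2 (lam.measure u)) :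
    Integrable (fun p : G × G => a p.1 * f (p.1⁻¹ * p.2) * k p.2)
      ((lam.measure u).prod (lam.measure u)) := by
  obtain ⟨A, -, hA⟩ := lam.exists_schur_bound f
  refine ⟨lam.aestronglyMeasurable_mul_inv_mul f f.continuous.measurable u a k, ?_⟩
  refine (lam.lintegral_lintegral_mul_le hA u a k).trans_lt ?_
  exact ENNReal.mul_lt_top (ENNReal.mul_lt_top ENNReal.ofReal_lt_top enorm_lt_top) enorm_lt_top

/-- The bilinear form `(a, k) ↦ ∬ a(y) f(y⁻¹x) k(x) dλ^u(y) dλ^u(x)` on `L²(G^u)`. -/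
def bilin (f : C_c(G, ℂ)) (u : unitSpace G) (a k : Lp ℂ 2 (lam.measure u)) : ℂ :=
  ∫ p, a p.1 * f (p.1⁻¹ * p.2) * k p.2 ∂(lam.measure u).prod (lam.measure u)

theorem norm_bilin_le {f : C_c(G, ℂ)} {A : ℝ} (hA0 : 0 ≤ A)
    (hA : ∀ u : unitSpace G, ∀ x : G, r x = u →
      ∫⁻ y, ‖f (x⁻¹ * y)‖ₑ ∂lam.measure u ≤ ENNReal.ofReal A ∧
      ∫⁻ y, ‖f (y⁻¹ * x)‖ₑ ∂lam.measure u ≤ ENNReal.ofReal A)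
    (u : unitSpace G) (a k : Lp ℂ 2 (lam.measure u)) :
    ‖lam.bilin f u a k‖ ≤ A * ‖a‖ * ‖k‖ := by
  have h := (enorm_integral_le_lintegral_enorm _).trans (lam.lintegral_lintegral_mul_le hA u a k)
  rw [← ofReal_norm, ← ofReal_norm, ← ofReal_norm, ← ENNReal.ofReal_mul hA0,
    ← ENNReal.ofReal_mul (by positivity), ENNReal.ofReal_le_ofReal_iff (by positivity)] at h
  exact h

theorem bilin_sub_left (f : C_c(G, ℂ)) (u : unitSpace G) (a b k : Lp ℂ 2 (lam.measure u)) :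
    lam.bilin f u (a - b) k = lam.bilin f u a k - lam.bilin f u b k := by
  rw [bilin, bilin, bilin, ← integral_sub (lam.integrable_mul_inv_mul f u a k)
    (lam.integrable_mul_inv_mul f u b k)]
  refine integral_congr_ae ?_
  have h := Measure.quasiMeasurePreserving_fst (μ := lam.measure u) (ν := lam.measure u)
    |>.ae (Lp.coeFn_sub a b)
  filter_upwards [h] with p hp
  rw [hp, Pi.sub_apply]
  ring

/-! ### Associativity of the convolution -/

/-- Fubini, then the substitution w ↦ t⁻¹w in the inner integral by left invariance. -/
theorem conv_assoc (f g h : C_c(G, ℂ)) :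
    lam.convCc (lam.convCc f g) h = lam.convCc f (lam.convCc g h) := by
  ext x
  set u := rangeUnit x with hu
  -- h(w⁻¹x) is the translate of h^∨ by x, so absolute convergence is an instance of the L² bound.
  have hint : Integrable (fun p : G × G => f p.1 * g (p.1⁻¹ * p.2) * h (p.2⁻¹ * x))
      ((lam.measure u).prod (lam.measure u)) := by
    refine (lam.integrable_mul_inv_mul g u (lam.restrict f u)
      (lam.transl x hu.symm rfl (lam.restrict (reflect h) (sourceUnit x)))).congr ?_
    filter_upwards [Measure.quasiMeasurePreserving_fst.ae (lam.coeFn_restrict f u),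
      Measure.quasiMeasurePreserving_snd.ae (lam.coeFn_transl_restrict x hu.symm rfl (reflect h)),
      Measure.quasiMeasurePreserving_snd.ae (lam.ae_r_eq u)] with p h1 h2 h3
    rw [h1, h2]
    change _ * h (x⁻¹ * p.2)⁻¹ = _
    rw [inv_mul_inv x p.2 h3.symm]
  calc ∫ w, lam.conv f g w * h (w⁻¹ * x) ∂lam.measure u
      = ∫ w, ∫ t, f t * g (t⁻¹ * w) * h (w⁻¹ * x) ∂lam.measure u ∂lam.measure u := by
        refine integral_congr_ae ?_
        filter_upwards [lam.ae_r_eq u] with w hw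
        rw [integral_mul_const, conv, (rangeUnit_eq_iff w u).2 hw]
    _ = ∫ t, ∫ w, f t * g (t⁻¹ * w) * h (w⁻¹ * x) ∂lam.measure u ∂lam.measure u :=
        (integral_integral_swap (f := fun t w => f t * g (t⁻¹ * w) * h (w⁻¹ * x)) hint).symm
    _ = ∫ t, f t * lam.conv g h (t⁻¹ * x) ∂lam.measure u := by
        refine integral_congr_ae ?_
        filter_upwards [lam.ae_r_eq u] with t ht
        have ht' : r t = r x := ht
        simp_rw [_root_.mul_assoc]
        rw [integral_const_mul]
        congr 1
        have e1 : rangeUnit (t⁻¹ * x) = sourceUnit t := Subtype.ext (r_inv_mul t x ht')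
        have h1 := (lam.integrable_conv g h (t⁻¹ * x)).aestronglyMeasurable
        rw [e1] at h1
        have h2 := lam.integral_translate t ((rangeUnit_eq_iff t u).2 ht) rfl h1
        rw [conv, e1, ← h2]
        refine integral_congr_ae ?_
        filter_upwards [lam.ae_r_eq u] with w hw
        rw [inv_mul_inv_mul t w x (ht'.trans hw.symm) ht']

/-! ### Algebra of the convolution operators -/

theorem clm_ext {E : Type*} [NormedAddCommGroup E] [NormedSpace ℂ E] {S T : lam.E2 →L[ℂ] E}
    (h : ∀ f, S (lam.toE2 f) = T (lam.toE2 f)) : S = T :=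
  DFunLike.coe_injective (lam.denseRange_toE2.equalizer S.continuous T.continuous (funext h))

theorem leftConv_add (F F' : C_c(G, ℂ)) :
    lam.leftConv (F + F') = lam.leftConv F + lam.leftConv F' :=
  lam.clm_ext fun f => by
    rw [add_apply]
    simp only [leftConv_toE2]
    rw [← map_add]
    exact congrArg lam.toE2 ((lam.rightConvCc f).map_add F F')

theorem leftConv_smul (c : ℂ) (F : C_c(G, ℂ)) : lam.leftConv (c • F) = c • lam.leftConv F :=
  lam.clm_ext fun f => by
    rw [smul_apply]
    simp only [leftConv_toE2]
    rw [← map_smul]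
    exact congrArg lam.toE2 ((lam.rightConvCc f).map_smul c F)

/-- The map `F ↦ L_F` as a linear map. -/
def leftConvₗ : C_c(G, ℂ) →ₗ[ℂ] lam.E2 →L[ℂ] lam.E2 where
  toFun := lam.leftConv
  map_add' := lam.leftConv_add
  map_smul' := lam.leftConv_smul

theorem leftConv_mul (F F' : C_c(G, ℂ)) :
    lam.leftConv F * lam.leftConv F' = lam.leftConv (lam.convCc F F') :=
  lam.clm_ext fun f => by
    rw [mul_apply_eq_comp]
    simp only [leftConv_toE2, conv_assoc]

theorem leftConv_rightConv (F F' : C_c(G, ℂ)) :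
    lam.leftConv F ∘L lam.rightConv F' = lam.rightConv F' ∘L lam.leftConv F :=
  lam.clm_ext fun f => by
    rw [ContinuousLinearMap.comp_apply, ContinuousLinearMap.comp_apply]
    simp only [leftConv_toE2, rightConv_toE2, conv_assoc]

theorem exists_nonUnitalSubalgebra_eq_range_leftConv :
    ∃ A : NonUnitalSubalgebra ℂ (lam.E2 →L[ℂ] lam.E2),
      (A : Set (lam.E2 →L[ℂ] lam.E2)) = Set.range lam.leftConv :=
  ⟨{ carrier := Set.range lam.leftConv
     add_mem' := by
      rintro _ _ ⟨F, rfl⟩ ⟨F', rfl⟩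
      exact ⟨F + F', lam.leftConv_add F F'⟩
     zero_mem' := ⟨0, lam.leftConvₗ.map_zero⟩
     smul_mem' := by
      rintro c _ ⟨F, rfl⟩
      exact ⟨c • F, lam.leftConv_smul c F⟩
     mul_mem' := by
      rintro _ _ ⟨F, rfl⟩ ⟨F', rfl⟩
      exact ⟨_, (lam.leftConv_mul F F').symm⟩ }, rfl⟩

/-! ### The strong operator topology -/

theorem strongClosure_subset_VN : strongClosure (Set.range lam.leftConv) ⊆ lam.VN := by
  let C : Set (lam.E2 →Lₚₜ[ℂ] lam.E2) :=
    {T | ∀ F ξ, T (lam.rightConv F ξ) = lam.rightConv F (T ξ)}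
  have hcl : IsClosed C := by
    simp only [C, ofPred_forall]
    refine isClosed_iInter fun F => isClosed_iInter fun ξ => ?_
    exact isClosed_eq (continuous_eval_const _)
      ((lam.rightConv F).continuous.comp (continuous_eval_const _))
  intro T hT F
  have hsub : (Set.range lam.leftConv : Set (lam.E2 →Lₚₜ[ℂ] lam.E2)) ⊆ C := by
    rintro _ ⟨F, rfl⟩ F' ξ
    exact DFunLike.congr_fun (lam.leftConv_rightConv F F') ξ
  exact ContinuousLinearMap.ext fun ξ => closure_minimal hsub hcl hT F ξ

/-- Basic neighbourhoods for pointwise convergence test finitely many vectors at once; hence the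
tuples of sections below. -/
theorem mem_strongClosure {E : Type*} [NormedAddCommGroup E] [NormedSpace ℂ E]
    {S : Set (E →L[ℂ] E)} {T : E →L[ℂ] E}
    (h : ∀ (J : Finset E) (ε : ℝ), 0 < ε → ∃ L ∈ S, ∀ ξ ∈ J, ‖L ξ - T ξ‖ < ε) :
    T ∈ strongClosure S := by
  have hb := (PointwiseConvergenceCLM.withSeminorms (σ := RingHom.id ℂ) (E := E)
    (F := E)).hasBasis_ball (x := T)
  refine (mem_closure_iff_nhds_basis hb).2 fun p hp => ?_
  obtain ⟨L, hL, hLT⟩ := h p.1 p.2 hp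
  refine ⟨L, hL, ?_⟩
  refine (Seminorm.mem_ball _).2 ?_
  exact Seminorm.finset_sup_apply_lt hp hLT

/-! ### Evaluation of sections -/

/-- Evaluation of sections at a unit. -/
def evalE2 (u : unitSpace G) : lam.E2 →L[ℂ] Lp ℂ 2 (lam.measure u) :=
  LinearMap.mkContinuous
    { toFun := fun ξ => ξ.1 u
      map_add' := fun _ _ => rfl
      map_smul' := fun _ _ => rfl } 1 fun ξ => by
        rw [one_mul]
        exact lam.norm_apply_le ξ u

theorem evalE2_toE2 (u : unitSpace G) (f : C_c(G, ℂ)) :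
    lam.evalE2 u (lam.toE2 f) = lam.restrict f u := rfl

theorem norm_evalE2_le (u : unitSpace G) (ξ : lam.E2) : ‖lam.evalE2 u ξ‖ ≤ ‖ξ‖ :=
  lam.norm_apply_le ξ u

theorem rangeUnit_fiber {u : unitSpace G} (y : fiber u) : rangeUnit (y : G) = u :=
  (rangeUnit_eq_iff _ _).2 y.2

/-- The translate of a section to the fibre `G^u` by an arrow `y` with range `u`. -/
def translE2 {u : unitSpace G} (y : fiber u) : lam.E2 →L[ℂ] Lp ℂ 2 (lam.measure u) :=
  (lam.transl (y : G) (rangeUnit_fiber y) rfl).toContinuousLinearMap ∘L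
    lam.evalE2 (sourceUnit (y : G))

theorem translE2_apply {u : unitSpace G} (y : fiber u) (ξ : lam.E2) :
    lam.translE2 y ξ = lam.transl (y : G) (rangeUnit_fiber y) rfl
      (lam.evalE2 (sourceUnit (y : G)) ξ) := rfl

theorem norm_translE2 {u : unitSpace G} (y : fiber u) (ξ : lam.E2) :
    ‖lam.translE2 y ξ‖ = ‖lam.evalE2 (sourceUnit (y : G)) ξ‖ :=
  (lam.transl (y : G) (rangeUnit_fiber y) rfl).norm_map _

theorem norm_translE2_le {u : unitSpace G} (y : fiber u) (ξ : lam.E2) :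
    ‖lam.translE2 y ξ‖ ≤ ‖ξ‖ :=
  (lam.norm_translE2 y ξ).trans_le (lam.norm_evalE2_le _ ξ)

theorem coeFn_translE2_toE2 {u : unitSpace G} (y : fiber u) (f : C_c(G, ℂ)) :
    lam.translE2 y (lam.toE2 f) =ᵐ[lam.measure u] fun x => f ((y : G)⁻¹ * x) :=
  lam.coeFn_transl_restrict (y : G) (rangeUnit_fiber y) rfl f

theorem transl_congr_unit {t : G} {u v v' : unitSpace G} (hr : rangeUnit t = u)
    (hs : sourceUnit t = v) (hs' : sourceUnit t = v') (ξ : lam.E2) :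
    lam.transl t hr hs (lam.evalE2 v ξ) = lam.transl t hr hs' (lam.evalE2 v' ξ) := by
  subst hs hs'
  rfl

theorem transl_translE2 {u v : unitSpace G} {γ : G} (hr : rangeUnit γ = u)
    (hs : sourceUnit γ = v) (y : fiber v) (z : fiber u) (hz : (z : G) = γ * y) (ξ : lam.E2) :
    lam.transl γ hr hs (lam.translE2 y ξ) = lam.translE2 z ξ := by
  obtain ⟨_, hz'⟩ := z
  obtain rfl : _ = γ * (y : G) := hz
  have e2 : s γ = r (y : G) := by
    have a1 : s γ = (v : G) := congrArg Subtype.val hs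
    have a2 : r (y : G) = (v : G) := y.2
    rw [a1, a2]
  have hs' : sourceUnit (γ * (y : G)) = sourceUnit (y : G) := Subtype.ext (s_mul _ _ e2)
  rw [translE2_apply, lam.transl_transl γ y hr hs (rangeUnit_fiber y) rfl
    ((rangeUnit_eq_iff _ _).2 hz') hs', translE2_apply]
  exact lam.transl_congr_unit _ _ _ ξ

/-- A unit as a point of its own fibre. -/
def unitFiber (u : unitSpace G) : fiber u := ⟨u, u.2⟩

theorem translE2_unitFiber (u : unitSpace G) (ξ : lam.E2) :
    lam.translE2 (unitFiber u) ξ = lam.evalE2 u ξ := by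
  rw [translE2_apply, lam.transl_congr_unit _ _ (show sourceUnit ((unitFiber u : fiber u) : G) = u
    from sourceUnit_coe u) ξ]
  exact lam.transl_unit u _ _ _

/-! ### Continuity of translates -/

theorem continuous_sourceUnit : Continuous (sourceUnit : G → unitSpace G) :=
  continuous_s.subtype_mk _

/-- The function `t ↦ ‖f(t⁻¹ ·) - f‖²` (norm in `L²(G^{r(t)})`). -/
def defect (f : C_c(G, ℂ)) (t : G) : ℝ :=
  ‖lam.transl t rfl rfl (lam.restrict f (sourceUnit t)) - lam.restrict f (rangeUnit t)‖ ^ 2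

/-- Expand the square, translation being isometric: the cross term is the value at t of conj f *
f^∨. Every term is then a continuous function of t, although the vectors live in varying L² spaces.
-/
theorem defect_eq (f : C_c(G, ℂ)) (t : G) :
    lam.defect f t = ‖lam.restrict f (sourceUnit t)‖ ^ 2 + ‖lam.restrict f (rangeUnit t)‖ ^ 2 -
      2 * (lam.convCc (star f) (reflect f) t).re := by
  have h : inner ℂ (lam.restrict f (rangeUnit t))
      (lam.transl t rfl rfl (lam.restrict f (sourceUnit t))) =
      lam.convCc (star f) (reflect f) t := by
    rw [L2.inner_def]
    refine integral_congr_ae ?_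
    filter_upwards [lam.coeFn_restrict f (rangeUnit t),
      lam.coeFn_transl_restrict t rfl rfl f, lam.ae_r_eq (rangeUnit t)] with x h1 h2 h3
    have h3' : r x = r t := h3
    rw [h1, h2]
    change _ = star (f x) * f (x⁻¹ * t)⁻¹
    rw [inv_mul_inv x t h3', RCLike.inner_apply, mul_comm]
    rfl
  rw [defect, ← h, norm_sub_rev, @norm_sub_sq ℂ, LinearIsometry.norm_map]
  change _ - 2 * (inner ℂ _ _ : ℂ).re + _ = _
  ring

theorem continuous_defect (f : C_c(G, ℂ)) : Continuous (lam.defect f) := by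
  have h : lam.defect f = fun t => ‖lam.restrict f (sourceUnit t)‖ ^ 2 +
      ‖lam.restrict f (rangeUnit t)‖ ^ 2 - 2 * (lam.convCc (star f) (reflect f) t).re :=
    funext (lam.defect_eq f)
  rw [h]
  have h1 := ((lam.continuous_norm_restrict f).comp continuous_sourceUnit).pow 2
  have h2 := ((lam.continuous_norm_restrict f).comp continuous_rangeUnit).pow 2
  exact (h1.add h2).sub (continuous_const.mul
    (Complex.continuous_re.comp (lam.convCc (star f) (reflect f)).continuous))

/-- Translating back by y compares y⁻¹t with a unit. Continuity of y ↦ y·f thus reduces to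
continuity of `defect`. -/
theorem norm_translE2_sub_sq {u : unitSpace G} (t y : fiber u) (f : C_c(G, ℂ)) :
    ‖lam.translE2 t (lam.toE2 f) - lam.translE2 y (lam.toE2 f)‖ ^ 2 =
      lam.defect f ((y : G)⁻¹ * t) := by
  have hyt : r (y : G) = r (t : G) := Eq.trans y.2 (Eq.symm t.2)
  have hz : (y : G)⁻¹ * t ∈ fiber (sourceUnit (y : G)) := r_inv_mul _ _ hyt
  have h1 := lam.transl_translE2 (rangeUnit_fiber y) rfl ⟨_, hz⟩ t
    (inv_mul_cancel_left (y : G) t hyt).symm (lam.toE2 f)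
  have h2 : lam.transl (y : G) (rangeUnit_fiber y) rfl (lam.evalE2 (sourceUnit (y : G))
    (lam.toE2 f)) = lam.translE2 y (lam.toE2 f) := rfl
  rw [← h1, ← h2, ← map_sub, LinearIsometry.norm_map]
  have key : ∀ (v : unitSpace G) (z : G) (hz : z ∈ fiber v),
      ‖lam.translE2 ⟨z, hz⟩ (lam.toE2 f) - lam.evalE2 v (lam.toE2 f)‖ ^ 2 = lam.defect f z := by
    intro v z hz
    obtain rfl := (rangeUnit_eq_iff z v).2 hz
    rfl
  exact key _ _ hz

theorem defect_unit (f : C_c(G, ℂ)) (u : unitSpace G) : lam.defect f u = 0 := by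
  have h := lam.norm_translE2_sub_sq (unitFiber u) (unitFiber u) f
  rw [sub_self, norm_zero, zero_pow two_ne_zero] at h
  have e : ((unitFiber u : fiber u) : G)⁻¹ * (unitFiber u : fiber u) = u :=
    inv_coe_mul u _ u.2
  rw [e] at h
  exact h.symm

theorem continuous_translE2_toE2 {u : unitSpace G} (f : C_c(G, ℂ)) :
    Continuous fun y : fiber u => lam.translE2 y (lam.toE2 f) := by
  refine continuous_iff_continuousAt.2 fun y => tendsto_iff_norm_sub_tendsto_zero.2 ?_
  have h1 : Continuous fun t : fiber u => lam.defect f ((y : G)⁻¹ * t) :=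
    (lam.continuous_defect f).comp (continuousOn_inv_mul.comp_continuous
      (f := fun t : fiber u => ((y : G), (t : G))) (by fun_prop)
      fun t => Eq.trans y.2 (Eq.symm t.2))
  have h2 := h1.sqrt.tendsto y
  simp_rw [← norm_translE2_sub_sq, Real.sqrt_sq (norm_nonneg _)] at h2
  simpa using h2

/-! ### Left convolution as an average of translates -/

/-- Cauchy–Schwarz with weight |F| and Tonelli take the place of Minkowski's integral inequality.
When the slices φ(t, ·) are uniformly bounded in L², the outcome is the same L¹ bound. -/
theorem lintegral_enorm_sq_integral_mul_le (F : C_c(G, ℂ)) (u : unitSpace G) {φ : G × G → ℂ}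
    (hφ : AEStronglyMeasurable φ ((lam.measure u).prod (lam.measure u))) :
    ∫⁻ x, ‖∫ t, F t * φ (t, x) ∂lam.measure u‖ₑ ^ 2 ∂lam.measure u ≤
      (∫⁻ t, ‖F t‖ₑ ∂lam.measure u) *
        ∫⁻ t, ‖F t‖ₑ * ∫⁻ x, ‖φ (t, x)‖ₑ ^ 2 ∂lam.measure u ∂lam.measure u := by
  have hF : AEMeasurable (fun t => ‖F t‖ₑ) (lam.measure u) := F.continuous.enorm.aemeasurable
  have hF' : ∫⁻ t, ‖F t‖ₑ ∂lam.measure u ≠ ∞ := by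
    obtain ⟨A, -, hA⟩ := lam.exists_lintegral_enorm_le F
    exact ((hA u).trans_lt ENNReal.ofReal_lt_top).ne
  calc ∫⁻ x, ‖∫ t, F t * φ (t, x) ∂lam.measure u‖ₑ ^ 2 ∂lam.measure u
      ≤ ∫⁻ x, (∫⁻ t, ‖F t‖ₑ ∂lam.measure u) *
          ∫⁻ t, ‖F t‖ₑ * ‖φ (t, x)‖ₑ ^ 2 ∂lam.measure u ∂lam.measure u := by
        refine lintegral_mono_ae ?_
        filter_upwards [hφ.prod_swap.prodMk_left] with x hx
        refine le_trans ?_ (lintegral_mul_sq_le _ hF hx.enorm)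
        gcongr
        refine (enorm_integral_le_lintegral_enorm _).trans_eq ?_
        simp_rw [enorm_mul]
    _ = (∫⁻ t, ‖F t‖ₑ ∂lam.measure u) * ∫⁻ x, ∫⁻ t, ‖F t‖ₑ * ‖φ (t, x)‖ₑ ^ 2
          ∂lam.measure u ∂lam.measure u := lintegral_const_mul' _ _ hF'
    _ = (∫⁻ t, ‖F t‖ₑ ∂lam.measure u) * ∫⁻ t, ∫⁻ x, ‖F t‖ₑ * ‖φ (t, x)‖ₑ ^ 2
          ∂lam.measure u ∂lam.measure u := by
        rw [lintegral_lintegral_swap]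
        exact ((F.continuous.enorm.comp continuous_snd).aemeasurable).mul
          (hφ.prod_swap.enorm.pow_const 2)
    _ = _ := by
        simp_rw [lintegral_const_mul' _ _ enorm_ne_top]

theorem integrable_Cc (F : C_c(G, ℂ)) (u : unitSpace G) : Integrable F (lam.measure u) :=
  F.continuous.integrable_of_hasCompactSupport F.hasCompactSupport

theorem aestronglyMeasurable_comp_inv_mul (f : C_c(G, ℂ)) (u : unitSpace G) :
    AEStronglyMeasurable (fun p : G × G => f (p.1⁻¹ * p.2))
      ((lam.measure u).prod (lam.measure u)) :=
  (f.continuous.measurable.comp_aemeasurable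
    (lam.aemeasurable_inv_mul_prod u)).aestronglyMeasurable

theorem lintegral_enorm_sq_congr {u : unitSpace G} {φ : G → ℂ} {a : Lp ℂ 2 (lam.measure u)}
    (h : a =ᵐ[lam.measure u] φ) : ∫⁻ x, ‖φ x‖ₑ ^ 2 ∂lam.measure u = ‖a‖ₑ ^ 2 := by
  rw [← lintegral_enorm_sq_Lp]
  exact lintegral_congr_ae (h.mono fun x hx => by simp only [hx])

/-- F * f is the average of the translates t·f with weight F(t), so only the translates with F(t) ≠
0 matter. Applied with F concentrated near y, or near the unit space, this yields both approximation
results below. -/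
theorem enorm_restrict_conv_sub_le (F f : C_c(G, ℂ)) {u : unitSpace G} (y : fiber u) {ε : ℝ}
    (h : ∀ t : fiber u, F t ≠ 0 →
      ‖lam.translE2 t (lam.toE2 f) - lam.translE2 y (lam.toE2 f)‖ ≤ ε) :
    ‖lam.restrict (lam.convCc F f) u -
      (∫ t, F t ∂lam.measure u) • lam.translE2 y (lam.toE2 f)‖ₑ ≤
      (∫⁻ t, ‖F t‖ₑ ∂lam.measure u) * ENNReal.ofReal ε := by
  have hy := lam.coeFn_translE2_toE2 y f
  have hφ : AEStronglyMeasurable (fun p : G × G => f (p.1⁻¹ * p.2) - f ((y : G)⁻¹ * p.2))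
      ((lam.measure u).prod (lam.measure u)) :=
    (lam.aestronglyMeasurable_comp_inv_mul f u).sub
      (((Lp.aestronglyMeasurable _).congr hy).comp_snd)
  have h1 := lam.lintegral_enorm_sq_integral_mul_le F u hφ
  have h2 : ∫⁻ x, ‖∫ t, F t * (f (t⁻¹ * x) - f ((y : G)⁻¹ * x)) ∂lam.measure u‖ₑ ^ 2
      ∂lam.measure u = ‖lam.restrict (lam.convCc F f) u -
      (∫ t, F t ∂lam.measure u) • lam.translE2 y (lam.toE2 f)‖ₑ ^ 2 := by
    refine lam.lintegral_enorm_sq_congr ?_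
    filter_upwards [Lp.coeFn_sub (lam.restrict (lam.convCc F f) u)
      ((∫ t, F t ∂lam.measure u) • lam.translE2 y (lam.toE2 f)),
      Lp.coeFn_smul (∫ t, F t ∂lam.measure u) (lam.translE2 y (lam.toE2 f)), hy,
      lam.coeFn_restrict (lam.convCc F f) u, lam.ae_r_eq u] with x h1 h2 h3 h4 h5
    obtain rfl := (rangeUnit_eq_iff x u).2 h5
    rw [h1, Pi.sub_apply, h2, Pi.smul_apply, h3, h4, smul_eq_mul, ← integral_mul_const]
    simp_rw [mul_sub]
    exact (integral_sub (lam.integrable_conv F f x)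
      ((lam.integrable_Cc F _).mul_const _)).symm
  have h3 : ∫⁻ t, ‖F t‖ₑ * ∫⁻ x, ‖f (t⁻¹ * x) - f ((y : G)⁻¹ * x)‖ₑ ^ 2 ∂lam.measure u
      ∂lam.measure u ≤ (∫⁻ t, ‖F t‖ₑ ∂lam.measure u) * ENNReal.ofReal ε ^ 2 := by
    rw [← lintegral_mul_const' _ _ (by finiteness)]
    refine lintegral_mono_ae ?_
    filter_upwards [lam.ae_r_eq u] with t ht
    by_cases hFt : F t = 0
    · simp [hFt]
    gcongr
    have hd : lam.translE2 (⟨t, ht⟩ : fiber u) (lam.toE2 f) - lam.translE2 y (lam.toE2 f)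
        =ᵐ[lam.measure u] fun x => f (t⁻¹ * x) - f ((y : G)⁻¹ * x) :=
      (Lp.coeFn_sub _ _).trans
        ((lam.coeFn_translE2_toE2 (⟨t, ht⟩ : fiber u) f).sub hy)
    rw [lam.lintegral_enorm_sq_congr hd, ← ofReal_norm]
    gcongr
    exact h ⟨t, ht⟩ hFt
  simp only at h1
  rw [h2] at h1
  refine (ENNReal.pow_le_pow_left_iff two_ne_zero).1 ?_
  calc _ ≤ _ := h1
    _ ≤ (∫⁻ t, ‖F t‖ₑ ∂lam.measure u) *
        ((∫⁻ t, ‖F t‖ₑ ∂lam.measure u) * ENNReal.ofReal ε ^ 2) := by gcongr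
    _ = _ := by ring

theorem enorm_restrict_conv_le (F f : C_c(G, ℂ)) (u : unitSpace G) :
    ‖lam.restrict (lam.convCc F f) u‖ₑ ≤ (∫⁻ t, ‖F t‖ₑ ∂lam.measure u) * ‖lam.toE2 f‖ₑ := by
  have h1 := lam.lintegral_enorm_sq_integral_mul_le F u (lam.aestronglyMeasurable_comp_inv_mul f u)
  have h2 : ∫⁻ x, ‖∫ t, F t * f (t⁻¹ * x) ∂lam.measure u‖ₑ ^ 2 ∂lam.measure u =
      ‖lam.restrict (lam.convCc F f) u‖ₑ ^ 2 := by
    refine lam.lintegral_enorm_sq_congr ?_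
    filter_upwards [lam.coeFn_restrict (lam.convCc F f) u, lam.ae_r_eq u] with x h4 h5
    obtain rfl := (rangeUnit_eq_iff x u).2 h5
    exact h4
  have h3 : ∫⁻ t, ‖F t‖ₑ * ∫⁻ x, ‖f (t⁻¹ * x)‖ₑ ^ 2 ∂lam.measure u
      ∂lam.measure u ≤ (∫⁻ t, ‖F t‖ₑ ∂lam.measure u) * ‖lam.toE2 f‖ₑ ^ 2 := by
    rw [← lintegral_mul_const' _ _ (by finiteness)]
    refine lintegral_mono_ae ?_
    filter_upwards [lam.ae_r_eq u] with t ht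
    gcongr
    rw [lam.lintegral_enorm_sq_congr (lam.coeFn_translE2_toE2 (⟨t, ht⟩ : fiber u) f)]
    gcongr
    rw [← ofReal_norm, ← ofReal_norm]
    exact ENNReal.ofReal_le_ofReal (lam.norm_translE2_le _ _)
  simp only at h1
  rw [h2] at h1
  refine (ENNReal.pow_le_pow_left_iff two_ne_zero).1 ?_
  calc _ ≤ _ := h1
    _ ≤ (∫⁻ t, ‖F t‖ₑ ∂lam.measure u) *
        ((∫⁻ t, ‖F t‖ₑ ∂lam.measure u) * ‖lam.toE2 f‖ₑ ^ 2) := by gcongr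
    _ = _ := by ring

theorem norm_evalE2_leftConv_le {F : C_c(G, ℂ)} {u : unitSpace G} {A : ℝ} (hA : 0 ≤ A)
    (h : ∫⁻ t, ‖F t‖ₑ ∂lam.measure u ≤ ENNReal.ofReal A) (ξ : lam.E2) :
    ‖lam.evalE2 u (lam.leftConv F ξ)‖ ≤ A * ‖ξ‖ := by
  have hcl : IsClosed {ξ : lam.E2 | ‖lam.evalE2 u (lam.leftConv F ξ)‖ ≤ A * ‖ξ‖} :=
    isClosed_le (by fun_prop) (by fun_prop)
  refine lam.denseRange_toE2.induction_on ξ hcl fun f => ?_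
  rw [leftConv_toE2, evalE2_toE2]
  have h1 := (lam.enorm_restrict_conv_le F f u).trans (mul_le_mul_left h _)
  rwa [← ofReal_norm, ← ofReal_norm, ← ENNReal.ofReal_mul hA,
    ENNReal.ofReal_le_ofReal_iff (by positivity)] at h1

theorem norm_le_of_evalE2 {ξ : lam.E2} {A : ℝ} (hA : 0 ≤ A)
    (h : ∀ u, ‖lam.evalE2 u ξ‖ ≤ A) : ‖ξ‖ ≤ A :=
  lp.norm_le_of_forall_le hA h

theorem norm_leftConv_le {F : C_c(G, ℂ)} {A : ℝ} (hA : 0 ≤ A)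
    (h : ∀ u, ∫⁻ t, ‖F t‖ₑ ∂lam.measure u ≤ ENNReal.ofReal A) (ξ : lam.E2) :
    ‖lam.leftConv F ξ‖ ≤ A * ‖ξ‖ :=
  lam.norm_le_of_evalE2 (by positivity) fun u => lam.norm_evalE2_leftConv_le hA (h u) ξ

/-! ### Approximate identities -/

theorem integral_pos_of_mem_fiber {g : C(G, ℝ)} (hg : HasCompactSupport g) (h0 : ∀ x, 0 ≤ g x)
    {u : unitSpace G} {y : G} (hy : r y = u) (hgy : g y ≠ 0) : 0 < ∫ t, g t ∂lam.measure u := by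
  rw [integral_pos_iff_support_of_nonneg h0 (g.continuous.integrable_of_hasCompactSupport hg)]
  have h1 : y ∈ (lam.measure u).support := by
    rw [lam.support_eq]
    exact hy
  exact ((Measure.mem_support_iff_forall _).1 h1) _
    (g.continuous.isOpen_support.mem_nhds hgy)

theorem integral_ofRealCc (g : C(G, ℝ)) (hg : HasCompactSupport g) (u : unitSpace G) :
    ∫ t, ofRealCc g hg t ∂lam.measure u = ((∫ t, g t ∂lam.measure u : ℝ) : ℂ) :=
  integral_ofReal

theorem lintegral_enorm_ofRealCc (g : C(G, ℝ)) (hg : HasCompactSupport g) (h0 : ∀ x, 0 ≤ g x)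
    (u : unitSpace G) :
    ∫⁻ t, ‖ofRealCc g hg t‖ₑ ∂lam.measure u = ENNReal.ofReal (∫ t, g t ∂lam.measure u) := by
  rw [ofReal_integral_eq_lintegral_ofReal (g.continuous.integrable_of_hasCompactSupport hg)
    (Eventually.of_forall h0)]
  refine lintegral_congr fun t => ?_
  change ‖((g t : ℝ) : ℂ)‖ₑ = _
  rw [← ofReal_norm, Complex.norm_real, Real.norm_of_nonneg (h0 t)]

theorem exists_bump {u : unitSpace G} (y : fiber u) {U : Set G} (hU : IsOpen U)
    (hy : (y : G) ∈ U) : ∃ (g : C(G, ℝ)) (_ : HasCompactSupport g), (∀ x, 0 ≤ g x) ∧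
      (∀ x, g x ≠ 0 → x ∈ U) ∧ ∫ t, g t ∂lam.measure u = 1 := by
  obtain ⟨c, hc1, hc2, hc3, hc4⟩ := exists_continuousMap_one_of_isCompact_subset_isOpen
    (isCompact_singleton (x := (y : G))) hU (singleton_subset_iff.2 hy)
  -- The bump can be normalised because λ^u has full support on G^u.
  have hpos := lam.integral_pos_of_mem_fiber hc2 (fun x => (hc4 x).1) y.2
    (by rw [hc1 (mem_singleton _)]; simp)
  set m := ∫ t, c t ∂lam.measure u with hm
  have hs : HasCompactSupport (m⁻¹ • c : C(G, ℝ)) :=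
    HasCompactSupport.mul_left (f := fun _ => m⁻¹) (f' := c) hc2
  refine ⟨m⁻¹ • c, hs, fun x => mul_nonneg (inv_nonneg.2 hpos.le) (hc4 x).1, fun x hx => ?_, ?_⟩
  · exact hc3 (subset_tsupport _ (right_ne_zero_of_mul hx))
  · change ∫ t, m⁻¹ * c t ∂lam.measure u = 1
    rw [integral_const_mul, ← hm, inv_mul_cancel₀ hpos.ne']

/-- F is a bump at y with integral 1. On the fibre over u the norm of L_F is at most 1 however
narrow the bump is, so the sections may be replaced by functions in C_c(G). -/
theorem exists_leftConv_near_translE2 {ι : Type*} [Finite ι] {u : unitSpace G} (y : fiber u)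
    (ξ : ι → lam.E2) {ε : ℝ} (hε : 0 < ε) :
    ∃ F, ∀ i, ‖lam.evalE2 u (lam.leftConv F (ξ i)) - lam.translE2 y (ξ i)‖ < ε := by
  have hε4 : 0 < ε / 4 := by positivity
  choose f hf using fun i => Metric.denseRange_iff.1 lam.denseRange_toE2 (ξ i) (ε / 4) hε4
  have hV : ∀ᶠ t in 𝓝 y, ∀ i, ‖lam.translE2 t (lam.toE2 (f i)) -
      lam.translE2 y (lam.toE2 (f i))‖ < ε / 4 := by
    refine eventually_all.2 fun i => ?_
    have h := ((lam.continuous_translE2_toE2 (u := u) (f i)).tendsto y)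
    exact (tendsto_iff_norm_sub_tendsto_zero.1 h).eventually (gt_mem_nhds hε4)
  obtain ⟨V, hV1, hV2, hV3⟩ := eventually_nhds_iff.1 hV
  obtain ⟨U, hU, rfl⟩ := isOpen_induced_iff.1 hV2
  obtain ⟨g, hg, g0, gU, gint⟩ := lam.exists_bump y hU hV3
  have hF1 := lam.lintegral_enorm_ofRealCc g hg g0 u
  have hF2 := lam.integral_ofRealCc g hg u
  rw [gint] at hF1 hF2
  refine ⟨ofRealCc g hg, fun i => ?_⟩
  have h1 : ‖lam.restrict (lam.convCc (ofRealCc g hg) (f i)) u -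
      lam.translE2 y (lam.toE2 (f i))‖ ≤ ε / 4 := by
    have h := lam.enorm_restrict_conv_sub_le (ofRealCc g hg) (f i) y (ε := ε / 4)
      fun t ht => (hV1 t (gU _ fun h0 => ht (by
        change ((g t : ℝ) : ℂ) = 0
        rw [h0, Complex.ofReal_zero])) i).le
    rw [hF1, hF2, Complex.ofReal_one, one_smul, ENNReal.ofReal_one, one_mul, ← ofReal_norm,
      ENNReal.ofReal_le_ofReal_iff hε4.le] at h
    exact h
  have h2 : ‖lam.evalE2 u (lam.leftConv (ofRealCc g hg) (ξ i - lam.toE2 (f i)))‖ ≤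
      1 * ‖ξ i - lam.toE2 (f i)‖ :=
    lam.norm_evalE2_leftConv_le zero_le_one hF1.le _
  have h3 := lam.norm_translE2_le y (ξ i - lam.toE2 (f i))
  have h4 : ‖ξ i - lam.toE2 (f i)‖ < ε / 4 := by rw [← dist_eq_norm]; exact hf i
  have e : lam.evalE2 u (lam.leftConv (ofRealCc g hg) (ξ i)) - lam.translE2 y (ξ i) =
      lam.evalE2 u (lam.leftConv (ofRealCc g hg) (ξ i - lam.toE2 (f i))) +
      (lam.restrict (lam.convCc (ofRealCc g hg) (f i)) u - lam.translE2 y (lam.toE2 (f i))) -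
      lam.translE2 y (ξ i - lam.toE2 (f i)) := by
    simp only [map_sub, leftConv_toE2, evalE2_toE2]
    abel
  rw [e]
  refine (norm_sub_le _ _).trans_lt ((add_le_add_left (norm_add_le _ _) _).trans_lt ?_)
  linarith

theorem exists_approx_identity_Cc {ι : Type*} [Finite ι] (f : ι → C_c(G, ℂ)) {ε : ℝ}
    (hε : 0 < ε) : ∃ e : C_c(G, ℂ), (∀ u, ∫⁻ t, ‖e t‖ₑ ∂lam.measure u ≤ 1) ∧
      ∀ i, ‖lam.toE2 (lam.convCc e (f i)) - lam.toE2 (f i)‖ ≤ ε := by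
  have hε2 : 0 < ε ^ 2 := by positivity
  -- Every defect vanishes at the units, so W is an open neighbourhood of the unit space. The set K
  -- below contains all units over which some f i is nonzero.
  let W : Set G := ⋂ i, {t | lam.defect (f i) t < ε ^ 2}
  have hW : IsOpen W :=
    isOpen_iInter_of_finite fun i => isOpen_lt (lam.continuous_defect (f i)) continuous_const
  let K : Set (unitSpace G) := ⋃ i, rangeUnit '' tsupport (f i)
  have hK : IsCompact K :=
    isCompact_iUnion fun i => (f i).hasCompactSupport.isCompact.image continuous_rangeUnit
  have hKW : Subtype.val '' K ⊆ W := by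
    rintro _ ⟨v, -, rfl⟩
    exact mem_iInter.2 fun i => by
      change lam.defect (f i) v < ε ^ 2
      rwa [defect_unit]
  obtain ⟨b, hb1, hb2, hb3, hb4⟩ := exists_continuousMap_one_of_isCompact_subset_isOpen
    (hK.image continuous_subtype_val) hW hKW
  let β : unitSpace G → ℝ := fun v => ∫ t, b t ∂lam.measure v
  have hβ : Continuous β := lam.continuous_integral_real b hb2
  have hβK : ∀ v ∈ K, 0 < β v := fun v hv =>
    lam.integral_pos_of_mem_fiber hb2 (fun x => (hb4 x).1) v.2
      (by rw [hb1 ⟨v, hv, rfl⟩]; simp)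
  obtain ⟨m, hm0, hm⟩ : ∃ m : ℝ, 0 < m ∧ ∀ v ∈ K, m ≤ β v := by
    rcases K.eq_empty_or_nonempty with hKe | hKn
    · exact ⟨1, one_pos, by simp [hKe]⟩
    · obtain ⟨v, hv, hmin⟩ := hK.exists_isMinOn hKn hβ.continuousOn
      exact ⟨β v, hβK v hv, fun w hw => hmin hw⟩
  have hmax : ∀ v, 0 < max (β v) m := fun v => lt_max_of_lt_right hm0
  -- Division by β would normalise the fibre integrals, but β may vanish off K. Dividing by max β m,
  -- with m a lower bound of β on K, stays continuous; it makes the fibre integrals equal to 1 on K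
  -- and at most 1 elsewhere.
  let d : C(G, ℝ) := ⟨fun x => (max (β (rangeUnit x)) m)⁻¹ * b x,
    (((hβ.comp continuous_rangeUnit).max continuous_const).inv₀
      fun x => (hmax _).ne').mul b.continuous⟩
  have hd : HasCompactSupport d := HasCompactSupport.mul_left
    (f := fun x => (max (β (rangeUnit x)) m)⁻¹) (f' := b) hb2
  have hd0 : ∀ x, 0 ≤ d x := fun x => mul_nonneg (inv_nonneg.2 (hmax _).le) (hb4 x).1
  have hdint : ∀ v, ∫ t, d t ∂lam.measure v = (max (β v) m)⁻¹ * β v := fun v => by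
    rw [← integral_const_mul]
    refine integral_congr_ae ?_
    filter_upwards [lam.ae_r_eq v] with t ht
    change (max (β (rangeUnit t)) m)⁻¹ * b t = _
    rw [(rangeUnit_eq_iff t v).2 ht]
  have hd1 : ∀ v, ∫ t, d t ∂lam.measure v ≤ 1 := fun v => by
    rw [hdint, inv_mul_le_iff₀ (hmax v), mul_one]
    exact le_max_left _ _
  have he : ∀ v, ∫⁻ t, ‖ofRealCc d hd t‖ₑ ∂lam.measure v ≤ 1 := fun v => by
    rw [lintegral_enorm_ofRealCc _ _ _ hd0, ← ENNReal.ofReal_one]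
    exact ENNReal.ofReal_le_ofReal (hd1 v)
  refine ⟨ofRealCc d hd, he, fun i => ?_⟩
  rw [← map_sub]
  refine lam.norm_le_of_evalE2 hε.le fun v => ?_
  have h := lam.enorm_restrict_conv_sub_le (ofRealCc d hd) (f i) (unitFiber v) (ε := ε)
    fun t ht => by
      have hbt : b t ≠ 0 := fun h0 => ht (by
        change (((max (β (rangeUnit (t : G))) m)⁻¹ * b t : ℝ) : ℂ) = 0
        rw [h0, mul_zero, Complex.ofReal_zero])
      have h1 : lam.defect (f i) t < ε ^ 2 :=
        mem_iInter.1 (hb3 (subset_tsupport _ hbt)) i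
      have h2 := lam.norm_translE2_sub_sq t (unitFiber v) (f i)
      have e1 : ((unitFiber v : fiber v) : G)⁻¹ * t = t := inv_coe_mul v t t.2
      rw [e1] at h2
      exact (lt_of_pow_lt_pow_left₀ 2 hε.le (h2.trans_lt h1)).le
  have h' := h.trans (mul_le_mul_left (he v) _)
  rw [one_mul, translE2_unitFiber, evalE2_toE2, integral_ofRealCc, hdint, ← ofReal_norm,
    ENNReal.ofReal_le_ofReal_iff hε.le] at h'
  -- Off K the function f i vanishes on the fibre, so the value of the normalising factor is
  -- irrelevant there.
  have e2 : (((max (β v) m)⁻¹ * β v : ℝ) : ℂ) • lam.restrict (f i) v = lam.restrict (f i) v := by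
    by_cases hv : v ∈ K
    · rw [max_eq_left (hm v hv), inv_mul_cancel₀ (hβK v hv).ne', Complex.ofReal_one, one_smul]
    · have h0 : lam.restrict (f i) v = 0 := by
        rw [← lam.restrict_zero v]
        refine MemLp.toLp_congr _ _ ?_
        filter_upwards [lam.ae_r_eq v] with t ht
        by_contra hne
        exact hv (mem_iUnion.2 ⟨i, t, subset_tsupport _ hne, (rangeUnit_eq_iff t v).2 ht⟩)
      rw [h0, smul_zero]
  rw [e2] at h'
  exact h'

theorem exists_approx_identity {ι : Type*} [Finite ι] (ξ : ι → lam.E2) {ε : ℝ}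
    (hε : 0 < ε) : ∃ e : C_c(G, ℂ), ∀ i, ‖lam.leftConv e (ξ i) - ξ i‖ < ε := by
  have hε4 : 0 < ε / 4 := by positivity
  choose f hf using fun i => Metric.denseRange_iff.1 lam.denseRange_toE2 (ξ i) (ε / 4) hε4
  obtain ⟨e, he1, he2⟩ := lam.exists_approx_identity_Cc f hε4
  refine ⟨e, fun i => ?_⟩
  have h1 := lam.norm_leftConv_le zero_le_one (by simpa using he1) (ξ i - lam.toE2 (f i))
  have h4 : ‖ξ i - lam.toE2 (f i)‖ < ε / 4 := by rw [← dist_eq_norm]; exact hf i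
  have e : lam.leftConv e (ξ i) - ξ i = lam.leftConv e (ξ i - lam.toE2 (f i)) +
      (lam.toE2 (lam.convCc e (f i)) - lam.toE2 (f i)) - (ξ i - lam.toE2 (f i)) := by
    rw [map_sub, leftConv_toE2]
    abel
  rw [e]
  refine (norm_sub_le _ _).trans_lt ((add_le_add_left (norm_add_le _ _) _).trans_lt ?_)
  linarith [he2 i]

/-! ### Extension of a functional on `E²` to Borel kernels -/

/-- The scalar retracts v radially onto the ball of radius N. It moves v by its distance to the
ball, which is at most ‖v - w‖ as w lies in the ball. -/
theorem norm_smul_sub_le_of_norm_le {E : Type*} [NormedAddCommGroup E] [NormedSpace ℂ E]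
    {v w : E} {N : ℝ} (hN : 0 < N) (hw : ‖w‖ ≤ N) :
    ‖((N / max N ‖v‖ : ℝ) : ℂ) • v - w‖ ≤ 2 * ‖v - w‖ := by
  have hmax : 0 < max N ‖v‖ := lt_max_of_lt_left hN
  have h1 : ‖((N / max N ‖v‖ : ℝ) : ℂ) • v - v‖ ≤ ‖v - w‖ := by
    have e : ((N / max N ‖v‖ : ℝ) : ℂ) • v - v = ((N / max N ‖v‖ - 1 : ℝ) : ℂ) • v := by
      push_cast
      rw [sub_smul, one_smul]
    rw [e, norm_smul, Complex.norm_real, Real.norm_eq_abs, abs_sub_comm]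
    rcases le_total ‖v‖ N with h | h
    · rw [max_eq_left h, div_self hN.ne']
      simp
    · rw [max_eq_right h]
      have hv : 0 < ‖v‖ := hN.trans_le h
      rw [abs_of_nonneg (by rw [sub_nonneg, div_le_one hv]; exact h), sub_mul, one_mul,
        div_mul_cancel₀ _ hv.ne']
      have := norm_sub_norm_le v w
      linarith
  have h2 := norm_sub_le_norm_sub_add_norm_sub (((N / max N ‖v‖ : ℝ) : ℂ) • v) v w
  linarith

/-- Write y = x (y⁻¹x)⁻¹: it is the image of a pair from a compact set under a continuous map. -/
theorem exists_isCompact_of_inv_mul_mem (u : unitSpace G) {K L : Set G} (hK : IsCompact K)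
    (hL : IsCompact L) : ∃ M : Set G, IsCompact M ∧
      ∀ x y : G, r x = u → r y = u → x ∈ L → y⁻¹ * x ∈ K → y ∈ M := by
  have hc : IsCompact ((L ×ˢ K) ∩ {p : G × G | s p.1 = s p.2}) :=
    (hL.prod hK).inter_right
      (isClosed_eq (continuous_s.comp continuous_fst) (continuous_s.comp continuous_snd))
  have hcont : ContinuousOn (fun p : G × G => p.1 * p.2⁻¹)
      ((L ×ˢ K) ∩ {p : G × G | s p.1 = s p.2}) :=
    continuousOn_mul.comp (f := fun p : G × G => (p.1, p.2⁻¹))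
      (continuous_fst.prodMk
        (TopologicalGroupoid.continuous_inv.comp continuous_snd)).continuousOn
      (fun p hp => by
        change s p.1 = r p.2⁻¹
        rw [r_inv]
        exact hp.2)
  refine ⟨_, hc.image_of_continuousOn hcont, fun x y hx hy hxL hxK => ?_⟩
  refine ⟨(x, y⁻¹ * x), ⟨⟨hxL, hxK⟩, (s_inv_mul y x (hy.trans hx.symm)).symm⟩, ?_⟩
  change x * (y⁻¹ * x)⁻¹ = y
  rw [inv_mul_inv y x (hy.trans hx.symm), inv_mul_cancel_left x y (hx.trans hy.symm)]

theorem lintegral_restrict_prod {u : unitSpace G} (M : Set G) {φ : G × G → ℝ≥0∞}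
    (hφ : AEMeasurable φ ((lam.measure u).prod (lam.measure u))) :
    ∫⁻ p, φ p ∂((lam.measure u).prod (lam.measure u)).restrict (M ×ˢ univ) =
      ∫⁻ y in M, ∫⁻ x, φ (y, x) ∂lam.measure u ∂lam.measure u := by
  have h : ((lam.measure u).prod (lam.measure u)).restrict (M ×ˢ univ) =
      ((lam.measure u).restrict M).prod (lam.measure u) := by
    rw [← Measure.prod_restrict, Measure.restrict_univ]
  have hφ' := hφ.restrict (s := M ×ˢ univ)
  rw [h] at hφ' ⊢
  exact lintegral_prod _ hφ'

theorem exists_cutoff_seq : ∃ χ : ℕ → C(G, ℝ), (∀ n, HasCompactSupport (χ n)) ∧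
    (∀ n x, χ n x ∈ Icc (0 : ℝ) 1) ∧ ∀ x, ∀ᶠ n in atTop, χ n x = 1 := by
  choose χ h1 h2 h3 h4 using fun n : ℕ => exists_continuousMap_one_of_isCompact_subset_isOpen
    (isCompact_compactCovering G n) isOpen_univ (subset_univ _)
  refine ⟨χ, h2, h4, fun x => ?_⟩
  obtain ⟨n, hn⟩ := exists_mem_compactCovering x
  filter_upwards [eventually_ge_atTop n] with k hk
  exact h1 k (compactCovering_subset G hk hn)

theorem aemeasurable_kernel {q : G → ℂ} (hq : Measurable q) (u : unitSpace G) :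
    AEMeasurable (fun p : G × G => q (p.1⁻¹ * p.2))
      ((lam.measure u).prod (lam.measure u)) :=
  hq.comp_aemeasurable (lam.aemeasurable_inv_mul_prod u)

/-- Push λ^u × λ^u, restricted to y in M, forward along (y, x) ↦ y⁻¹x. Over the support of χ the
image measure is finite and q is square integrable for it, so q is an L² limit of bounded continuous
functions. The approximation holds only in the mean over M; single slices of F are not controlled.
-/
theorem exists_Cc_near_kernel {u : unitSpace G} {M : Set G} (hM : IsCompact M) {q : G → ℂ}
    (hq : Measurable q) {N : ℝ}
    (hqN : ∀ y : fiber u, ∫⁻ x, ‖q ((y : G)⁻¹ * x)‖ₑ ^ 2 ∂lam.measure u ≤ ENNReal.ofReal N ^ 2)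
    {χ : C(G, ℝ)} (hχ : HasCompactSupport χ) (hχ1 : ∀ x, χ x ∈ Icc (0 : ℝ) 1)
    {ε : ℝ} (hε : 0 < ε) :
    ∃ F : C_c(G, ℂ), (∀ x, x ∉ tsupport χ → F x = 0) ∧
      ∫⁻ y in M, ∫⁻ x, ‖F (y⁻¹ * x) - χ (y⁻¹ * x) * q (y⁻¹ * x)‖ₑ ^ 2
        ∂lam.measure u ∂lam.measure u ≤ ENNReal.ofReal ε ^ 2 := by
  set R := ((lam.measure u).prod (lam.measure u)).restrict (M ×ˢ univ) with hR
  have hπ : AEMeasurable (fun p : G × G => p.1⁻¹ * p.2) R :=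
    (lam.aemeasurable_inv_mul_prod u).restrict
  set ρ₀ := R.map (fun p : G × G => p.1⁻¹ * p.2) with hρ₀
  set ρ := ρ₀.restrict (tsupport χ) with hρ
  have hmap : ∀ φ : G → ℝ≥0∞, Measurable φ → ∫⁻ z, φ z ∂ρ₀ =
      ∫⁻ y in M, ∫⁻ x, φ (y⁻¹ * x) ∂lam.measure u ∂lam.measure u := fun φ hφ => by
    rw [hρ₀, lintegral_map' hφ.aemeasurable hπ]
    exact lam.lintegral_restrict_prod M
      (hφ.comp_aemeasurable (lam.aemeasurable_inv_mul_prod u))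
  have haeM : ∀ᵐ y ∂(lam.measure u).restrict M, r y = (u : G) :=
    ae_restrict_of_ae (lam.ae_r_eq u)
  have hMfin : lam.measure u M < ∞ := hM.measure_lt_top
  -- A bump equal to 1 on the support of χ has uniformly bounded slice integrals, and M has finite
  -- measure.
  have hfin : IsFiniteMeasure ρ := by
    obtain ⟨c, hc1, hc2, -, -⟩ := exists_continuousMap_one_of_isCompact_subset_isOpen hχ
      isOpen_univ (subset_univ _)
    obtain ⟨A, -, hA⟩ := lam.exists_schur_bound (ofRealCc c hc2)
    refine ⟨?_⟩
    rw [hρ, Measure.restrict_apply_univ]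
    calc ρ₀ (tsupport χ) = ∫⁻ z, (tsupport χ).indicator 1 z ∂ρ₀ :=
          (lintegral_indicator_one (isClosed_tsupport _).measurableSet).symm
      _ ≤ ∫⁻ z, ‖ofRealCc c hc2 z‖ₑ ∂ρ₀ := by
          refine lintegral_mono fun x => ?_
          by_cases hx : x ∈ tsupport χ
          · have : ofRealCc c hc2 x = 1 := by
              change ((c x : ℝ) : ℂ) = 1
              rw [hc1 hx]
              simp
            simp [hx, this]
          · simp [hx]
      _ = ∫⁻ y in M, ∫⁻ x, ‖ofRealCc c hc2 (y⁻¹ * x)‖ₑ ∂lam.measure u ∂lam.measure u :=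
          hmap _ (ofRealCc c hc2).continuous.measurable.enorm
      _ ≤ ∫⁻ y in M, ENNReal.ofReal A ∂lam.measure u := by
          refine lintegral_mono_ae ?_
          filter_upwards [haeM] with y hy using (hA u y hy).1
      _ < ∞ := by
          rw [setLIntegral_const]
          exact ENNReal.mul_lt_top ENNReal.ofReal_lt_top hMfin
  have hqL : MemLp q 2 ρ := by
    refine ⟨hq.aestronglyMeasurable, ?_⟩
    rw [eLpNorm_lt_top_iff_lintegral_rpow_enorm_lt_top two_ne_zero ENNReal.ofNat_ne_top]
    simp only [ENNReal.toReal_ofNat, ENNReal.rpow_ofNat]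
    calc ∫⁻ z, ‖q z‖ₑ ^ 2 ∂ρ ≤ ∫⁻ z, ‖q z‖ₑ ^ 2 ∂ρ₀ := lintegral_mono' Measure.restrict_le_self le_rfl
      _ = ∫⁻ y in M, ∫⁻ x, ‖q (y⁻¹ * x)‖ₑ ^ 2 ∂lam.measure u ∂lam.measure u :=
          hmap _ (hq.enorm.pow_const 2)
      _ ≤ ∫⁻ y in M, ENNReal.ofReal N ^ 2 ∂lam.measure u := by
          refine lintegral_mono_ae ?_
          filter_upwards [haeM] with y hy using hqN ⟨y, hy⟩
      _ < ∞ := by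
          rw [setLIntegral_const]
          exact ENNReal.mul_lt_top (by finiteness) hMfin
  obtain ⟨F₀, hF₀, -⟩ := hqL.exists_boundedContinuous_eLpNorm_sub_le ENNReal.ofNat_ne_top
    (ε := ENNReal.ofReal ε) (by simpa using hε)
  let F : C_c(G, ℂ) :=
    { toFun := fun x => (χ x : ℂ) * F₀ x
      continuous_toFun := by fun_prop
      hasCompactSupport' := HasCompactSupport.mul_right
        (HasCompactSupport.comp_left (g := fun a : ℝ => (a : ℂ)) hχ Complex.ofReal_zero) }
  refine ⟨F, fun x hx => ?_, ?_⟩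
  · change (χ x : ℂ) * F₀ x = 0
    rw [image_eq_zero_of_notMem_tsupport hx, Complex.ofReal_zero, zero_mul]
  have hFm : Measurable fun z : G => ‖F z - χ z * q z‖ₑ ^ 2 :=
    ((F.continuous.measurable.sub ((Complex.measurable_ofReal.comp
      χ.continuous.measurable).mul hq)).enorm).pow_const 2
  calc _ = ∫⁻ z, ‖F z - χ z * q z‖ₑ ^ 2 ∂ρ₀ := (hmap _ hFm).symm
    _ ≤ ∫⁻ z in tsupport χ, ‖q z - F₀ z‖ₑ ^ 2 ∂ρ₀ := by
        rw [← lintegral_indicator (isClosed_tsupport _).measurableSet]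
        refine lintegral_mono fun z => ?_
        have e : F z - χ z * q z = -((χ z : ℂ) * (q z - F₀ z)) := by
          change (χ z : ℂ) * F₀ z - χ z * q z = _
          ring
        by_cases hz : z ∈ tsupport χ
        · rw [indicator_of_mem hz, e, enorm_neg, enorm_mul]
          gcongr
          refine mul_le_of_le_one_left zero_le ?_
          rw [← ofReal_norm, Complex.norm_real, Real.norm_of_nonneg (hχ1 z).1]
          exact ENNReal.ofReal_le_one.2 (hχ1 z).2
        · rw [e, image_eq_zero_of_notMem_tsupport hz]
          simp
    _ = eLpNorm (q - (F₀ : G → ℂ)) 2 ρ ^ 2 := by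
        rw [eLpNorm_eq_lintegral_rpow_enorm_toReal two_ne_zero ENNReal.ofNat_ne_top]
        simp only [ENNReal.toReal_ofNat, one_div]
        rw [← ENNReal.rpow_natCast (_ ^ _), ← ENNReal.rpow_mul]
        norm_num
        rfl
    _ ≤ _ := by gcongr

theorem memLp_kernel {u : unitSpace G} (y : fiber u) {q : G → ℂ} (hq : Measurable q) {N : ℝ}
    (hqN : ∫⁻ x, ‖q ((y : G)⁻¹ * x)‖ₑ ^ 2 ∂lam.measure u ≤ ENNReal.ofReal N ^ 2) :
    MemLp (fun x => q ((y : G)⁻¹ * x)) 2 (lam.measure u) := by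
  refine ⟨(hq.comp_aemeasurable (lam.aemeasurable_inv_mul y u
    (rangeUnit_fiber y))).aestronglyMeasurable, ?_⟩
  rw [eLpNorm_lt_top_iff_lintegral_rpow_enorm_lt_top two_ne_zero ENNReal.ofNat_ne_top]
  simp only [ENNReal.toReal_ofNat, ENNReal.rpow_ofNat]
  exact hqN.trans_lt (by finiteness)

/-- The retraction of `C_c(G)` onto the ball of radius `N` for the norm of `E²`. -/
def truncate (F : C_c(G, ℂ)) {N : ℝ} (hN : 0 < N) : C_c(G, ℂ) :=
  mulRange ⟨fun v => N / max N ‖lam.restrict F v‖,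
    continuous_const.div (continuous_const.max (lam.continuous_norm_restrict F))
      fun _ => (lt_max_of_lt_left hN).ne'⟩ F

theorem restrict_truncate (F : C_c(G, ℂ)) {N : ℝ} (hN : 0 < N) (v : unitSpace G) :
    lam.restrict (lam.truncate F hN) v =
      ((N / max N ‖lam.restrict F v‖ : ℝ) : ℂ) • lam.restrict F v :=
  lam.restrict_mulRange _ F v

theorem norm_toE2_truncate_le (F : C_c(G, ℂ)) {N : ℝ} (hN : 0 < N) :
    ‖lam.toE2 (lam.truncate F hN)‖ ≤ N := by
  refine lam.norm_le_of_evalE2 hN.le fun v => ?_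
  have hmax : 0 < max N ‖lam.restrict F v‖ := lt_max_of_lt_left hN
  rw [evalE2_toE2, restrict_truncate, norm_smul, Complex.norm_real,
    Real.norm_of_nonneg (by positivity), div_mul_eq_mul_div, div_le_iff₀ hmax]
  exact mul_le_mul_of_nonneg_left (le_max_right _ _) hN.le

/-- Translation by y is isometric, so on this slice truncation is the radial retraction of y·F. The
slice of q lies in the ball, hence distances at most double, and 4 = 2². -/
theorem lintegral_truncate_sub_le {u : unitSpace G} (y : fiber u) (F : C_c(G, ℂ)) {q : G → ℂ}
    (hq : Measurable q) {N : ℝ} (hN : 0 < N)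
    (hqN : ∫⁻ x, ‖q ((y : G)⁻¹ * x)‖ₑ ^ 2 ∂lam.measure u ≤ ENNReal.ofReal N ^ 2) :
    ∫⁻ x, ‖lam.truncate F hN ((y : G)⁻¹ * x) - q ((y : G)⁻¹ * x)‖ₑ ^ 2 ∂lam.measure u ≤
      4 * ∫⁻ x, ‖F ((y : G)⁻¹ * x) - q ((y : G)⁻¹ * x)‖ₑ ^ 2 ∂lam.measure u := by
  have hL := lam.memLp_kernel y hq hqN
  have hw : ‖hL.toLp‖ ≤ N := by
    have h := lam.lintegral_enorm_sq_congr hL.coeFn_toLp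
    rw [h, ENNReal.pow_le_pow_left_iff two_ne_zero, ← ofReal_norm,
      ENNReal.ofReal_le_ofReal_iff hN.le] at hqN
    exact hqN
  have h1 : ∀ F' : C_c(G, ℂ), ∫⁻ x, ‖F' ((y : G)⁻¹ * x) - q ((y : G)⁻¹ * x)‖ₑ ^ 2
      ∂lam.measure u = ‖lam.translE2 y (lam.toE2 F') - hL.toLp‖ₑ ^ 2 := fun F' =>
    lam.lintegral_enorm_sq_congr ((Lp.coeFn_sub _ _).trans
      ((lam.coeFn_translE2_toE2 y F').sub hL.coeFn_toLp))
  have h2 : lam.translE2 y (lam.toE2 (lam.truncate F hN)) =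
      ((N / max N ‖lam.translE2 y (lam.toE2 F)‖ : ℝ) : ℂ) • lam.translE2 y (lam.toE2 F) := by
    rw [norm_translE2, translE2_apply, evalE2_toE2, restrict_truncate, map_smul]
    rfl
  rw [h1, h1, h2]
  have h3 := norm_smul_sub_le_of_norm_le (v := lam.translE2 y (lam.toE2 F)) hN hw
  rw [← ofReal_norm, ← ofReal_norm]
  calc _ ≤ ENNReal.ofReal (2 * ‖lam.translE2 y (lam.toE2 F) - hL.toLp‖) ^ 2 := by gcongr
    _ = _ := by
      rw [ENNReal.ofReal_mul zero_le_two, mul_pow]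
      norm_num

/-- The C_c(G) function that approximates χq in the mean may have a large norm in E². Truncating it
to norm N costs a factor 2 in the approximation and lets `hC` give C N. The compact supports of k
and χ confine y to a compact set, where approximation in the mean is enough. -/
theorem norm_integral_cutoff_kernel_le {u : unitSpace G} (a : Lp ℂ 2 (lam.measure u))
    (k : C_c(G, ℂ)) {C : ℝ} (hC0 : 0 ≤ C)
    (hC : ∀ F : C_c(G, ℂ), ‖lam.bilin F u a (lam.restrict k u)‖ ≤ C * ‖lam.toE2 F‖)
    {q : G → ℂ} (hq : Measurable q) {N : ℝ} (hN : 0 < N)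
    (hqN : ∀ y : fiber u, ∫⁻ x, ‖q ((y : G)⁻¹ * x)‖ₑ ^ 2 ∂lam.measure u ≤ ENNReal.ofReal N ^ 2)
    {χ : C(G, ℝ)} (hχ : HasCompactSupport χ) (hχ1 : ∀ x, χ x ∈ Icc (0 : ℝ) 1)
    (hint : Integrable (fun p : G × G => a p.1 * (χ (p.1⁻¹ * p.2) * q (p.1⁻¹ * p.2)) *
      lam.restrict k u p.2) ((lam.measure u).prod (lam.measure u))) :
    ‖∫ p : G × G, a p.1 * (χ (p.1⁻¹ * p.2) * q (p.1⁻¹ * p.2)) * lam.restrict k u p.2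
      ∂(lam.measure u).prod (lam.measure u)‖ ≤ C * N := by
  obtain ⟨M, hM, hMmem⟩ := exists_isCompact_of_inv_mul_mem u (K := tsupport χ) (L := tsupport k)
    hχ k.hasCompactSupport
  set κ := lam.restrict k u with hκ
  refine le_of_forall_pos_le_add fun ε hε => ?_
  -- Cauchy–Schwarz will bound the error by ‖a‖ ‖κ‖ 2δ; the summand 1 keeps the denominator
  -- positive.
  let δ : ℝ := ε / (2 * (‖a‖ * ‖κ‖ + 1))
  have hδ : 0 < δ := by positivity
  obtain ⟨F, hFχ, hF⟩ := lam.exists_Cc_near_kernel hM hq hqN hχ hχ1 hδ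
  set F' := lam.truncate F hN with hF'
  let q' : G → ℂ := fun z => χ z * q z
  have hq' : Measurable q' :=
    (Complex.measurable_ofReal.comp χ.continuous.measurable).mul hq
  have hq'N : ∀ y : fiber u, ∫⁻ x, ‖q' ((y : G)⁻¹ * x)‖ₑ ^ 2 ∂lam.measure u ≤
      ENNReal.ofReal N ^ 2 := fun y => by
    refine (lintegral_mono fun x => ?_).trans (hqN y)
    simp only [q']
    rw [enorm_mul]
    gcongr
    refine mul_le_of_le_one_left zero_le ?_
    rw [← ofReal_norm, Complex.norm_real, Real.norm_of_nonneg (hχ1 _).1]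
    exact ENNReal.ofReal_le_one.2 (hχ1 _).2
  have hF'χ : ∀ x, x ∉ tsupport χ → F' x = 0 := fun x hx => by
    change _ * F x = 0
    rw [hFχ x hx, mul_zero]
  have hE : Measurable fun z => F' z - q' z := F'.continuous.measurable.sub hq'
  have hEk := lam.aemeasurable_kernel hE u
  have hEM : ∫⁻ p : G × G, ‖F' (p.1⁻¹ * p.2) - q' (p.1⁻¹ * p.2)‖ₑ ^ 2
      ∂((lam.measure u).prod (lam.measure u)).restrict (M ×ˢ univ) ≤
      (2 * ENNReal.ofReal δ) ^ 2 := by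
    rw [lam.lintegral_restrict_prod M (hEk.enorm.pow_const 2)]
    calc _ ≤ ∫⁻ y in M, 4 * ∫⁻ x, ‖F (y⁻¹ * x) - q' (y⁻¹ * x)‖ₑ ^ 2
          ∂lam.measure u ∂lam.measure u := by
          refine lintegral_mono_ae ?_
          filter_upwards [ae_restrict_of_ae (lam.ae_r_eq u)] with y hy
          exact lam.lintegral_truncate_sub_le (⟨y, hy⟩ : fiber u) F hq' hN (hq'N ⟨y, hy⟩)
      _ = 4 * ∫⁻ y in M, ∫⁻ x, ‖F (y⁻¹ * x) - q' (y⁻¹ * x)‖ₑ ^ 2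
          ∂lam.measure u ∂lam.measure u := lintegral_const_mul' _ _ (by finiteness)
      _ ≤ 4 * ENNReal.ofReal δ ^ 2 := by gcongr
      _ = _ := by rw [mul_pow]; norm_num
  have hak : ∫⁻ p : G × G, (‖a p.1‖ₑ * ‖κ p.2‖ₑ) ^ 2
      ∂((lam.measure u).prod (lam.measure u)).restrict (M ×ˢ univ) ≤ (‖a‖ₑ * ‖κ‖ₑ) ^ 2 := by
    refine (lintegral_mono' Measure.restrict_le_self le_rfl).trans ?_
    simp_rw [mul_pow]
    rw [lintegral_prod_mul ((aemeasurable_enorm_Lp a).pow_const 2)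
      ((aemeasurable_enorm_Lp κ).pow_const 2), lintegral_enorm_sq_Lp, lintegral_enorm_sq_Lp]
  have hdiff : ‖lam.bilin F' u a κ - ∫ p : G × G, a p.1 * q' (p.1⁻¹ * p.2) * κ p.2
      ∂(lam.measure u).prod (lam.measure u)‖ₑ ≤ ‖a‖ₑ * ‖κ‖ₑ * (2 * ENNReal.ofReal δ) := by
    rw [bilin, ← integral_sub (lam.integrable_mul_inv_mul F' u a κ) hint]
    refine (enorm_integral_le_lintegral_enorm _).trans ?_
    calc _ = ∫⁻ p : G × G in M ×ˢ univ, ‖a p.1 * F' (p.1⁻¹ * p.2) * κ p.2 -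
          a p.1 * q' (p.1⁻¹ * p.2) * κ p.2‖ₑ ∂(lam.measure u).prod (lam.measure u) := by
          rw [← lintegral_indicator (hM.isClosed.measurableSet.prod MeasurableSet.univ)]
          refine lintegral_congr_ae ?_
          filter_upwards [Measure.quasiMeasurePreserving_fst.ae (lam.ae_r_eq u),
            Measure.quasiMeasurePreserving_snd.ae (lam.ae_r_eq u),
            Measure.quasiMeasurePreserving_snd.ae (lam.coeFn_restrict k u)] with p h1 h2 h3
          by_cases hp : p ∈ M ×ˢ (univ : Set G)
          · rw [indicator_of_mem hp]
          · rw [indicator_of_notMem hp, enorm_eq_zero]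
            rw [h3]
            have hp1 : p.1 ∉ M := fun h => hp ⟨h, mem_univ _⟩
            by_cases hk : p.2 ∈ tsupport k
            · have hz : p.1⁻¹ * p.2 ∉ tsupport χ := fun hz => hp1 (hMmem _ _ h2 h1 hk hz)
              rw [hF'χ _ hz, image_eq_zero_of_notMem_tsupport hz, Complex.ofReal_zero]
              ring
            · rw [image_eq_zero_of_notMem_tsupport hk]
              ring
      _ = ∫⁻ p : G × G in M ×ˢ univ, (‖a p.1‖ₑ * ‖κ p.2‖ₑ) *
          ‖F' (p.1⁻¹ * p.2) - q' (p.1⁻¹ * p.2)‖ₑ ∂(lam.measure u).prod (lam.measure u) := by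
          refine lintegral_congr fun p => ?_
          rw [← enorm_mul, ← enorm_mul]
          congr 1
          ring
      _ ≤ _ := by
          refine lintegral_mul_le_of_sq_le _ ?_ hEk.enorm.restrict hak hEM
          exact (((aemeasurable_enorm_Lp a).comp_quasiMeasurePreserving
            Measure.quasiMeasurePreserving_fst).mul
            ((aemeasurable_enorm_Lp κ).comp_quasiMeasurePreserving
            Measure.quasiMeasurePreserving_snd)).restrict
  have hdiff' : ‖lam.bilin F' u a κ - ∫ p : G × G, a p.1 * q' (p.1⁻¹ * p.2) * κ p.2
      ∂(lam.measure u).prod (lam.measure u)‖ ≤ ‖a‖ * ‖κ‖ * (2 * δ) := by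
    have e : ‖a‖ₑ * ‖κ‖ₑ * (2 * ENNReal.ofReal δ) = ENNReal.ofReal (‖a‖ * ‖κ‖ * (2 * δ)) := by
      rw [ENNReal.ofReal_mul (by positivity), ENNReal.ofReal_mul (norm_nonneg _),
        ENNReal.ofReal_mul zero_le_two, ofReal_norm, ofReal_norm, ENNReal.ofReal_ofNat]
    rw [e, ← ofReal_norm, ENNReal.ofReal_le_ofReal_iff (by positivity)] at hdiff
    exact hdiff
  have h1 := hC F'
  have h2 : C * ‖lam.toE2 F'‖ ≤ C * N :=
    mul_le_mul_of_nonneg_left (lam.norm_toE2_truncate_le F hN) hC0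
  have h3 : ‖a‖ * ‖κ‖ * (2 * δ) ≤ ε := by
    have e : (‖a‖ * ‖κ‖ + 1) * (2 * δ) = ε := by
      simp only [δ]
      field_simp
    rw [← e]
    gcongr
    linarith
  have h4 := norm_le_norm_add_norm_sub (lam.bilin F' u a κ)
    (∫ p : G × G, a p.1 * q' (p.1⁻¹ * p.2) * κ p.2 ∂(lam.measure u).prod (lam.measure u))
  change ‖∫ p : G × G, a p.1 * q' (p.1⁻¹ * p.2) * κ p.2
    ∂(lam.measure u).prod (lam.measure u)‖ ≤ _
  linarith

/-- A functional on `E²` of the form `F ↦ ∬ a(y) F(y⁻¹x) k(x)` keeps its bound on Borel kernels. -/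
theorem norm_integral_kernel_le {u : unitSpace G} (a : Lp ℂ 2 (lam.measure u))
    (k : C_c(G, ℂ)) {C : ℝ} (hC0 : 0 ≤ C)
    (hC : ∀ F : C_c(G, ℂ), ‖lam.bilin F u a (lam.restrict k u)‖ ≤ C * ‖lam.toE2 F‖)
    {q : G → ℂ} (hq : Measurable q) {N : ℝ} (hN : 0 < N)
    (hqN : ∀ y : fiber u, ∫⁻ x, ‖q ((y : G)⁻¹ * x)‖ₑ ^ 2 ∂lam.measure u ≤ ENNReal.ofReal N ^ 2)
    (hint : Integrable (fun p : G × G => a p.1 * q (p.1⁻¹ * p.2) * lam.restrict k u p.2)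
      ((lam.measure u).prod (lam.measure u))) :
    ‖∫ p : G × G, a p.1 * q (p.1⁻¹ * p.2) * lam.restrict k u p.2
      ∂(lam.measure u).prod (lam.measure u)‖ ≤ C * N := by
  obtain ⟨χ, hχ, hχ1, hχlim⟩ := exists_cutoff_seq (G := G)
  have hmeas : ∀ n, AEStronglyMeasurable (fun p : G × G =>
      a p.1 * (χ n (p.1⁻¹ * p.2) * q (p.1⁻¹ * p.2)) * lam.restrict k u p.2)
      ((lam.measure u).prod (lam.measure u)) := fun n =>
    lam.aestronglyMeasurable_mul_inv_mul (fun z => χ n z * q z)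
      ((Complex.measurable_ofReal.comp (χ n).continuous.measurable).mul hq) u a _
  have hbd : ∀ (n : ℕ) (p : G × G), ‖a p.1 * (χ n (p.1⁻¹ * p.2) * q (p.1⁻¹ * p.2)) * lam.restrict k u p.2‖ ≤
      ‖a p.1 * q (p.1⁻¹ * p.2) * lam.restrict k u p.2‖ := fun n p => by
    simp only [norm_mul]
    gcongr
    refine mul_le_of_le_one_left (norm_nonneg _) ?_
    rw [Complex.norm_real, Real.norm_of_nonneg (hχ1 n _).1]
    exact (hχ1 n _).2
  -- The cutoffs are eventually 1 at each point and the full integrand dominates. The bound C N does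
  -- not depend on the cutoff, so it survives the limit.
  have hlim : Tendsto (fun n => ∫ p : G × G, a p.1 * (χ n (p.1⁻¹ * p.2) * q (p.1⁻¹ * p.2)) *
      lam.restrict k u p.2 ∂(lam.measure u).prod (lam.measure u)) atTop
      (𝓝 (∫ p : G × G, a p.1 * q (p.1⁻¹ * p.2) * lam.restrict k u p.2
        ∂(lam.measure u).prod (lam.measure u))) := by
    refine tendsto_integral_of_dominated_convergence _ hmeas hint.norm
      (fun n => Eventually.of_forall (hbd n)) (Eventually.of_forall fun p => ?_)
    refine tendsto_const_nhds.congr' ?_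
    filter_upwards [hχlim (p.1⁻¹ * p.2)] with n hn
    rw [hn, Complex.ofReal_one, one_mul]
  refine le_of_tendsto hlim.norm (Eventually.of_forall fun n => ?_)
  exact lam.norm_integral_cutoff_kernel_le a k hC0 hC hq hN hqN (hχ n) (hχ1 n)
    (hint.mono (hmeas n) (Eventually.of_forall (hbd n)))

/-! ### Matrix coefficients of translates and right convolution -/

theorem continuous_bilin_left (f : C_c(G, ℂ)) (u : unitSpace G) (k : Lp ℂ 2 (lam.measure u)) :
    Continuous fun a => lam.bilin f u a k := by
  obtain ⟨A, hA0, hA⟩ := lam.exists_schur_bound f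
  refine LipschitzWith.continuous (K := (A * ‖k‖).toNNReal)
    (LipschitzWith.of_dist_le_mul fun a b => ?_)
  rw [dist_eq_norm, dist_eq_norm, ← bilin_sub_left, Real.coe_toNNReal _ (by positivity)]
  refine (lam.norm_bilin_le hA0 hA u (a - b) k).trans_eq ?_
  ring

/-- R_f is defined on E² only by extension. Both sides are continuous in η, the right one by the
Schur bound, so it is enough to apply Fubini for η in C_c(G). -/
theorem inner_evalE2_rightConv (f : C_c(G, ℂ)) (u : unitSpace G) (η : lam.E2)
    (κ : Lp ℂ 2 (lam.measure u)) :
    ⟪κ, lam.evalE2 u (lam.rightConv f η)⟫_ℂ = lam.bilin f u (lam.evalE2 u η) (star κ) := by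
  have hcl : IsClosed {η : lam.E2 | ⟪κ, lam.evalE2 u (lam.rightConv f η)⟫_ℂ =
      lam.bilin f u (lam.evalE2 u η) (star κ)} :=
    isClosed_eq (by fun_prop)
      ((lam.continuous_bilin_left f u (star κ)).comp (lam.evalE2 u).continuous)
  refine lam.denseRange_toE2.induction_on η hcl fun a => ?_
  have hint := lam.integrable_mul_inv_mul f u (lam.restrict a u) (star κ)
  rw [rightConv_toE2, evalE2_toE2, evalE2_toE2, bilin, integral_prod_symm _ hint, L2.inner_def]
  refine integral_congr_ae ?_
  filter_upwards [lam.coeFn_restrict (lam.convCc a f) u, Lp.coeFn_star κ, lam.ae_r_eq u]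
    with x h1 h2 h3
  rw [integral_mul_const, h1, h2, RCLike.inner_apply]
  congr 1
  obtain rfl := (rangeUnit_eq_iff x u).2 h3
  refine integral_congr_ae ?_
  filter_upwards [lam.coeFn_restrict a (rangeUnit x)] with t ht
  rw [ht]

theorem inner_translE2_toE2 {u : unitSpace G} (y : fiber u) (f : C_c(G, ℂ))
    (κ : Lp ℂ 2 (lam.measure u)) :
    ⟪κ, lam.translE2 y (lam.toE2 f)⟫_ℂ =
      ∫ x, f ((y : G)⁻¹ * x) * (star κ : Lp ℂ 2 (lam.measure u)) x ∂lam.measure u := by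
  rw [L2.inner_def]
  refine integral_congr_ae ?_
  filter_upwards [lam.coeFn_translE2_toE2 y f, Lp.coeFn_star κ] with x h1 h2
  rw [h1, h2, RCLike.inner_apply]
  rfl

theorem enorm_star_Lp {X : Type*} [MeasurableSpace X] {μ : Measure X} (κ : Lp ℂ 2 μ) :
    ‖(star κ : Lp ℂ 2 μ)‖ₑ = ‖κ‖ₑ := by
  rw [Lp.enorm_def, Lp.enorm_def]
  refine eLpNorm_congr_enorm_ae ?_
  filter_upwards [Lp.coeFn_star κ] with x hx
  rw [hx, Pi.star_apply, ← ofReal_norm, ← ofReal_norm, norm_star]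

theorem enorm_inner_translE2_le {u : unitSpace G} (y : fiber u) (f : C_c(G, ℂ))
    (κ : Lp ℂ 2 (lam.measure u)) :
    ‖⟪κ, lam.translE2 y (lam.toE2 f)⟫_ℂ‖ₑ ≤
      ∫⁻ x, ‖f ((y : G)⁻¹ * x)‖ₑ * ‖(star κ : Lp ℂ 2 (lam.measure u)) x‖ₑ ∂lam.measure u := by
  rw [inner_translE2_toE2]
  refine (enorm_integral_le_lintegral_enorm _).trans_eq ?_
  simp_rw [enorm_mul]

theorem enorm_inner_comm {E : Type*} [NormedAddCommGroup E] [InnerProductSpace ℂ E] (v w : E) :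
    ‖⟪v, w⟫_ℂ‖ₑ = ‖⟪w, v⟫_ℂ‖ₑ := by
  rw [← ofReal_norm, ← ofReal_norm, norm_inner_symm]

theorem restrict_star (f : C_c(G, ℂ)) (u : unitSpace G) :
    lam.restrict (star f) u = star (lam.restrict f u) := by
  refine Lp.ext ?_
  filter_upwards [lam.coeFn_restrict (star f) u, lam.coeFn_restrict f u,
    Lp.coeFn_star (lam.restrict f u)] with x h1 h2 h3
  rw [h1, h3, Pi.star_apply, h2]
  rfl

/-- The vector in `L²(G^u)` given by `p * g` is the average of the translates of `g`. -/
theorem inner_restrict_conv (p g : C_c(G, ℂ)) {u : unitSpace G} (m : Lp ℂ 2 (lam.measure u))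
    {Q : G → ℂ} (hQ : ∀ x : fiber u, Q x = ⟪lam.translE2 x (lam.toE2 g), m⟫_ℂ) :
    ⟪lam.restrict (lam.convCc p g) u, m⟫_ℂ =
      ∫ x, Q x * lam.restrict (star p) u x ∂lam.measure u := by
  have hint := lam.integrable_mul_inv_mul g u (lam.restrict p u) (star m)
  -- p * g is read as R_g p, and conjugation moves m into the slot where the formula for right
  -- convolutions applies.
  rw [← inner_conj_symm, ← evalE2_toE2, ← rightConv_toE2, inner_evalE2_rightConv, bilin,
    evalE2_toE2, integral_prod _ hint, ← integral_conj]
  refine integral_congr_ae ?_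
  filter_upwards [lam.coeFn_restrict p u, lam.coeFn_restrict (star p) u, lam.ae_r_eq u]
    with x h1 h2 h3
  simp only [_root_.mul_assoc]
  rw [integral_const_mul, ← lam.inner_translE2_toE2 (⟨x, h3⟩ : fiber u), h1, h2, map_mul,
    inner_conj_symm, hQ ⟨x, h3⟩, mul_comm]
  rfl

/-! ### Invariant kernels -/

theorem measurableSet_of_isSigmaCompact {s : Set G} (hs : IsSigmaCompact s) : MeasurableSet s := by
  obtain ⟨K, hK, rfl⟩ := hs
  exact MeasurableSet.iUnion fun n => (hK n).measurableSet

/-- A continuous kernel on `G^u × G^u` that depends only on `y⁻¹x` comes from a Borel function. -/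
theorem exists_measurable_kernel {u : unitSpace G} {Q : fiber u × fiber u → ℂ} (hc : Continuous Q)
    (hinv : ∀ p p' : fiber u × fiber u,
      (p.1 : G)⁻¹ * p.2 = (p'.1 : G)⁻¹ * p'.2 → Q p = Q p') :
    ∃ q : G → ℂ, Measurable q ∧ ∀ p : fiber u × fiber u, q ((p.1 : G)⁻¹ * p.2) = Q p := by
  let π : fiber u × fiber u → G := fun p => (p.1 : G)⁻¹ * p.2
  have hπ : Continuous π := continuousOn_inv_mul.comp_continuous
    (f := fun p : fiber u × fiber u => ((p.1 : G), (p.2 : G))) (by fun_prop)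
    fun p => Eq.trans p.1.2 (Eq.symm p.2.2)
  have hfac : Q.FactorsThrough π := fun p p' h => hinv p p' h
  have : LocallyCompactSpace (fiber u) :=
    (isClosed_fiber u).isClosedEmbedding_subtypeVal.locallyCompactSpace
  -- G^u × G^u is σ-compact, so images of closed sets under π are σ-compact and therefore Borel.
  have himg : ∀ C : Set (fiber u × fiber u), IsClosed C → MeasurableSet (π '' C) := fun C hC =>
    measurableSet_of_isSigmaCompact ((isSigmaCompact_univ.of_isClosed_subset hC
      (subset_univ _)).image hπ)
  refine ⟨Function.extend π Q 0, measurable_of_isClosed fun C hC => ?_, fun p =>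
    hfac.extend_apply 0 p⟩
  -- The default value 0 off the range of π adds the complement of the range exactly when C contains
  -- 0.
  have hpre : Function.extend π Q 0 ⁻¹' C = π '' (Q ⁻¹' C) ∪ ((range π)ᶜ ∩ {_z | (0 : ℂ) ∈ C}) := by
    ext z
    by_cases hz : z ∈ range π
    · obtain ⟨p, rfl⟩ := hz
      rw [mem_preimage, hfac.extend_apply]
      constructor
      · exact fun h => Or.inl ⟨p, h, rfl⟩
      · rintro (⟨p', hp', h⟩ | ⟨h, -⟩)
        · rw [hinv p p' h.symm]
          exact hp'
        · exact absurd ⟨p, rfl⟩ h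
    · rw [mem_preimage, Function.extend_apply' _ _ _ hz]
      constructor
      · exact fun h => Or.inr ⟨hz, h⟩
      · rintro (⟨p', -, h⟩ | ⟨-, h⟩)
        · exact absurd ⟨p', h⟩ hz
        · exact h
  rw [hpre]
  refine (himg _ (hC.preimage hc)).union (MeasurableSet.inter ?_ (MeasurableSet.const _))
  rw [← image_univ]
  exact (himg _ isClosed_univ).compl

/-! ### The projection onto an orthogonal complement -/

section Hilbert

variable {E : Type*} [NormedAddCommGroup E] [InnerProductSpace ℂ E] [CompleteSpace E]

/-- The projection onto the orthogonal complement of a subspace. -/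
def coProjection (M : Submodule ℂ E) : E →L[ℂ] E := (Submodule.orthogonal M).starProjection

theorem coProjection_of_mem {M : Submodule ℂ E} {v : E} (hv : v ∈ M) : coProjection M v = 0 :=
  (Submodule.starProjection_apply_eq_zero_iff _).2 (Submodule.le_orthogonal_orthogonal _ hv)

theorem mem_closure_of_coProjection_eq_zero {M : Submodule ℂ E} {v : E}
    (h : coProjection M v = 0) : v ∈ M.topologicalClosure := by
  rw [← Submodule.orthogonal_orthogonal_eq_closure]
  exact (Submodule.starProjection_apply_eq_zero_iff _).1 h

theorem norm_coProjection_le (M : Submodule ℂ E) (v : E) : ‖coProjection M v‖ ≤ ‖v‖ :=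
  Submodule.norm_starProjection_apply_le _ v

theorem inner_coProjection_left (M : Submodule ℂ E) (v w : E) :
    ⟪coProjection M v, w⟫_ℂ = ⟪v, coProjection M w⟫_ℂ :=
  Submodule.inner_starProjection_left_eq_right _ v w

theorem coProjection_map {M : Submodule ℂ E} (e : E ≃ₗᵢ[ℂ] E)
    (hM : M.map (e.toLinearEquiv : E →ₗ[ℂ] E) = M) (v : E) :
    coProjection M (e v) = e (coProjection M v) := by
  have h2 : (Submodule.orthogonal M).map (e.toLinearEquiv : E →ₗ[ℂ] E) =
      Submodule.orthogonal M := by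
    rw [Submodule.map_orthogonal_equiv, hM]
  have h3 := Submodule.starProjection_map_apply e (Submodule.orthogonal M) (e v)
  rw [LinearIsometryEquiv.symm_apply_apply] at h3
  rw [coProjection, ← h3]
  simp only [h2]

end Hilbert

/-! ### Tuples of sections on a fibre -/

section Tuples

variable {ι : Type*} [Fintype ι]

/-- The tuple of values at `u` of a tuple of sections. -/
def evalVec (u : unitSpace G) (ξ : ι → lam.E2) : PiLp 2 fun _ : ι => Lp ℂ 2 (lam.measure u) :=
  WithLp.toLp 2 fun i => lam.evalE2 u (ξ i)

/-- The tuple of translates of a tuple of sections. -/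
def translVec {u : unitSpace G} (y : fiber u) (ξ : ι → lam.E2) :
    PiLp 2 fun _ : ι => Lp ℂ 2 (lam.measure u) :=
  WithLp.toLp 2 fun i => lam.translE2 y (ξ i)

theorem norm_toLp_le_sum {E : Type*} [NormedAddCommGroup E] (v : ι → E) :
    ‖(WithLp.toLp 2 v : PiLp 2 fun _ : ι => E)‖ ≤ ∑ i, ‖v i‖ := by
  refine le_of_sq_le_sq ?_ (Finset.sum_nonneg fun i _ => norm_nonneg _)
  rw [PiLp.norm_sq_eq_of_L2]
  exact Finset.sum_sq_le_sq_sum_of_nonneg fun i _ => norm_nonneg _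

theorem inner_single {E : Type*} [NormedAddCommGroup E] [InnerProductSpace ℂ E]
    [DecidableEq ι] (j : ι) (v : E) (w : PiLp 2 fun _ : ι => E) :
    ⟪PiLp.single 2 j v, w⟫_ℂ = ⟪v, w j⟫_ℂ := by
  rw [PiLp.inner_apply, Finset.sum_eq_single j]
  · simp
  · intro i _ hi
    simp [hi]
  · simp

/-- The span of the translates to `G^u` of a tuple of sections. -/
def translSpan (u : unitSpace G) (ξ : ι → lam.E2) :
    Submodule ℂ (PiLp 2 fun _ : ι => Lp ℂ 2 (lam.measure u)) :=
  Submodule.span ℂ (range fun y : fiber u => lam.translVec y ξ)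

/-- The projection onto the orthogonal complement of the translates of a tuple of sections. -/
def coProj (u : unitSpace G) (ξ : ι → lam.E2) :
    (PiLp 2 fun _ : ι => Lp ℂ 2 (lam.measure u)) →L[ℂ]
      (PiLp 2 fun _ : ι => Lp ℂ 2 (lam.measure u)) :=
  coProjection (lam.translSpan u ξ)

theorem coProj_translVec {u : unitSpace G} (y : fiber u) (ξ : ι → lam.E2) :
    lam.coProj u ξ (lam.translVec y ξ) = 0 :=
  coProjection_of_mem (Submodule.subset_span ⟨y, rfl⟩)

/-- Translation by an arrow of the isotropy group of `u` as a unitary operator on `L²(G^u)`. -/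
def isotropyEquiv {u : unitSpace G} (γ : G) (hr : rangeUnit γ = u) (hs : sourceUnit γ = u) :
    Lp ℂ 2 (lam.measure u) ≃ₗᵢ[ℂ] Lp ℂ 2 (lam.measure u) :=
  LinearIsometryEquiv.ofSurjective (lam.transl γ hr hs) fun ζ => by
    have hr' : rangeUnit γ⁻¹ = u := by
      rw [← hs]
      exact Subtype.ext (r_inv γ)
    have hs' : sourceUnit γ⁻¹ = u := by
      rw [← hr]
      exact Subtype.ext (s_inv γ)
    have e : γ * γ⁻¹ = u := by
      rw [TopologicalGroupoid.mul_inv, ← hr]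
      rfl
    refine ⟨lam.transl γ⁻¹ hr' hs' ζ, ?_⟩
    rw [lam.transl_transl γ γ⁻¹ hr hs hr' hs' (by rw [e, rangeUnit_coe])
      (by rw [e, sourceUnit_coe])]
    have key : ∀ (z : G) (hz : z = u) (h1 : rangeUnit z = u) (h2 : sourceUnit z = u),
        lam.transl z h1 h2 ζ = ζ := by
      rintro z rfl h1 h2
      exact lam.transl_unit u h1 h2 ζ
    exact key _ e _ _

theorem mul_mem_fiber {u : unitSpace G} {γ : G} (hr : rangeUnit γ = u) (hs : sourceUnit γ = u)
    (y : fiber u) : γ * (y : G) ∈ fiber u := by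
  have e1 : r γ = (u : G) := congrArg Subtype.val hr
  have e2 : s γ = (u : G) := congrArg Subtype.val hs
  exact (r_mul _ _ (e2.trans (Eq.symm y.2))).trans e1

theorem isotropyEquiv_translVec {u : unitSpace G} {γ : G} (hr : rangeUnit γ = u)
    (hs : sourceUnit γ = u) (y z : fiber u) (hz : (z : G) = γ * y) (ξ : ι → lam.E2) :
    LinearIsometryEquiv.piLpCongrRight 2 (fun _ => lam.isotropyEquiv γ hr hs)
      (lam.translVec y ξ) = lam.translVec z ξ := by
  rw [LinearIsometryEquiv.piLpCongrRight_apply, translVec, translVec]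
  congr 1
  funext i
  exact lam.transl_translE2 hr hs y z hz (ξ i)

/-- Left multiplication by γ permutes G^u, hence permutes the vectors spanning `translSpan`. A
unitary preserving a subspace commutes with the projection onto its complement. -/
theorem coProj_isotropyEquiv {u : unitSpace G} (γ : G) (hr : rangeUnit γ = u)
    (hs : sourceUnit γ = u) (ξ : ι → lam.E2)
    (v : PiLp 2 fun _ : ι => Lp ℂ 2 (lam.measure u)) :
    lam.coProj u ξ (LinearIsometryEquiv.piLpCongrRight 2
      (fun _ => lam.isotropyEquiv γ hr hs) v) =
      LinearIsometryEquiv.piLpCongrRight 2 (fun _ => lam.isotropyEquiv γ hr hs)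
        (lam.coProj u ξ v) := by
  set e := LinearIsometryEquiv.piLpCongrRight 2
    (fun _ : ι => lam.isotropyEquiv γ hr hs) with he
  have happ : ∀ y : fiber u, e (lam.translVec y ξ) =
      lam.translVec ⟨γ * (y : G), mul_mem_fiber hr hs y⟩ ξ := fun y =>
    lam.isotropyEquiv_translVec hr hs y _ rfl ξ
  have hr' : rangeUnit γ⁻¹ = u := by
    rw [← hs]
    exact Subtype.ext (r_inv γ)
  have hs' : sourceUnit γ⁻¹ = u := by
    rw [← hr]
    exact Subtype.ext (s_inv γ)
  have hmap : (lam.translSpan u ξ).map (e.toLinearEquiv : _ →ₗ[ℂ] _) = lam.translSpan u ξ := by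
    rw [translSpan, Submodule.map_span]
    congr 1
    ext w
    constructor
    · rintro ⟨_, ⟨y, rfl⟩, rfl⟩
      exact ⟨_, (happ y).symm⟩
    · rintro ⟨y, rfl⟩
      refine ⟨_, ⟨⟨γ⁻¹ * (y : G), mul_mem_fiber hr' hs' y⟩, rfl⟩, ?_⟩
      refine (happ _).trans ?_
      congr 2
      refine inv_mul_cancel_left γ y ?_
      exact (congrArg Subtype.val hr).trans (Eq.symm y.2)
  exact coProjection_map e hmap v

end Tuples

/-! ### Operators that commute with right convolutions -/

section Tuples

variable {ι : Type*} [Fintype ι]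

/-- The coefficients of the `j`-th component of the projected translates of a tuple. -/
def coProjKernel (u : unitSpace G) (ξ : ι → lam.E2) (h : ι → C_c(G, ℂ)) (g : C_c(G, ℂ)) (j : ι)
    (p : fiber u × fiber u) : ℂ :=
  ⟪lam.translE2 p.2 (lam.toE2 g),
    (lam.coProj u ξ (lam.translVec p.1 fun i => lam.toE2 (h i))) j⟫_ℂ

theorem continuous_coProjKernel (u : unitSpace G) (ξ : ι → lam.E2) (h : ι → C_c(G, ℂ))
    (g : C_c(G, ℂ)) (j : ι) : Continuous (lam.coProjKernel u ξ h g j) := by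
  have h1 : Continuous fun y : fiber u => lam.translVec y fun i => lam.toE2 (h i) :=
    (PiLp.continuous_toLp 2 _).comp
      (continuous_pi fun i => lam.continuous_translE2_toE2 (h i))
  have h2 : Continuous fun y : fiber u =>
      (lam.coProj u ξ (lam.translVec y fun i => lam.toE2 (h i))) j :=
    (PiLp.continuous_apply 2 _ j).comp ((lam.coProj u ξ).continuous.comp h1)
  exact ((lam.continuous_translE2_toE2 g).comp continuous_snd).inner (h2.comp continuous_fst)

/-- If y⁻¹x = y'⁻¹x', then γ = y'y⁻¹ lies in the isotropy group of u and carries (y, x) to (y', x').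
It acts unitarily and commutes with the projection. -/
theorem coProjKernel_invariant (u : unitSpace G) (ξ : ι → lam.E2) (h : ι → C_c(G, ℂ))
    (g : C_c(G, ℂ)) (j : ι) (p p' : fiber u × fiber u)
    (hp : (p.1 : G)⁻¹ * p.2 = (p'.1 : G)⁻¹ * p'.2) :
    lam.coProjKernel u ξ h g j p = lam.coProjKernel u ξ h g j p' := by
  obtain ⟨⟨y, hy⟩, ⟨x, hx⟩⟩ := p
  obtain ⟨⟨y', hy'⟩, ⟨x', hx'⟩⟩ := p'
  change r y = (u : G) at hy
  change r x = (u : G) at hx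
  change r y' = (u : G) at hy'
  change r x' = (u : G) at hx'
  change y⁻¹ * x = y'⁻¹ * x' at hp
  have hss : s y = s y' := by
    rw [← r_inv_mul y x (hy.trans hx.symm), hp, r_inv_mul y' x' (hy'.trans hx'.symm)]
  have hc : s y' = r y⁻¹ := by rw [r_inv, hss]
  have hr : rangeUnit (y' * y⁻¹) = u := (rangeUnit_eq_iff _ _).2 (by rw [r_mul _ _ hc, hy'])
  have hs : sourceUnit (y' * y⁻¹) = u := Subtype.ext (by
    change s (y' * y⁻¹) = _
    rw [s_mul _ _ hc, s_inv, hy])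
  have e1 : y' = y' * y⁻¹ * y := by
    rw [TopologicalGroupoid.mul_assoc _ _ _ hc (s_inv y), inv_mul, hss, mul_s_self]
  have e2 : x' = y' * y⁻¹ * x := by
    rw [TopologicalGroupoid.mul_assoc _ _ _ hc (by rw [s_inv, hx, hy]), hp,
      inv_mul_cancel_left _ _ (hy'.trans hx'.symm)]
  rw [coProjKernel, coProjKernel, ← lam.isotropyEquiv_translVec hr hs ⟨y, hy⟩ ⟨y', hy'⟩ e1,
    ← lam.transl_translE2 hr hs ⟨x, hx⟩ ⟨x', hx'⟩ e2, coProj_isotropyEquiv,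
    LinearIsometryEquiv.piLpCongrRight_apply]
  exact ((lam.transl _ hr hs).inner_map_map _ _).symm

/-- The projection kills y·ξ, so ξ may be subtracted first. The bound is uniform in y. -/
theorem norm_coProj_translVec_le {u : unitSpace G} (y : fiber u) (ξ ξ' : ι → lam.E2) (j : ι) :
    ‖(lam.coProj u ξ (lam.translVec y ξ')) j‖ ≤ ∑ i, ‖ξ' i - ξ i‖ := by
  have e : lam.coProj u ξ (lam.translVec y ξ') =
      lam.coProj u ξ (lam.translVec y fun i => ξ' i - ξ i) := by
    have e' : (lam.translVec y fun i => ξ' i - ξ i) =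
        lam.translVec y ξ' - lam.translVec y ξ := by
      rw [translVec, translVec, translVec, ← WithLp.toLp_sub]
      congr 1
      funext i
      exact map_sub _ _ _
    rw [e', map_sub, coProj_translVec, sub_zero]
  rw [e]
  refine (PiLp.norm_apply_le _ j).trans ((norm_coProjection_le _ _).trans
    ((norm_toLp_le_sum _).trans ?_))
  exact Finset.sum_le_sum fun i _ => lam.norm_translE2_le y _

/-- |q(x)| is at most the integral of |g(x⁻¹ ·)| |m|, to which the Schur test applies. With m a
projected translate this bounds the slices of the kernel. -/
theorem lintegral_coProjKernel_sq_le {g : C_c(G, ℂ)} {A : ℝ}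
    (hA : ∀ u : unitSpace G, ∀ x : G, r x = u →
      ∫⁻ y, ‖g (x⁻¹ * y)‖ₑ ∂lam.measure u ≤ ENNReal.ofReal A ∧
      ∫⁻ y, ‖g (y⁻¹ * x)‖ₑ ∂lam.measure u ≤ ENNReal.ofReal A)
    {u : unitSpace G} (m : Lp ℂ 2 (lam.measure u)) {q : G → ℂ}
    (hq : ∀ x : fiber u, q x = ⟪lam.translE2 x (lam.toE2 g), m⟫_ℂ) :
    ∫⁻ x, ‖q x‖ₑ ^ 2 ∂lam.measure u ≤ (ENNReal.ofReal A * ‖m‖ₑ) ^ 2 := by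
  have h2 := lam.lintegral_sq_lintegral_mul_right_le hA u
    (aemeasurable_enorm_Lp (star m : Lp ℂ 2 (lam.measure u)))
  rw [lintegral_enorm_sq_Lp, enorm_star_Lp, ← mul_pow] at h2
  refine (lintegral_mono_ae ?_).trans h2
  filter_upwards [lam.ae_r_eq u] with x hx
  gcongr
  rw [hq ⟨x, hx⟩, enorm_inner_comm]
  exact lam.enorm_inner_translE2_le ⟨x, hx⟩ g m

/-- The weak form of "η * h is the average of the y·h with weight η(y)"; it makes sense although η^u
is only square integrable. -/
theorem inner_evalVec_rightConv (u : unitSpace G) (h : ι → C_c(G, ℂ)) (η : lam.E2)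
    (κ : PiLp 2 fun _ : ι => Lp ℂ 2 (lam.measure u)) {W : G → ℂ}
    (hW : ∀ y : fiber u, W y = ⟪κ, lam.translVec y fun i => lam.toE2 (h i)⟫_ℂ) :
    ⟪κ, lam.evalVec u fun i => lam.rightConv (h i) η⟫_ℂ =
      ∫ y, lam.evalE2 u η y * W y ∂lam.measure u := by
  have hint := fun i => lam.integrable_mul_inv_mul (h i) u (lam.evalE2 u η)
    (star (κ i) : Lp ℂ 2 (lam.measure u))
  rw [PiLp.inner_apply]
  have e1 : ∀ i, ⟪κ i, (lam.evalVec u fun i => lam.rightConv (h i) η) i⟫_ℂ =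
      ∫ y, ∫ x, lam.evalE2 u η y * h i (y⁻¹ * x) * (star (κ i) : Lp ℂ 2 (lam.measure u)) x
        ∂lam.measure u ∂lam.measure u := fun i =>
    (lam.inner_evalE2_rightConv (h i) u η (κ i)).trans (integral_prod _ (hint i))
  simp_rw [e1]
  rw [← integral_finsetSum _ fun i _ => (hint i).integral_prod_left]
  refine integral_congr_ae ?_
  filter_upwards [lam.ae_r_eq u] with y hy
  rw [hW ⟨y, hy⟩, PiLp.inner_apply, Finset.mul_sum]
  refine Finset.sum_congr rfl fun i _ => ?_
  simp only [_root_.mul_assoc]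
  rw [integral_const_mul]
  congr 1
  exact (lam.inner_translE2_toE2 ⟨y, hy⟩ (h i) (κ i)).symm

theorem lintegral_mul_inner_translVec_le {h : ι → C_c(G, ℂ)} {A : ι → ℝ}
    (hA : ∀ i, ∀ u : unitSpace G, ∀ x : G, r x = u →
      ∫⁻ y, ‖h i (x⁻¹ * y)‖ₑ ∂lam.measure u ≤ ENNReal.ofReal (A i) ∧
      ∫⁻ y, ‖h i (y⁻¹ * x)‖ₑ ∂lam.measure u ≤ ENNReal.ofReal (A i))
    {u : unitSpace G} (a : Lp ℂ 2 (lam.measure u))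
    (κ : PiLp 2 fun _ : ι => Lp ℂ 2 (lam.measure u)) {W : G → ℂ}
    (hW : ∀ y : fiber u, W y = ⟪κ, lam.translVec y fun i => lam.toE2 (h i)⟫_ℂ) :
    ∫⁻ y, ‖a y * W y‖ₑ ∂lam.measure u ≤ ∑ i, ENNReal.ofReal (A i) * ‖a‖ₑ * ‖κ‖ₑ := by
  have hm := fun i => (lam.integrable_mul_inv_mul (h i) u a
    (star (κ i) : Lp ℂ 2 (lam.measure u))).aestronglyMeasurable.enorm
  calc ∫⁻ y, ‖a y * W y‖ₑ ∂lam.measure u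
      ≤ ∫⁻ y, ∑ i, ∫⁻ x, ‖a y * h i (y⁻¹ * x) * (star (κ i) : Lp ℂ 2 (lam.measure u)) x‖ₑ
          ∂lam.measure u ∂lam.measure u := by
        refine lintegral_mono_ae ?_
        filter_upwards [lam.ae_r_eq u] with y hy
        rw [hW ⟨y, hy⟩, PiLp.inner_apply, Finset.mul_sum]
        refine (enorm_sum_le _ _).trans (Finset.sum_le_sum fun i _ => ?_)
        simp_rw [_root_.mul_assoc, enorm_mul]
        rw [lintegral_const_mul' _ _ enorm_ne_top]
        gcongr
        exact lam.enorm_inner_translE2_le ⟨y, hy⟩ (h i) (κ i)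
    _ = ∑ i, ∫⁻ y, ∫⁻ x, ‖a y * h i (y⁻¹ * x) * (star (κ i) : Lp ℂ 2 (lam.measure u)) x‖ₑ
          ∂lam.measure u ∂lam.measure u :=
        lintegral_finsetSum' _ fun i _ => (hm i).lintegral_prod_right'
    _ ≤ _ := by
        refine Finset.sum_le_sum fun i _ => ?_
        rw [← lintegral_prod _ (hm i)]
        refine (lam.lintegral_lintegral_mul_le (hA i) u a _).trans ?_
        rw [enorm_star_Lp]
        gcongr
        exact enorm_le_iff_norm_le.2 (PiLp.norm_apply_le κ i)

end Tuples

/-! ### Values of commuting operators lie in the span of the translates -/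

theorem exists_norm_sub_restrict_lt {u : unitSpace G} (a : Lp ℂ 2 (lam.measure u)) {ε : ℝ}
    (hε : 0 < ε) : ∃ f : C_c(G, ℂ), ‖a - lam.restrict f u‖ < ε := by
  obtain ⟨g, hg, hgε, hgc, -⟩ := (Lp.memLp a).exists_hasCompactSupport_eLpNorm_sub_le
    ENNReal.ofNat_ne_top (ε := ENNReal.ofReal (ε / 2)) (by simpa using hε)
  refine ⟨⟨⟨g, hgc⟩, hg⟩, ?_⟩
  refine lt_of_le_of_lt ?_ (half_lt_self hε)
  rw [← ENNReal.ofReal_le_ofReal_iff (half_pos hε).le, ofReal_norm, Lp.enorm_def]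
  refine (eLpNorm_congr_ae ?_).trans_le hgε
  filter_upwards [Lp.coeFn_sub a (lam.restrict ⟨⟨g, hgc⟩, hg⟩ u),
    lam.coeFn_restrict ⟨⟨g, hgc⟩, hg⟩ u] with x h1 h2
  rw [h1, Pi.sub_apply, h2]
  rfl

section Tuples

variable {ι : Type*} [Fintype ι]

/-- The pairing is the double integral of a(y) q(y⁻¹x) k(x). For kernels from C_c(G), boundedness of
B estimates such integrals by the norm in E². Carried over to q, whose slices have norm at most A δ,
this yields smallness without integrating |a|. -/
theorem norm_inner_coProj_single_le {B : lam.E2 →L[ℂ] lam.E2} {η : lam.E2}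
    [DecidableEq ι] (hB : ∀ f, B (lam.toE2 f) = lam.rightConv f η) (u : unitSpace G) (ξ : ι → lam.E2)
    (h : ι → C_c(G, ℂ)) (j : ι) (p : C_c(G, ℂ)) {g : C_c(G, ℂ)} {A : ℝ} (hA0 : 0 < A)
    (hA : ∀ u : unitSpace G, ∀ x : G, r x = u →
      ∫⁻ y, ‖g (x⁻¹ * y)‖ₑ ∂lam.measure u ≤ ENNReal.ofReal A ∧
      ∫⁻ y, ‖g (y⁻¹ * x)‖ₑ ∂lam.measure u ≤ ENNReal.ofReal A) {δ : ℝ} (hδ : 0 < δ)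
    (hh : ∑ i, ‖lam.toE2 (h i) - ξ i‖ ≤ δ) :
    ‖⟪lam.coProj u ξ (PiLp.single 2 j (lam.restrict (lam.convCc p g) u)),
      lam.evalVec u fun i => B (lam.toE2 (h i))⟫_ℂ‖ ≤
      ‖lam.restrict p u‖ * ‖B‖ * (A * δ) := by
  set a := lam.evalE2 u η with ha
  obtain ⟨q, hqm, hq⟩ := exists_measurable_kernel (lam.continuous_coProjKernel u ξ h g j)
    (lam.coProjKernel_invariant u ξ h g j)
  set κ := lam.coProj u ξ (PiLp.single 2 j (lam.restrict (lam.convCc p g) u)) with hκ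
  set k := lam.restrict (star p) u with hk
  have hW : ∀ y : fiber u, (∫ x, q ((y : G)⁻¹ * x) * k x ∂lam.measure u) =
      ⟪κ, lam.translVec y fun i => lam.toE2 (h i)⟫_ℂ := fun y => by
    rw [hκ, coProj, inner_coProjection_left, inner_single]
    exact (lam.inner_restrict_conv p g (Q := fun x => q ((y : G)⁻¹ * x)) _
      fun x => hq (y, x)).symm
  -- Integrate over y first: for fixed x this pairs `a` with coefficients of the projection of x·g,
  -- whose norm is at most ‖g‖, so it is bounded by a constant D. The remaining factor conj p is
  -- integrable.
  have hint : Integrable (fun z : G × G => a z.1 * q (z.1⁻¹ * z.2) * k z.2)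
      ((lam.measure u).prod (lam.measure u)) := by
    choose A' hA'0 hA' using fun i => lam.exists_schur_bound (h i)
    have hmeas := lam.aestronglyMeasurable_mul_inv_mul q hqm u a k
    refine ⟨hmeas, ?_⟩
    let D : ℝ≥0∞ := ∑ i, ENNReal.ofReal (A' i) * ‖a‖ₑ * ‖lam.toE2 g‖ₑ
    have hD : D < ∞ := ENNReal.sum_lt_top.2 fun i _ =>
      ENNReal.mul_lt_top (ENNReal.mul_lt_top ENNReal.ofReal_lt_top enorm_lt_top) enorm_lt_top
    rw [HasFiniteIntegral, lintegral_prod_symm _ hmeas.enorm]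
    calc ∫⁻ x, ∫⁻ y, ‖a y * q (y⁻¹ * x) * k x‖ₑ ∂lam.measure u ∂lam.measure u
        ≤ ∫⁻ x, D * ‖star p x‖ₑ ∂lam.measure u := by
          refine lintegral_mono_ae ?_
          filter_upwards [lam.ae_r_eq u, lam.coeFn_restrict (star p) u] with x hx hkx
          simp_rw [enorm_mul _ (k x)]
          rw [lintegral_mul_const' _ _ enorm_ne_top, hk, hkx]
          gcongr
          refine (lam.lintegral_mul_inner_translVec_le hA' a
            (lam.coProj u ξ (PiLp.single 2 j (lam.translE2 ⟨x, hx⟩ (lam.toE2 g)))) (W := fun y => q (y⁻¹ * x)) fun y => ?_).trans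
            (Finset.sum_le_sum fun i _ => ?_)
          · rw [coProj, inner_coProjection_left, inner_single]
            exact hq (y, ⟨x, hx⟩)
          · gcongr
            refine enorm_le_iff_norm_le.2 ((norm_coProjection_le _ _).trans ?_)
            rw [PiLp.norm_single]
            exact lam.norm_translE2_le _ _
      _ = D * ∫⁻ x, ‖star p x‖ₑ ∂lam.measure u := lintegral_const_mul' _ _ hD.ne
      _ < ∞ := ENNReal.mul_lt_top hD (lam.integrable_Cc (star p) u).2
  have hC : ∀ F : C_c(G, ℂ), ‖lam.bilin F u a k‖ ≤
      ‖lam.restrict p u‖ * ‖B‖ * ‖lam.toE2 F‖ := fun F => by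
    rw [hk, restrict_star, ha, ← inner_evalE2_rightConv, ← hB, _root_.mul_assoc]
    refine (norm_inner_le_norm _ _).trans ?_
    gcongr
    exact (lam.norm_evalE2_le u _).trans (B.le_opNorm _)
  have hqN : ∀ y : fiber u, ∫⁻ x, ‖q ((y : G)⁻¹ * x)‖ₑ ^ 2 ∂lam.measure u ≤
      ENNReal.ofReal (A * δ) ^ 2 := fun y => by
    refine (lam.lintegral_coProjKernel_sq_le hA
      ((lam.coProj u ξ (lam.translVec y fun i => lam.toE2 (h i))) j)
      (q := fun x => q ((y : G)⁻¹ * x)) fun x => hq (y, x)).trans ?_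
    rw [ENNReal.ofReal_mul hA0.le, ← ofReal_norm]
    gcongr
    exact (lam.norm_coProj_translVec_le y ξ _ j).trans hh
  have key := lam.norm_integral_kernel_le a (star p) (by positivity) hC hqm
    (mul_pos hA0 hδ) hqN hint
  rw [integral_prod _ hint] at key
  simp_rw [hB]
  rw [lam.inner_evalVec_rightConv u h η κ
    (W := fun y => ∫ x, q (y⁻¹ * x) * k x ∂lam.measure u) hW]
  refine le_of_eq_of_le (congrArg _ (integral_congr_ae (Eventually.of_forall fun y => ?_))) key
  simp only [_root_.mul_assoc]
  exact (integral_const_mul _ _).symm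

theorem inner_coProj_single_eq_zero {B : lam.E2 →L[ℂ] lam.E2} {η : lam.E2} [DecidableEq ι]
    (hB : ∀ f, B (lam.toE2 f) = lam.rightConv f η) (u : unitSpace G) (ξ : ι → lam.E2) (j : ι)
    (p g : C_c(G, ℂ)) :
    ⟪lam.coProj u ξ (PiLp.single 2 j (lam.restrict (lam.convCc p g) u)),
      lam.evalVec u fun i => B (ξ i)⟫_ℂ = 0 := by
  obtain ⟨A, hA0, hA⟩ := lam.exists_schur_bound g
  -- The estimate needs a strictly positive constant, hence A + 1.
  have hA' : ∀ u : unitSpace G, ∀ x : G, r x = u →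
      ∫⁻ y, ‖g (x⁻¹ * y)‖ₑ ∂lam.measure u ≤ ENNReal.ofReal (A + 1) ∧
      ∫⁻ y, ‖g (y⁻¹ * x)‖ₑ ∂lam.measure u ≤ ENNReal.ofReal (A + 1) := fun u x hx =>
    have hAA := ENNReal.ofReal_le_ofReal (le_add_of_nonneg_right zero_le_one : A ≤ A + 1)
    ⟨(hA u x hx).1.trans hAA, (hA u x hx).2.trans hAA⟩
  have hle := fun h δ hδ => lam.norm_inner_coProj_single_le hB u ξ h j p
    (by positivity : 0 < A + 1) hA' (δ := δ) hδ
  generalize lam.coProj u ξ (PiLp.single 2 j (lam.restrict (lam.convCc p g) u)) = κ at hle ⊢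
  have hdiff : ∀ h : ι → C_c(G, ℂ), ‖lam.evalVec u (fun i => B (lam.toE2 (h i))) -
      lam.evalVec u (fun i => B (ξ i))‖ ≤ ‖B‖ * ∑ i, ‖lam.toE2 (h i) - ξ i‖ := fun h => by
    rw [evalVec, evalVec, ← WithLp.toLp_sub, Finset.mul_sum]
    refine (norm_toLp_le_sum _).trans (Finset.sum_le_sum fun i _ => ?_)
    rw [Pi.sub_apply, ← map_sub, ← map_sub]
    exact (lam.norm_evalE2_le u _).trans (B.le_opNorm _)
  generalize lam.evalVec u (fun i => B (ξ i)) = v at hdiff ⊢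
  have hM : 0 ≤ ‖κ‖ * ‖B‖ + ‖lam.restrict p u‖ * ‖B‖ * (A + 1) := by positivity
  -- κ and v do not involve h; only h varies with δ. The pairing with v is therefore bounded by a
  -- fixed multiple of δ.
  have hbd : ∀ δ : ℝ, 0 < δ →
      ‖⟪κ, v⟫_ℂ‖ ≤ (‖κ‖ * ‖B‖ + ‖lam.restrict p u‖ * ‖B‖ * (A + 1)) * δ := fun δ hδ => by
    choose h hh using fun i => Metric.denseRange_iff.1 lam.denseRange_toE2 (ξ i)
      (δ / (Fintype.card ι + 1)) (by positivity)
    have hsum : ∑ i, ‖lam.toE2 (h i) - ξ i‖ ≤ δ := by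
      refine (Finset.sum_le_card_nsmul _ _ (δ / (Fintype.card ι + 1)) fun i _ => ?_).trans ?_
      · rw [← dist_eq_norm, dist_comm]
        exact (hh i).le
      · rw [nsmul_eq_mul, Finset.card_univ, mul_div_left_comm]
        refine mul_le_of_le_one_right hδ.le ?_
        rw [div_le_one (by positivity)]
        linarith
    have h1 := hle h δ hδ hsum
    have h2 := (hdiff h).trans (mul_le_mul_of_nonneg_left hsum (norm_nonneg B))
    generalize lam.evalVec u (fun i => B (lam.toE2 (h i))) = v' at h1 h2
    have h4 : ‖⟪κ, v' - v⟫_ℂ‖ ≤ ‖κ‖ * (‖B‖ * δ) :=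
      (norm_inner_le_norm _ _).trans (mul_le_mul_of_nonneg_left h2 (norm_nonneg _))
    rw [← sub_sub_cancel v' v, inner_sub_right]
    refine (norm_sub_le _ _).trans ((add_le_add h1 h4).trans_eq ?_)
    ring
  generalize ‖κ‖ * ‖B‖ + ‖lam.restrict p u‖ * ‖B‖ * (A + 1) = M at hM hbd
  rw [← norm_le_zero_iff]
  refine le_of_forall_pos_le_add fun ε hε => (hbd (ε / (M + 1)) (by positivity)).trans ?_
  rw [zero_add, mul_div_assoc', div_le_iff₀ (by positivity)]
  nlinarith

/-- An approximate identity makes the products p * g dense among functions of C_c(G), which are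
dense in L²(G^u). -/
theorem eq_zero_of_forall_inner_restrict_conv {u : unitSpace G} {m : Lp ℂ 2 (lam.measure u)}
    (hm : ∀ p g : C_c(G, ℂ), ⟪lam.restrict (lam.convCc p g) u, m⟫_ℂ = 0) : m = 0 := by
  have hcl : IsClosed {w : Lp ℂ 2 (lam.measure u) | ⟪w, m⟫_ℂ = 0} :=
    isClosed_eq (by fun_prop) continuous_const
  have hCc : ∀ g : C_c(G, ℂ), ⟪lam.restrict g u, m⟫_ℂ = 0 := fun g => by
    refine hcl.closure_subset (Metric.mem_closure_iff.2 fun ε hε => ?_)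
    obtain ⟨e, -, he⟩ := lam.exists_approx_identity_Cc (fun _ : Unit => g) (half_pos hε)
    refine ⟨lam.restrict (lam.convCc e g) u, hm e g, ?_⟩
    rw [dist_comm, dist_eq_norm]
    have h := lam.norm_evalE2_le u (lam.toE2 (lam.convCc e g) - lam.toE2 g)
    rw [map_sub, evalE2_toE2, evalE2_toE2] at h
    exact (h.trans (he ())).trans_lt (half_lt_self hε)
  have hmm : ⟪m, m⟫_ℂ = 0 := by
    refine hcl.closure_subset (Metric.mem_closure_iff.2 fun ε hε => ?_)
    obtain ⟨g, hg⟩ := lam.exists_norm_sub_restrict_lt m hε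
    exact ⟨_, hCc g, by rwa [dist_eq_norm]⟩
  exact inner_self_eq_zero.1 hmm

theorem evalVec_mem_closure_translSpan {B : lam.E2 →L[ℂ] lam.E2} {η : lam.E2}
    (hB : ∀ f, B (lam.toE2 f) = lam.rightConv f η) (u : unitSpace G) (ξ : ι → lam.E2) :
    lam.evalVec u (fun i => B (ξ i)) ∈ (lam.translSpan u ξ).topologicalClosure := by
  classical
  refine mem_closure_of_coProjection_eq_zero ?_
  ext1 j
  refine lam.eq_zero_of_forall_inner_restrict_conv fun p g => ?_
  rw [← inner_single, ← inner_coProjection_left]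
  exact lam.inner_coProj_single_eq_zero hB u ξ j p g

end Tuples

/-! ### Approximation of commuting operators on a fibre -/

section Tuples

variable {ι : Type*} [Fintype ι]

theorem norm_toLp_lt {E : Type*} [NormedAddCommGroup E] {v : ι → E} {ε : ℝ} (hε : 0 < ε)
    (h : ∀ i, ‖v i‖ < ε / (Fintype.card ι + 1)) :
    ‖(WithLp.toLp 2 v : PiLp 2 fun _ : ι => E)‖ < ε := by
  refine (norm_toLp_le_sum v).trans_lt ((Finset.sum_le_card_nsmul _ _ _
    fun i _ => (h i).le).trans_lt ?_)
  rw [nsmul_eq_mul, Finset.card_univ, mul_div_assoc', div_lt_iff₀ (by positivity)]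
  linarith

/-- The map `F ↦ (F * ξ i)|_{G^u}`. -/
def evalVecLeftConv (u : unitSpace G) (ξ : ι → lam.E2) :
    C_c(G, ℂ) →ₗ[ℂ] PiLp 2 fun _ : ι => Lp ℂ 2 (lam.measure u) where
  toFun F := lam.evalVec u fun i => lam.leftConv F (ξ i)
  map_add' F F' := by
    simp only [evalVec, leftConv_add, add_apply, map_add]
    rfl
  map_smul' c F := by
    simp only [evalVec, leftConv_smul, smul_apply, map_smul]
    rfl

theorem translSpan_le (u : unitSpace G) (ξ : ι → lam.E2) :
    lam.translSpan u ξ ≤ (LinearMap.range (lam.evalVecLeftConv u ξ)).topologicalClosure := by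
  refine Submodule.span_le.2 ?_
  rintro _ ⟨y, rfl⟩
  refine Metric.mem_closure_iff.2 fun ε hε => ?_
  obtain ⟨F, hF⟩ := lam.exists_leftConv_near_translE2 y ξ
    (ε := ε / (Fintype.card ι + 1)) (by positivity)
  refine ⟨_, ⟨F, rfl⟩, ?_⟩
  rw [dist_comm, dist_eq_norm]
  exact norm_toLp_lt hε hF

theorem evalVec_mem_closure_of_mem_VN {T : lam.E2 →L[ℂ] lam.E2} (hT : T ∈ lam.VN)
    (u : unitSpace G) (ξ : ι → lam.E2) :
    lam.evalVec u (fun i => T (ξ i)) ∈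
      (LinearMap.range (lam.evalVecLeftConv u ξ)).topologicalClosure := by
  refine Submodule.topologicalClosure_minimal _ (lam.translSpan_le u ξ)
    (Submodule.isClosed_topologicalClosure _) ?_
  refine (Submodule.isClosed_topologicalClosure _).closure_subset
    (Metric.mem_closure_iff.2 fun ε hε => ?_)
  have hε' : 0 < ε / (Fintype.card ι + 1) / (‖T‖ + 1) := by positivity
  -- Since e * f = R_f e, commutation gives T L_e f = R_f (T e) on C_c(G). Thus T L_e is convolution
  -- with a fixed section, and it is close to T on the given ξ.
  obtain ⟨e, he⟩ := lam.exists_approx_identity ξ hε'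
  refine ⟨lam.evalVec u fun i => (T ∘L lam.leftConv e) (ξ i),
    lam.evalVec_mem_closure_translSpan (η := T (lam.toE2 e)) (fun f => ?_) u ξ, ?_⟩
  · rw [ContinuousLinearMap.comp_apply, leftConv_toE2, ← rightConv_toE2]
    exact DFunLike.congr_fun (hT f) (lam.toE2 e)
  · rw [dist_comm, dist_eq_norm]
    refine norm_toLp_lt hε fun i => ?_
    change ‖lam.evalE2 u (T (lam.leftConv e (ξ i))) - lam.evalE2 u (T (ξ i))‖ < _
    rw [← map_sub, ← map_sub]
    refine (lam.norm_evalE2_le u _).trans_lt ((T.le_opNorm _).trans_lt ?_)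
    have h := he i
    rw [lt_div_iff₀ (by positivity)] at h
    nlinarith [norm_nonneg (lam.leftConv e (ξ i) - ξ i), norm_nonneg T]

theorem exists_leftConv_near_apply {T : lam.E2 →L[ℂ] lam.E2} (hT : T ∈ lam.VN)
    (u : unitSpace G) (ξ : ι → lam.E2) {ε : ℝ} (hε : 0 < ε) :
    ∃ F, ∀ i, ‖lam.evalE2 u (T (ξ i) - lam.leftConv F (ξ i))‖ < ε := by
  obtain ⟨_, ⟨F, rfl⟩, hF⟩ := Metric.mem_closure_iff.1 (lam.evalVec_mem_closure_of_mem_VN hT u ξ)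
    ε hε
  rw [dist_eq_norm] at hF
  refine ⟨F, fun i => ?_⟩
  rw [map_sub]
  exact (PiLp.norm_apply_le (lam.evalVec u (fun i => T (ξ i)) - lam.evalVecLeftConv u ξ F) i).trans_lt
    hF

end Tuples

/-! ### From fibres to sections -/

/-- Fibre norms are continuous for sections from C_c(G), and approximation in E² is uniform over the
units. -/
theorem eventually_norm_evalE2_lt (ξ : lam.E2) {u : unitSpace G} {ε : ℝ}
    (h : ‖lam.evalE2 u ξ‖ < ε) : ∀ᶠ v in 𝓝 u, ‖lam.evalE2 v ξ‖ < ε := by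
  obtain ⟨f, hf⟩ := Metric.denseRange_iff.1 lam.denseRange_toE2 ξ ((ε - ‖lam.evalE2 u ξ‖) / 3)
    (by linarith)
  rw [dist_eq_norm] at hf
  have hle : ∀ v, ‖lam.evalE2 v ξ - lam.restrict f v‖ ≤ ‖ξ - lam.toE2 f‖ := fun v => by
    rw [← evalE2_toE2, ← map_sub]
    exact lam.norm_evalE2_le v _
  have hu : ‖lam.restrict f u‖ < ε - (ε - ‖lam.evalE2 u ξ‖) / 3 := by
    have := norm_le_norm_add_norm_sub (lam.evalE2 u ξ) (lam.restrict f u)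
    linarith [hle u]
  filter_upwards [(lam.continuous_norm_restrict f).continuousAt.eventually (gt_mem_nhds hu)]
    with v hv
  have := norm_le_norm_add_norm_sub' (lam.evalE2 v ξ) (lam.restrict f v)
  linarith [hle v]

theorem exists_isCompact_norm_evalE2_lt {ι : Type*} [Finite ι] (ξ : ι → lam.E2) {ε : ℝ}
    (hε : 0 < ε) : ∃ K : Set (unitSpace G), IsCompact K ∧ ∀ u ∉ K, ∀ i, ‖lam.evalE2 u (ξ i)‖ < ε := by
  have h : ∀ᶠ u in cocompact (unitSpace G), ∀ i, ‖lam.evalE2 u (ξ i)‖ < ε :=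
    eventually_all.2 fun i => (ξ i).2.2.eventually (gt_mem_nhds hε)
  obtain ⟨K, hK, hKξ⟩ := mem_cocompact.1 h
  exact ⟨K, hK, fun u hu => hKξ hu⟩

/-- In the convolution integral t has the same range as x, so b factors out. This is what allows
gluing over G⁰. -/
theorem convCc_mulRange (b : C(unitSpace G, ℝ)) (F f : C_c(G, ℂ)) :
    lam.convCc (mulRange b F) f = mulRange b (lam.convCc F f) := by
  ext x
  change ∫ t, (b (rangeUnit t) : ℂ) * F t * f (t⁻¹ * x) ∂lam.measure (rangeUnit x) =
    (b (rangeUnit x) : ℂ) * ∫ t, F t * f (t⁻¹ * x) ∂lam.measure (rangeUnit x)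
  rw [← integral_const_mul]
  refine integral_congr_ae ?_
  filter_upwards [lam.ae_r_eq (rangeUnit x)] with t ht
  rw [(rangeUnit_eq_iff t _).2 ht, _root_.mul_assoc]

theorem evalE2_leftConv_mulRange (b : C(unitSpace G, ℝ)) (F : C_c(G, ℂ)) (u : unitSpace G)
    (ξ : lam.E2) : lam.evalE2 u (lam.leftConv (mulRange b F) ξ) =
      (b u : ℂ) • lam.evalE2 u (lam.leftConv F ξ) := by
  have h : lam.evalE2 u ∘L lam.leftConv (mulRange b F) =
      (b u : ℂ) • (lam.evalE2 u ∘L lam.leftConv F) := lam.clm_ext fun f => by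
    simp only [ContinuousLinearMap.comp_apply, smul_apply, leftConv_toE2,
      convCc_mulRange, evalE2_toE2, restrict_mulRange]
  exact DFunLike.congr_fun h ξ

theorem exists_norm_leftConv_sub_lt {ι : Type*} [Finite ι] (ξ ζ : ι → lam.E2)
    (h : ∀ u : unitSpace G, ∀ ε : ℝ, 0 < ε →
      ∃ F, ∀ i, ‖lam.evalE2 u (ζ i - lam.leftConv F (ξ i))‖ < ε) {ε : ℝ} (hε : 0 < ε) :
    ∃ F, ∀ i, ‖lam.leftConv F (ξ i) - ζ i‖ < ε := by
  have hε2 : 0 < ε / 2 := half_pos hε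
  obtain ⟨K, hK, hKζ⟩ := lam.exists_isCompact_norm_evalE2_lt ζ hε2
  choose F hF using fun u => h u (ε / 2) hε2
  choose V hVF hVo hVu using fun u => eventually_nhds_iff.1
    (eventually_all.2 fun i => lam.eventually_norm_evalE2_lt _ (hF u i))
  obtain ⟨S, hS⟩ := hK.elim_nhds_subcover V fun u _ => (hVo u).mem_nhds (hVu u)
  obtain ⟨ρ, hρ, -⟩ := PartitionOfUnity.exists_isSubordinate_of_locallyFinite_t2space hK
    (fun j : S => V j) (fun j => hVo j) (locallyFinite_of_finite _)
    (fun x hx => by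
      obtain ⟨j, hj, hxj⟩ := mem_iUnion₂.1 (hS.2 hx)
      exact mem_iUnion.2 ⟨⟨j, hj⟩, hxj⟩)
  refine ⟨∑ j : S, mulRange (ρ j) (F j), fun i => ?_⟩
  rw [norm_sub_rev]
  refine lt_of_le_of_lt (lam.norm_le_of_evalE2 hε2.le fun u => ?_) (half_lt_self hε)
  have hsum1 : ∑ j : S, ρ j u ≤ 1 := by
    rw [← finsum_eq_sum_of_fintype]
    exact ρ.sum_le_one u
  -- The error splits into the local errors, weighted by ρ j and small on V j, and a multiple of ζ i
  -- whose coefficient vanishes on K, while ζ i is small off K.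
  have hdec : lam.evalE2 u (ζ i - lam.leftConv (∑ j : S, mulRange (ρ j) (F j)) (ξ i)) =
      ((1 - ∑ j : S, ρ j u : ℝ) : ℂ) • lam.evalE2 u (ζ i) +
        ∑ j : S, (ρ j u : ℂ) • lam.evalE2 u (ζ i - lam.leftConv (F j) (ξ i)) := by
    have e : lam.leftConv (∑ j : S, mulRange (ρ j) (F j)) =
        ∑ j : S, lam.leftConv (mulRange (ρ j) (F j)) := map_sum lam.leftConvₗ _ _
    simp only [e, sum_apply, map_sub, map_sum, evalE2_leftConv_mulRange,
      smul_sub, Finset.sum_sub_distrib, ← Finset.sum_smul]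
    push_cast
    rw [sub_smul, one_smul]
    abel
  have h1 : ‖((1 - ∑ j : S, ρ j u : ℝ) : ℂ) • lam.evalE2 u (ζ i)‖ ≤
      (1 - ∑ j : S, ρ j u) * (ε / 2) := by
    rw [norm_smul, Complex.norm_real, Real.norm_of_nonneg (by linarith)]
    by_cases hu : u ∈ K
    · have h2 : ∑ j : S, ρ j u = 1 := by
        rw [← finsum_eq_sum_of_fintype]
        exact ρ.sum_eq_one hu
      rw [h2]
      simp
    · exact mul_le_mul_of_nonneg_left (hKζ u hu i).le (by linarith)
  have h3 : ‖∑ j : S, (ρ j u : ℂ) • lam.evalE2 u (ζ i - lam.leftConv (F j) (ξ i))‖ ≤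
      (∑ j : S, ρ j u) * (ε / 2) := by
    rw [Finset.sum_mul]
    refine norm_sum_le_of_le _ fun j _ => ?_
    rw [norm_smul, Complex.norm_real, Real.norm_of_nonneg (ρ.nonneg j u)]
    by_cases hu : u ∈ V j
    · exact mul_le_mul_of_nonneg_left (hVF j u hu i).le (ρ.nonneg j u)
    · have h4 : ρ j u = 0 := by
        by_contra hne
        exact hu (hρ j (subset_tsupport _ hne))
      simp [h4]
  rw [hdec]
  refine (norm_add_le _ _).trans ((add_le_add h1 h3).trans_eq ?_)
  ring

theorem VN_subset_strongClosure : lam.VN ⊆ strongClosure (Set.range lam.leftConv) := by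
  refine fun T hT => mem_strongClosure fun J ε hε => ?_
  obtain ⟨F, hF⟩ := lam.exists_norm_leftConv_sub_lt (fun ξ : J => (ξ : lam.E2))
    (fun ξ => T ξ) (fun u ε hε => lam.exists_leftConv_near_apply hT u _ hε) hε
  exact ⟨_, ⟨F, rfl⟩, fun ξ hξ => hF ⟨ξ, hξ⟩⟩

end HaarSystem

end

theorem proposition18 {G : Type*} [TopologicalSpace G] [T2Space G] [LocallyCompactSpace G]
    [SecondCountableTopology G] [MeasurableSpace G] [BorelSpace G] [TopologicalGroupoid G]
    (lam : HaarSystem G) :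
    (∃ A : NonUnitalSubalgebra ℂ (lam.E2 →L[ℂ] lam.E2),
      (A : Set (lam.E2 →L[ℂ] lam.E2)) = Set.range lam.leftConv) ∧
    lam.VN = HaarSystem.strongClosure (Set.range lam.leftConv) :=
  ⟨lam.exists_nonUnitalSubalgebra_eq_range_leftConv,
    Set.Subset.antisymm lam.VN_subset_strongClosure lam.strongClosure_subset_VN⟩
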